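/- Throughout, subscripts $x,y$ denote partial derivatives. Let $\varphi,\psi$ be real functions that are $C^4$ on an open set $U\subseteq\mathbb R^2$, with nonvanishing Jacobian $\Delta=\varphi_x\psi_y-\varphi_y\psi_x$ on $U$, and consider the point transformation $t=\varphi(x,y)$, $u=\psi(x,y)$. Let $\Omega$ be a set of jets $(x,y,y',y'',y''')$ with $(x,y)\in U$ and $\varphi_x+y'\varphi_y\neq 0$, and let $f:\Omega\to\mathbb R$. We say that the equation $$y^{(4)}=f(x,y,y',y'',y''')\qquad(*)$$ is obtained on $\Omega$ from the linear equation $u^{(4)}+a_3(t)u'''+a_2(t)u''+a_1(t)u'+a_0(t)u=b(t)$ by this transformation if, whenever $y$ is $C^4$ near $x_0$, $u$ is $C^4$ near $t_0=\varphi(x_0,y(x_0))$, $u(\varphi(x,y(x)))=\psi(x,y(x))$ for all $x$ near $x_0$, and the jet of $y$ at $x_0$ lies in $\Omega$, equation $(*)$ holds for $y$ at $x_0$ if and only if the linear equation holds for $u$ at $t_0$. No regularity of $f$ and of the coefficients of the linear equation is needed. Consider the two classes of equations $$y^{(4)}+(A_1y'+A_0)y'''+B_0y''^2+(C_2y'^2+C_1y'+C_0)y''+D_4y'^4+D_3y'^3+D_2y'^2+D_1y'+D_0=0,\qquad(\mathrm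 I)$$ $$y^{(4)}+\frac{-10y''+F_2y'^2+F_1y'+F_0}{y'+r}\,y'''+\frac{1}{(y'+r)^2}\Big[15y''^3+(H_2y'^2+H_1y'+H_0)y''^2+(J_4y'^4+J_3y'^3+J_2y'^2+J_1y'+J_0)y''+\sum_{i=0}^{7}K_iy'^i\Big]=0,\qquad(\mathrm{II})$$ whose coefficients are functions of $(x,y)$. **Part 1 (the two candidates).** Suppose $(*)$ is obtained on $\Omega$ from a linear fourth-order equation by the transformation. If $\varphi_y=0$ on $U$, then $(*)$ is of the form (I) on $\Omega$. If $\varphi_y\neq0$ everywhere on $U$, then $y'+r\ne 0$ on $\Omega$ and $(*)$ is of the form (II) on $\Omega$ with $r=\varphi_x/\varphi_y$. For arbitrary $\varphi$ there is a dense open subset $W$ of $U$ each of whose points has an open neighbourhood $V\subseteq W$ such that $(*)$ is of the form (I) or of the form (II) on the part of $\Omega$ over $V$. In all cases $(*)$ is linear in $y'''$: there are functions $G,H$ of $(x,y,y',y'')$ with $f=G\,y'''+H$ on $\Omega$. **Part 2 (the coefficients).** Suppose the linear equation is in Laguerre's form $u^{(4)}+\alpha(t)u'+\beta(t)u=0$.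 Below, $\alpha,\beta$ stand for $\alpha(\varphi(x,y)),\beta(\varphi(x,y))$. If $\varphi_y=0$ on $U$, then $(*)$ is, on $\Omega$, equation (I) with $$A_{1} = 4(\psi_{y})^{-1}\psi_{yy}$$ $$A_{0} = -2(\varphi_{x}\psi_{y})^{-1}(3\varphi_{xx}\psi_{y} - 2\varphi_{x}\psi_{xy})$$ $$B_{0} = 3(\psi_{y})^{-1}\psi_{yy}$$ $$C_{2} = 6(\psi_{y})^{-1}\psi_{yyy}$$ $$C_{1} = -6(\varphi_{x}\psi_{y})^{-1}(3\varphi_{xx}\psi_{yy} - 2\varphi_{x}\psi_{xyy})$$ $$C_{0} = -(\varphi_{x}^2\psi_{y})^{-1}((4\varphi_{xxx}\varphi_{x} - 15\varphi_{xx}^2)\psi_{y} + 6(3\varphi_{xx}\psi_{xy} - \varphi_{x}\psi_{xxy})\varphi_{x})$$ $$D_{4} = (\psi_{y})^{-1}\psi_{yyyy}$$ $$D_{3} = -2(\varphi_{x}\psi_{y})^{-1}(3\varphi_{xx}\psi_{yyy} - 2\varphi_{x}\psi_{xyyy})$$ $$D_{2} = -(\varphi_{x}^2\psi_{y})^{-1}(4\varphi_{xxx}\varphi_{x}\psi_{yy}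 - 15\varphi_{xx}^2\psi_{yy} + 18\varphi_{xx}\varphi_{x}\psi_{xyy} - 6\varphi_{x}^2\psi_{xxyy})$$ $$D_{1} = -(\varphi_{x}^3\psi_{y})^{-1}(3(5\varphi_{xx}^2\psi_{y} - 10\varphi_{xx}\varphi_{x}\psi_{xy} + 6\varphi_{x}^2\psi_{xxy})\varphi_{xx} -(\varphi_{x}^3\psi_{y}\alpha + 4\psi_{xxxy})\varphi_{x}^3 - 2(5\varphi_{xx}\psi_{y} - 4\varphi_{x}\psi_{xy})\varphi_{xxx}\varphi_{x} + \varphi_{xxxx}\varphi_{x}^2\psi_{y})$$ $$D_{0} = -(\varphi_{x}^3\psi_{y})^{-1}((15\varphi_{xx}^3 - \varphi_{x}^6\alpha + \varphi_{xxxx}\varphi_{x}^2)\psi_{x} - (10\varphi_{xxx}\varphi_{xx}\psi_{x} - 4\varphi_{xxx}\varphi_{x}\psi_{xx} + 15\varphi_{xx}^2\psi_{xx} - 6\varphi_{xx}\varphi_{x}\psi_{xxx} + \varphi_{x}^6\beta\psi + \varphi_{x}^2\psi_{xxxx})\varphi_{x})$$ If $\varphi_y\neq0$ everywhere on $U$,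 then, with $r=\varphi_x/\varphi_y$, $y'+r\neq0$ on $\Omega$ and $(*)$ is, on $\Omega$, equation (II) with $$F_{2} = -2(\varphi_{y}\Delta)^{-1}(5\varphi_{yy}\Delta - 2\varphi_{y}\Delta_{y})$$ $$F_{1} = 4(\varphi_{y}\Delta)^{-1}((\Delta_{x} + \Delta_{y}r -5r_{y}\Delta)\varphi_{y} - 5\varphi_{yy}r\Delta)$$ $$F_{0} = -2(\varphi_{y}\Delta)^{-1}(((5r_{y}\Delta - 2\Delta_{x})r + 5r_{x}\Delta)\varphi_{y} + 5\varphi_{yy}r^2\Delta)$$ $$H_{2} = 6(\varphi_{y}\Delta)^{-1}(5\varphi_{yy}\Delta - 2\varphi_{y}\Delta_{y})$$ $$H_{1} = -3(\varphi_{y}\Delta)^{-1}((5\Delta_{x} + 3\Delta_{y}r - 25r_{y}\Delta)\varphi_{y} - 20\varphi_{yy}r\Delta)$$ $$H_{0} = 3(\varphi_{y}\Delta)^{-1}((5(3r_{x} + 2r_{y}r)\Delta - (5\Delta_{x} - \Delta_{y}r)r)\varphi_{y} + 10\varphi_{yy}r^2\Delta)$$ $$J_{4} = -(\varphi_{y}^2\Delta)^{-1}(10\varphi_{yyy}\varphi_{y}\Delta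 - 45\varphi_{yy}^2\Delta + 30\varphi_{yy}\varphi_{y}\Delta_{y} - 6\varphi_{y}^2\Delta_{yy})$$ $$J_{3} = 2(\varphi_{y}^2\Delta)^{-1}(3((2(\Delta_{xy} + \Delta_{yy}r - 5r_{y}\Delta_{y}) - 5r_{yy}\Delta)\varphi_{y}^2 - 5((\Delta_{x} + 3\Delta_{y}r - 4r_{y}\Delta)\varphi_{y} - 6\varphi_{yy}r\Delta)\varphi_{yy}) - 20\varphi_{yyy}\varphi_{y}r\Delta)$$ $$J_{2} = 6(\varphi_{y}^2\Delta)^{-1}((\Delta_{xx} + \Delta_{yy}r^2 + 4\Delta_{xy}r - 5(2\Delta_{x} + 3\Delta_{y}r - 5r_{y}\Delta)r_{y} - 10r_{yy}r\Delta - 5r_{x}\Delta_{y} - 5r_{xy}\Delta)\varphi_{y}^2 - 5(((3(\Delta_{x} + \Delta_{y}r) - 10r_{y}\Delta)r - 2r_{x}\Delta)\varphi_{y} - 9\varphi_{yy}r^2\Delta)\varphi_{yy} - 10\varphi_{yyy}\varphi_{y}r^2\Delta)$$ $$J_{1} = -2(\varphi_{y}^2\Delta)^{-1}(((5(3(3\Delta_{x}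 + \Delta_{y}r) - 14r_{y}\Delta)r_{y} - 6(\Delta_{xy}r + \Delta_{xx}) + 20r_{yy}r\Delta)r + 5(3(\Delta_{x} + \Delta_{y}r) - 16r_{y}\Delta)r_{x} + 5r_{xx}\Delta + 20r_{xy}r\Delta)\varphi_{y}^2 + 15(((3\Delta_{x} + \Delta_{y}r - 8r_{y}\Delta)r - 4r_{x}\Delta)\varphi_{y} - 6\varphi_{yy}r^2\Delta)\varphi_{yy}r + 20\varphi_{yyy}\varphi_{y}r^3\Delta)$$ $$J_{0} = -(\varphi_{y}^2\Delta)^{-1}(((2((5r_{yy}r\Delta - 3\Delta_{xx})r + 5r_{xx}\Delta + 5r_{xy}r\Delta) - 5(7r_{y}\Delta - 6\Delta_{x})r_{y}r)r - 5(2(7r_{y}\Delta - 3\Delta_{x})r + 9r_{x}\Delta)r_{x})\varphi_{y}^2 - 5(3(2((2r_{y}\Delta - \Delta_{x})r + 2r_{x}\Delta)\varphi_{y} + 3\varphi_{yy}r^2\Delta)\varphi_{yy} - 2\varphi_{yyy}\varphi_{y}r^2\Delta)r^2)$$ $$K_{7} = -(\varphi_{y}^2\Delta)^{-1}(\varphi_{yyyy}\varphi_{y}^2\psi_{y}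 - 10\varphi_{yyy}\varphi_{yy}\varphi_{y}\psi_{y} + 4\varphi_{yyy}\varphi_{y}^2\psi_{yy} + 15\varphi_{yy}^3\psi_{y} - 15\varphi_{yy}^2\varphi_{y}\psi_{yy} + 6\varphi_{yy}\varphi_{y}^2\psi_{yyy} - \varphi_{y}^7\beta\psi - \varphi_{y}^6\psi_{y}\alpha - \varphi_{y}^3\psi_{yyyy})$$ $$K_{6} = (\varphi_{y}^3\Delta)^{-1}(3(5((7\varphi_{y}\psi_{yy}r - 6\Delta_{y})\varphi_{y} - 7(\varphi_{y}\psi_{y}r - \Delta)\varphi_{yy})\varphi_{yy} - 2(7\varphi_{y}\psi_{yyy}r - 5\Delta_{yy})\varphi_{y}^2)\varphi_{yy} + (7\varphi_{y}^5 \beta \psi r + 7\varphi_{y}^4\psi_{y}\alpha r - \varphi_{y}^3\alpha\Delta + 7\varphi_{y}\psi_{yyyy}r - 4\Delta_{yyy})\varphi_{y}^3 + 2(35\varphi_{yy}\varphi_{y}\psi_{y}r - 30\varphi_{yy}\Delta - 14\varphi_{y}^2\psi_{yy}r + 10\varphi_{y}\Delta_{y})\varphi_{yyy}\varphi_{y}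 - (7\varphi_{y}\psi_{y}r - 5\Delta)\varphi_{yyyy}\varphi_{y}^2)$$ $$K_{5} = -(\varphi_{y}^3\Delta)^{-1}((2(3(\Delta_{xyy} + 3\Delta_{yyy}r - 5r_{y}\Delta_{yy} - 5r_{yy}\Delta_{y}) - 5r_{yyy}\Delta) - 3(7\varphi_{y}^4\beta\psi r + 7\varphi_{y}^3\psi_{y}\alpha r - 2\varphi_{y}^2\alpha\Delta + 7\psi_{yyyy}r)\varphi_{y}r)\varphi_{y}^3 - 3(2(5(\Delta_{xy} + 5\Delta_{yy}r - 4r_{y}\Delta_{y} - 2r_{yy}\Delta) - 21\varphi_{y}\psi_{yyy}r^2)\varphi_{y}^2 - 15((\Delta_{x} + 11\Delta_{y}r - 3r_{y}\Delta - 7\varphi_{y}\psi_{yy}r^2)\varphi_{y} + 7(\varphi_{y}\psi_{y}r - 2\Delta)\varphi_{yy}r)\varphi_{yy})\varphi_{yy} - 2((5(\Delta_{x} + 11\Delta_{y}r - 3r_{y}\Delta) - 42\varphi_{y}\psi_{yy}r^2)\varphi_{y} + 15(7\varphi_{y}\psi_{y}r - 12\Delta)\varphi_{yy}r)\varphi_{yyy}\varphi_{y}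 + 3(7\varphi_{y}\psi_{y}r - 10\Delta)\varphi_{yyyy}\varphi_{y}^2r)$$ $$K_{4} = -(\varphi_{y}^3\Delta)^{-1}((2(45r_{yy}r_{y}\Delta - 10r_{yy}\Delta_{x} - 55r_{yy}\Delta_{y}r + 50r_{y}^2\Delta_{y} - 20r_{y}\Delta_{xy} - 50r_{y}\Delta_{yy}r + 11\Delta_{xyy}r + 2\Delta_{xxy} + 17\Delta_{yyy}r^2 - 20r_{yyy}r\Delta - 5r_{x}\Delta_{yy} - 10r_{xy}\Delta_{y} - 5r_{xyy}\Delta) - 5(7\varphi_{y}^4\beta\psi r + 7\varphi_{y}^3\psi_{y}\alpha r - 3\varphi_{y}^2\alpha\Delta + 7\psi_{yyyy}r)\varphi_{y}r^2)\varphi_{y}^3 + 15((3((5(\Delta_{x} + 5\Delta_{y}r) - 14r_{y}\Delta)r - r_{x}\Delta) - 35\varphi_{y}\psi_{yy}r^3)\varphi_{y} + 35(\varphi_{y}\psi_{y}r - 3\Delta)\varphi_{yy}r^2)\varphi_{yy}^2 - 10(\Delta_{xx} + 31\Delta_{yy}r^2 + 13\Delta_{xy}r - 8(\Delta_{x} +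 6\Delta_{y}r - 2r_{y}\Delta)r_{y} - 26r_{yy}r\Delta - 4r_{x}\Delta_{y} - 4r_{xy}\Delta - 21\varphi_{y}\psi_{yyy}r^3)\varphi_{yy}\varphi_{y}^2 - 10(((5(\Delta_{x} + 5\Delta_{y}r) - 14r_{y}\Delta)r - r_{x}\Delta - 14\varphi_{y}\psi_{yy}r^3)\varphi_{y} + 5(7\varphi_{y}\psi_{y}r - 18\Delta)\varphi_{yy}r^2)\varphi_{yyy}\varphi_{y} + 5(7\varphi_{y}\psi_{y}r - 15\Delta)\varphi_{yyyy}\varphi_{y}^2r^2)$$ $$K_{3} = -(\varphi_{y}^3\Delta)^{-1}(((13\Delta_{xxy} + 35\Delta_{yyy}r^2)r + \Delta_{xxx} + 31\Delta_{xyy}r^2 - 5(3\Delta_{xx} + 26\Delta_{yy}r^2 + 23\Delta_{xy}r - (15\Delta_{x} + 49\Delta_{y}r - 25r_{y}\Delta)r_{y})r_{y} - 5(13\Delta_{x} + 32\Delta_{y}r - 50r_{y}\Delta)r_{yy}r - 65r_{yyy}r^2\Delta - 5(3\Delta_{xy} + 5\Delta_{yy}r - 16r_{y}\Delta_{y} -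 7r_{yy}\Delta)r_{x} - 5r_{xx}\Delta_{y} - 5r_{xxy}\Delta - 5(3\Delta_{x} + 11\Delta_{y}r - 15r_{y}\Delta)r_{xy} - 30r_{xyy}r\Delta - 5(7\varphi_{y}^4\beta\psi r + 7\varphi_{y}^3\psi_{y}\alpha r - 4\varphi_{y}^2\alpha\Delta + 7\psi_{yyyy}r)\varphi_{y}r^3)\varphi_{y}^3 - 5(2((2(2\Delta_{xx} + 17\Delta_{yy}r^2 + 11\Delta_{xy}r) - (29\Delta_{x} + 75\Delta_{y}r - 51r_{y}\Delta)r_{y} - 45r_{yy}r\Delta)r - (3\Delta_{x} + 13\Delta_{y}r - 13r_{y}\Delta)r_{x} - r_{xx}\Delta - 14r_{xy}r\Delta - 21\varphi_{y}\psi_{yyy}r^4)\varphi_{y}^2 - 3((6((5(\Delta_{x} + 3\Delta_{y}r) - 13r_{y}\Delta)r - 2r_{x}\Delta) - 35\varphi_{y}\psi_{yy}r^3)\varphi_{y} + 35(\varphi_{y}\psi_{y}r - 4\Delta)\varphi_{yy}r^2)\varphi_{yy}r)\varphi_{yy} - 10(2((5(\Delta_{x} + 3\Delta_{y}r) - 13r_{y}\Delta)r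 - 2r_{x}\Delta - 7\varphi_{y}\psi_{yy}r^3)\varphi_{y} + 5(7\varphi_{y}\psi_{y}r - 24\Delta)\varphi_{yy}r^2)\varphi_{yyy}\varphi_{y}r + 5(7\varphi_{y}\psi_{y}r - 20\Delta)\varphi_{yyyy}\varphi_{y}^2r^3)$$ $$K_{2} = -(\varphi_{y}^3\Delta)^{-1}(((3((5\Delta_{xxy} + 7\Delta_{yyy}r^2)r + \Delta_{xxx} + 7\Delta_{xyy}r^2) - (3(13\Delta_{xx} + 28\Delta_{yy}r^2 + 39\Delta_{xy}r) + (204r_{y}\Delta - 161\Delta_{x} - 217\Delta_{y}r)r_{y})r_{y} - (79\Delta_{x} + 116\Delta_{y}r - 264r_{y}\Delta)r_{yy}r - 54r_{yyy}r^2\Delta)r - (3(2\Delta_{xx} + 7\Delta_{yy}r^2 + 11\Delta_{xy}r) + (171r_{y}\Delta - 64\Delta_{x} - 140\Delta_{y}r)r_{y} - 72r_{yy}r\Delta - 18r_{x}\Delta_{y})r_{x} - (4\Delta_{x} + 11\Delta_{y}r - 21r_{y}\Delta)r_{xx} - 12r_{xxy}r\Delta - r_{xxx}\Delta - ((37\Delta_{x}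 + 53\Delta_{y}r - 150r_{y}\Delta)r - 33r_{x}\Delta)r_{xy} - 33r_{xyy}r^2\Delta - 3(7\varphi_{y}^4\beta\psi r + 7\varphi_{y}^3\psi_{y}\alpha r - 5\varphi_{y}^2\alpha\Delta + 7\psi_{yyyy}r)\varphi_{y}r^4)\varphi_{y}^3 - 3(2(5((2\Delta_{xx} + 7\Delta_{yy}r^2 + 6\Delta_{xy}r - (13\Delta_{x} + 19\Delta_{y}r - 20r_{y}\Delta)r_{y} - 13r_{yy}r\Delta)r^2 - ((3\Delta_{x} + 5\Delta_{y}r - 11r_{y}\Delta)r - r_{x}\Delta)r_{x} - r_{xx}r\Delta - 6r_{xy}r^2\Delta) - 21\varphi_{y}\psi_{yyy}r^5)\varphi_{y}^2 - 15((2((5(\Delta_{x} + 2\Delta_{y}r) - 12r_{y}\Delta)r - 3r_{x}\Delta) - 7\varphi_{y}\psi_{yy}r^3)\varphi_{y} + 7(\varphi_{y}\psi_{y}r - 5\Delta)\varphi_{yy}r^2)\varphi_{yy}r^2)\varphi_{yy} - 2(2(5((5(\Delta_{x} + 2\Delta_{y}r) - 12r_{y}\Delta)r - 3r_{x}\Delta)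 - 21\varphi_{y}\psi_{yy}r^3)\varphi_{y} + 15(7\varphi_{y}\psi_{y}r - 30\Delta)\varphi_{yy}r^2)\varphi_{yyy}\varphi_{y}r^2 + 3(7\varphi_{y}\psi_{y}r - 25\Delta)\varphi_{yyyy}\varphi_{y}^2r^4)$$ $$K_{1} = -(\varphi_{y}^3\Delta)^{-1}(((7(\Delta_{xxy} + \Delta_{yyy}r^2)r + 3\Delta_{xxx} + 7\Delta_{xyy}r^2 - (33\Delta_{xx} + 28\Delta_{yy}r^2 + 49\Delta_{xy}r + 2(59r_{y}\Delta - 56\Delta_{x} - 42\Delta_{y}r)r_{y})r_{y} - (43\Delta_{x} + 42\Delta_{y}r - 128r_{y}\Delta)r_{yy}r - 23r_{yyy}r^2\Delta)r^2 - ((12\Delta_{xx} + 7\Delta_{yy}r^2 + 21\Delta_{xy}r + 2(86r_{y}\Delta - 49\Delta_{x} - 35\Delta_{y}r)r_{y} - 49r_{yy}r\Delta)r + (85r_{y}\Delta - 15\Delta_{x} - 21\Delta_{y}r)r_{x})r_{x} - ((8\Delta_{x} + 7\Delta_{y}r - 32r_{y}\Delta)r - 10r_{x}\Delta)r_{xx}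 - 9r_{xxy}r^2\Delta - 2r_{xxx}r\Delta - ((29\Delta_{x} + 21\Delta_{y}r - 95r_{y}\Delta)r - 46r_{x}\Delta)r_{xy}r - 16r_{xyy}r^3\Delta - (7\varphi_{y}^4\beta\psi r + 7\varphi_{y}^3\psi_{y}\alpha r - 6\varphi_{y}^2\alpha\Delta + 7\psi_{yyyy}r)\varphi_{y}r^5)\varphi_{y}^3 - (2(5((4\Delta_{xx} + 7\Delta_{yy}r^2 + 7\Delta_{xy}r - (23\Delta_{x} + 21\Delta_{y}r - 31r_{y}\Delta)r_{y} - 17r_{yy}r\Delta)r^2 - ((9\Delta_{x} + 7\Delta_{y}r - 27r_{y}\Delta)r - 6r_{x}\Delta)r_{x} - 3r_{xx}r\Delta - 10r_{xy}r^2\Delta) - 21\varphi_{y}\psi_{yyy}r^5)\varphi_{y}^2 - 15((3((5\Delta_{x} + 7\Delta_{y}r - 11r_{y}\Delta)r - 4r_{x}\Delta) - 7\varphi_{y}\psi_{yy}r^3)\varphi_{y} + 7(\varphi_{y}\psi_{y}r - 6\Delta)\varphi_{yy}r^2)\varphi_{yy}r^2)\varphi_{yy}r - 2((5((5\Delta_{x}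 + 7\Delta_{y}r - 11r_{y}\Delta)r - 4r_{x}\Delta) - 14\varphi_{y}\psi_{yy}r^3)\varphi_{y} + 5(7\varphi_{y}\psi_{y}r - 36\Delta)\varphi_{yy}r^2)\varphi_{yyy}\varphi_{y}r^3 + (7\varphi_{y}\psi_{y}r - 30\Delta)\varphi_{yyyy}\varphi_{y}^2r^5)$$ $$K_{0} = (\varphi_{y}^3\Delta)^{-1}(((((2(r_{xxy} + 2r_{yyy}r^2)r + r_{xxx} + 3r_{xyy}r^2)\Delta + 3(3\Delta_{x} + 2\Delta_{y}r - 8r_{y}\Delta)r_{yy}r^2)r - ((10r_{x} + 11r_{y}r)\Delta - (4\Delta_{x} + \Delta_{y}r)r)r_{xx} - ((13r_{x} + 20r_{y}r)\Delta - (7\Delta_{x} + 3\Delta_{y}r)r)r_{xy}r + ((\varphi_{y}^4\beta\psi + \varphi_{y}^3\psi_{y}\alpha + \psi_{yyyy})r - \varphi_{y}^2\alpha\Delta)\varphi_{y}r^5 + (9\Delta_{xx} + 4\Delta_{yy}r^2 + 7\Delta_{xy}r - 2(13\Delta_{x} + 6\Delta_{y}r - 12r_{y}\Delta)r_{y})r_{y}r^2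 - ((\Delta_{xxy} + \Delta_{yyy}r^2)r + \Delta_{xxx} + \Delta_{xyy}r^2)r^2)r - ((2((17\Delta_{x} + 5\Delta_{y}r - 23r_{y}\Delta)r_{y} + 6r_{yy}r\Delta) - (6\Delta_{xx} + \Delta_{yy}r^2 + 3\Delta_{xy}r))r^2 - (5(3r_{x} + 8r_{y}r)\Delta - 3(5\Delta_{x} + \Delta_{y}r)r)r_{x})r_{x})\varphi_{y}^3 - ((2((5(r_{xx} + 3r_{yy}r^2 + 2r_{xy}r)\Delta + 3\varphi_{y}\psi_{yyy}r^4 + 5(5\Delta_{x} + 3\Delta_{y}r - 6r_{y}\Delta)r_{y}r - 5(\Delta_{xx} + \Delta_{yy}r^2 + \Delta_{xy}r)r)r - 5((3r_{x} + 7r_{y}r)\Delta - (3\Delta_{x} + \Delta_{y}r)r)r_{x})\varphi_{y}^2 - 15((3(r_{x} + 2r_{y}r)\Delta + \varphi_{y}\psi_{yy}r^3 - 3(\Delta_{x} + \Delta_{y}r)r)\varphi_{y} - (\varphi_{y}\psi_{y}r - 7\Delta)\varphi_{yy}r^2)\varphi_{yy}r^2)\varphi_{yy} + (2((5(r_{x}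 + 2r_{y}r)\Delta + 2\varphi_{y}\psi_{yy}r^3 - 5(\Delta_{x} + \Delta_{y}r)r)\varphi_{y} - 5(\varphi_{y}\psi_{y}r - 6\Delta)\varphi_{yy}r^2)\varphi_{yyy} + (\varphi_{y}\psi_{y}r - 5\Delta)\varphi_{yyyy}\varphi_{y}r^2)\varphi_{y}r^2)r^2)$$ -/

import Mathlib

noncomputable section

namespace FourthOrder

/-- Partial derivative of a function of two variables in the first variable. -/
def dx (g : ℝ → ℝ → ℝ) : ℝ → ℝ → ℝ := fun x y => deriv (fun s => g s y) x

/-- Partial derivative of a function of two variables in the second variable. -/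
def dy (g : ℝ → ℝ → ℝ) : ℝ → ℝ → ℝ := fun x y => deriv (fun s => g x s) y

/-- The Jacobian `Δ = φ_x ψ_y - φ_y ψ_x` of the change of variables `t = φ(x,y)`, `u = ψ(x,y)`. -/
def jacobian (phi psi : ℝ → ℝ → ℝ) : ℝ → ℝ → ℝ :=
  fun x y => dx phi x y * dy psi x y - dy phi x y * dx psi x y

/-- The function `r = φ_x / φ_y` (used only where `φ_y ≠ 0`). -/
def ratio (phi : ℝ → ℝ → ℝ) : ℝ → ℝ → ℝ := fun x y => dx phi x y / dy phi x y

/-- `t = φ(x,y)`, `u = ψ(x,y)` is a point transformation on the open set `U` of the `(x,y)`-plane: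
both functions are four times continuously differentiable and the Jacobian vanishes nowhere. -/
structure IsPointTransformation (U : Set (ℝ × ℝ)) (phi psi : ℝ → ℝ → ℝ) : Prop where
  isOpen : IsOpen U
  contDiffOn_phi : ContDiffOn ℝ 4 (fun z : ℝ × ℝ => phi z.1 z.2) U
  contDiffOn_psi : ContDiffOn ℝ 4 (fun z : ℝ × ℝ => psi z.1 z.2) U
  jacobian_ne_zero : ∀ x y, (x, y) ∈ U → jacobian phi psi x y ≠ 0

/-- The jets `(x, y, y', y'', y''')` over `U` at which `φ_x + y' φ_y ≠ 0`, that is, at which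
`t = φ(x, y(x))` can serve as the new independent variable along the graph of `y`. -/
def regularJets (U : Set (ℝ × ℝ)) (phi : ℝ → ℝ → ℝ) : Set (ℝ × ℝ × ℝ × ℝ × ℝ) :=
  {j | (j.1, j.2.1) ∈ U ∧ dx phi j.1 j.2.1 + j.2.2.1 * dy phi j.1 j.2.1 ≠ 0}

/-- The equation `y⁗ = f(x, y, y', y'', y''')`, considered on the set `Ω` of jets, is obtained from
the linear equation `u⁗ + a₃(t) u''' + a₂(t) u'' + a₁(t) u' + a₀(t) u = b(t)` by the change of
variables `t = φ(x,y)`, `u = ψ(x,y)`: whenever the graph of `y` near a point `x₀` is carried to the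
graph of `u`, the equation for `y` holds at `x₀` if and only if the linear equation for `u`
holds at `t₀ = φ(x₀, y(x₀))`. -/
def ObtainedFromLinear (Ω : Set (ℝ × ℝ × ℝ × ℝ × ℝ)) (f : ℝ × ℝ × ℝ × ℝ × ℝ → ℝ)
    (phi psi : ℝ → ℝ → ℝ) (a₃ a₂ a₁ a₀ b : ℝ → ℝ) : Prop :=
  ∀ (x₀ t₀ : ℝ) (y u : ℝ → ℝ),
    t₀ = phi x₀ (y x₀) →
    ContDiffAt ℝ 4 y x₀ → ContDiffAt ℝ 4 u t₀ →
    (∀ᶠ x in nhds x₀, u (phi x (y x)) = psi x (y x)) →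
    (x₀, y x₀, iteratedDeriv 1 y x₀, iteratedDeriv 2 y x₀, iteratedDeriv 3 y x₀) ∈ Ω →
    (iteratedDeriv 4 y x₀ =
        f (x₀, y x₀, iteratedDeriv 1 y x₀, iteratedDeriv 2 y x₀, iteratedDeriv 3 y x₀) ↔
      iteratedDeriv 4 u t₀ + a₃ t₀ * iteratedDeriv 3 u t₀ + a₂ t₀ * iteratedDeriv 2 u t₀
        + a₁ t₀ * iteratedDeriv 1 u t₀ + a₀ t₀ * u t₀ = b t₀)

/-- The same for a linear equation in Laguerre's form `u⁗ + α(t) u' + β(t) u = 0`. -/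
def ObtainedFromLaguerre (Ω : Set (ℝ × ℝ × ℝ × ℝ × ℝ)) (f : ℝ × ℝ × ℝ × ℝ × ℝ → ℝ)
    (phi psi : ℝ → ℝ → ℝ) (a b : ℝ → ℝ) : Prop :=
  ObtainedFromLinear Ω f phi psi (fun _ => 0) (fun _ => 0) a b (fun _ => 0)

/-- The coefficients of an equation of the first class. -/
structure FirstCoeffs where
  (A₁ A₀ B₀ C₂ C₁ C₀ D₄ D₃ D₂ D₁ D₀ : ℝ → ℝ → ℝ)

/-- The coefficients of an equation of the second class. -/
structure SecondCoeffs where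
  (r F₂ F₁ F₀ H₂ H₁ H₀ J₄ J₃ J₂ J₁ J₀ K₇ K₆ K₅ K₄ K₃ K₂ K₁ K₀ : ℝ → ℝ → ℝ)

/-- On `Ω`, the equation `y⁗ = f` is the equation
`y⁗ + (A₁y' + A₀)y''' + B₀y''² + (C₂y'² + C₁y' + C₀)y'' + D₄y'⁴ + D₃y'³ + D₂y'² + D₁y' + D₀ = 0`.
Here `p, q, s` stand for `y', y'', y'''`. -/
def HasFirstForm (Ω : Set (ℝ × ℝ × ℝ × ℝ × ℝ)) (f : ℝ × ℝ × ℝ × ℝ × ℝ → ℝ)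
    (c : FirstCoeffs) : Prop :=
  ∀ x y p q s : ℝ, (x, y, p, q, s) ∈ Ω →
    f (x, y, p, q, s) + (c.A₁ x y * p + c.A₀ x y) * s + c.B₀ x y * q ^ 2
      + (c.C₂ x y * p ^ 2 + c.C₁ x y * p + c.C₀ x y) * q
      + c.D₄ x y * p ^ 4 + c.D₃ x y * p ^ 3 + c.D₂ x y * p ^ 2 + c.D₁ x y * p + c.D₀ x y = 0

/-- On `Ω`, one has `y' + r ≠ 0` and the equation `y⁗ = f` is the equation
`y⁗ + (-10y'' + F₂y'² + F₁y' + F₀)y''' / (y' + r) + [15y''³ + (H₂y'² + H₁y' + H₀)y''²`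
`+ (J₄y'⁴ + ⋯ + J₀)y'' + K₇y'⁷ + ⋯ + K₀] / (y' + r)² = 0`.
Here `p, q, s` stand for `y', y'', y'''`. -/
def HasSecondForm (Ω : Set (ℝ × ℝ × ℝ × ℝ × ℝ)) (f : ℝ × ℝ × ℝ × ℝ × ℝ → ℝ)
    (c : SecondCoeffs) : Prop :=
  ∀ x y p q s : ℝ, (x, y, p, q, s) ∈ Ω →
    p + c.r x y ≠ 0 ∧
    f (x, y, p, q, s)
      + 1 / (p + c.r x y) * (-10 * q + c.F₂ x y * p ^ 2 + c.F₁ x y * p + c.F₀ x y) * s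
      + 1 / (p + c.r x y) ^ 2 *
        (15 * q ^ 3 + (c.H₂ x y * p ^ 2 + c.H₁ x y * p + c.H₀ x y) * q ^ 2
          + (c.J₄ x y * p ^ 4 + c.J₃ x y * p ^ 3 + c.J₂ x y * p ^ 2 + c.J₁ x y * p + c.J₀ x y) * q
          + c.K₇ x y * p ^ 7 + c.K₆ x y * p ^ 6 + c.K₅ x y * p ^ 5 + c.K₄ x y * p ^ 4
          + c.K₃ x y * p ^ 3 + c.K₂ x y * p ^ 2 + c.K₁ x y * p + c.K₀ x y) = 0

/-- On `Ω`, the equation `y⁗ = f` is linear in the third-order derivative. -/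
def IsLinearInThirdDerivative (Ω : Set (ℝ × ℝ × ℝ × ℝ × ℝ)) (f : ℝ × ℝ × ℝ × ℝ × ℝ → ℝ) : Prop :=
  ∃ G H : ℝ → ℝ → ℝ → ℝ → ℝ, ∀ x y p q s : ℝ, (x, y, p, q, s) ∈ Ω →
    f (x, y, p, q, s) = G x y p q * s + H x y p q

section LaguerreFirst

namespace LaguerreFirst

variable (phi psi : ℝ → ℝ → ℝ) (a b : ℝ → ℝ) (x y : ℝ)

local notation "φ_x" => dx phi x y
local notation "φ_xx" => dx (dx phi) x y
local notation "φ_xxx" => dx (dx (dx phi)) x y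
local notation "φ_xxxx" => dx (dx (dx (dx phi))) x y
local notation "ψ" => psi x y
local notation "ψ_x" => dx psi x y
local notation "ψ_y" => dy psi x y
local notation "ψ_xx" => dx (dx psi) x y
local notation "ψ_xy" => dy (dx psi) x y
local notation "ψ_yy" => dy (dy psi) x y
local notation "ψ_xxx" => dx (dx (dx psi)) x y
local notation "ψ_xxy" => dy (dx (dx psi)) x y
local notation "ψ_xyy" => dy (dy (dx psi)) x y
local notation "ψ_yyy" => dy (dy (dy psi)) x y
local notation "ψ_xxxx" => dx (dx (dx (dx psi))) x y
local notation "ψ_xxxy" => dy (dx (dx (dx psi))) x y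
local notation "ψ_xxyy" => dy (dy (dx (dx psi))) x y
local notation "ψ_xyyy" => dy (dy (dy (dx psi))) x y
local notation "ψ_yyyy" => dy (dy (dy (dy psi))) x y
local notation "α" => a (phi x y)
local notation "β" => b (phi x y)

def A₁ : ℝ :=
  4 * (ψ_y)⁻¹ * ψ_yy

def A₀ : ℝ :=
  -2 * (φ_x * ψ_y)⁻¹ * (3 * φ_xx * ψ_y - 2 * φ_x * ψ_xy)

def B₀ : ℝ :=
  3 * (ψ_y)⁻¹ * ψ_yy

def C₂ : ℝ :=
  6 * (ψ_y)⁻¹ * ψ_yyy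

def C₁ : ℝ :=
  -6 * (φ_x * ψ_y)⁻¹ * (3 * φ_xx * ψ_yy - 2 * φ_x * ψ_xyy)

def C₀ : ℝ :=
  -(φ_x ^ 2 * ψ_y)⁻¹ * ((4 * φ_xxx * φ_x - 15 * φ_xx ^ 2) * ψ_y + 6 * (3 * φ_xx * ψ_xy - φ_x *
  ψ_xxy) * φ_x)

def D₄ : ℝ :=
  (ψ_y)⁻¹ * ψ_yyyy

def D₃ : ℝ :=
  -2 * (φ_x * ψ_y)⁻¹ * (3 * φ_xx * ψ_yyy - 2 * φ_x * ψ_xyyy)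

def D₂ : ℝ :=
  -(φ_x ^ 2 * ψ_y)⁻¹ * (4 * φ_xxx * φ_x * ψ_yy - 15 * φ_xx ^ 2 * ψ_yy + 18 * φ_xx * φ_x *
  ψ_xyy - 6 * φ_x ^ 2 * ψ_xxyy)

def D₁ : ℝ :=
  -(φ_x ^ 3 * ψ_y)⁻¹ * (3 * (5 * φ_xx ^ 2 * ψ_y - 10 * φ_xx * φ_x * ψ_xy + 6 * φ_x ^ 2 *
  ψ_xxy) * φ_xx - (φ_x ^ 3 * ψ_y * α + 4 * ψ_xxxy) * φ_x ^ 3 - 2 * (5 * φ_xx * ψ_y - 4 * φ_x *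
  ψ_xy) * φ_xxx * φ_x + φ_xxxx * φ_x ^ 2 * ψ_y)

def D₀ : ℝ :=
  -(φ_x ^ 3 * ψ_y)⁻¹ * ((15 * φ_xx ^ 3 - φ_x ^ 6 * α + φ_xxxx * φ_x ^ 2) * ψ_x - (10 * φ_xxx *
  φ_xx * ψ_x - 4 * φ_xxx * φ_x * ψ_xx + 15 * φ_xx ^ 2 * ψ_xx - 6 * φ_xx * φ_x * ψ_xxx +
  φ_x ^ 6 * β * ψ + φ_x ^ 2 * ψ_xxxx) * φ_x)

end LaguerreFirst

end LaguerreFirst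

section LaguerreSecond

namespace LaguerreSecond

variable (phi psi : ℝ → ℝ → ℝ) (a b : ℝ → ℝ) (x y : ℝ)

local notation "φ_y" => dy phi x y
local notation "φ_yy" => dy (dy phi) x y
local notation "φ_yyy" => dy (dy (dy phi)) x y
local notation "φ_yyyy" => dy (dy (dy (dy phi))) x y
local notation "ψ" => psi x y
local notation "ψ_y" => dy psi x y
local notation "ψ_yy" => dy (dy psi) x y
local notation "ψ_yyy" => dy (dy (dy psi)) x y
local notation "ψ_yyyy" => dy (dy (dy (dy psi))) x y
local notation "Δ" => jacobian phi psi x y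
local notation "Δ_x" => dx (jacobian phi psi) x y
local notation "Δ_y" => dy (jacobian phi psi) x y
local notation "Δ_xx" => dx (dx (jacobian phi psi)) x y
local notation "Δ_xy" => dy (dx (jacobian phi psi)) x y
local notation "Δ_yy" => dy (dy (jacobian phi psi)) x y
local notation "Δ_xxx" => dx (dx (dx (jacobian phi psi))) x y
local notation "Δ_xxy" => dy (dx (dx (jacobian phi psi))) x y
local notation "Δ_xyy" => dy (dy (dx (jacobian phi psi))) x y
local notation "Δ_yyy" => dy (dy (dy (jacobian phi psi))) x y
local notation "r" => ratio phi x y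
local notation "r_x" => dx (ratio phi) x y
local notation "r_y" => dy (ratio phi) x y
local notation "r_xx" => dx (dx (ratio phi)) x y
local notation "r_xy" => dy (dx (ratio phi)) x y
local notation "r_yy" => dy (dy (ratio phi)) x y
local notation "r_xxx" => dx (dx (dx (ratio phi))) x y
local notation "r_xxy" => dy (dx (dx (ratio phi))) x y
local notation "r_xyy" => dy (dy (dx (ratio phi))) x y
local notation "r_yyy" => dy (dy (dy (ratio phi))) x y
local notation "α" => a (phi x y)
local notation "β" => b (phi x y)

def F₂ : ℝ :=
  -2 * (φ_y * Δ)⁻¹ * (5 * φ_yy * Δ - 2 * φ_y * Δ_y)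

def F₁ : ℝ :=
  4 * (φ_y * Δ)⁻¹ * ((Δ_x + Δ_y * r - 5 * r_y * Δ) * φ_y - 5 * φ_yy * r * Δ)

def F₀ : ℝ :=
  -2 * (φ_y * Δ)⁻¹ * (((5 * r_y * Δ - 2 * Δ_x) * r + 5 * r_x * Δ) * φ_y + 5 * φ_yy * r ^ 2 * Δ)

def H₂ : ℝ :=
  6 * (φ_y * Δ)⁻¹ * (5 * φ_yy * Δ - 2 * φ_y * Δ_y)

def H₁ : ℝ :=
  -3 * (φ_y * Δ)⁻¹ * ((5 * Δ_x + 3 * Δ_y * r - 25 * r_y * Δ) * φ_y - 20 * φ_yy * r * Δ)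

def H₀ : ℝ :=
  3 * (φ_y * Δ)⁻¹ * ((5 * (3 * r_x + 2 * r_y * r) * Δ - (5 * Δ_x - Δ_y * r) * r) * φ_y + 10 *
  φ_yy * r ^ 2 * Δ)

def J₄ : ℝ :=
  -(φ_y ^ 2 * Δ)⁻¹ * (10 * φ_yyy * φ_y * Δ - 45 * φ_yy ^ 2 * Δ + 30 * φ_yy * φ_y * Δ_y - 6 *
  φ_y ^ 2 * Δ_yy)

def J₃ : ℝ :=
  2 * (φ_y ^ 2 * Δ)⁻¹ * (3 * ((2 * (Δ_xy + Δ_yy * r - 5 * r_y * Δ_y) - 5 * r_yy * Δ) * φ_y ^ 2 -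
  5 * ((Δ_x + 3 * Δ_y * r - 4 * r_y * Δ) * φ_y - 6 * φ_yy * r * Δ) * φ_yy) - 20 * φ_yyy * φ_y *
  r * Δ)

def J₂ : ℝ :=
  6 * (φ_y ^ 2 * Δ)⁻¹ * ((Δ_xx + Δ_yy * r ^ 2 + 4 * Δ_xy * r - 5 * (2 * Δ_x + 3 * Δ_y * r - 5 *
  r_y * Δ) * r_y - 10 * r_yy * r * Δ - 5 * r_x * Δ_y - 5 * r_xy * Δ) * φ_y ^ 2 - 5 * (((3 *
  (Δ_x + Δ_y * r) - 10 * r_y * Δ) * r - 2 * r_x * Δ) * φ_y - 9 * φ_yy * r ^ 2 * Δ) * φ_yy - 10 *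
  φ_yyy * φ_y * r ^ 2 * Δ)

def J₁ : ℝ :=
  -2 * (φ_y ^ 2 * Δ)⁻¹ * (((5 * (3 * (3 * Δ_x + Δ_y * r) - 14 * r_y * Δ) * r_y - 6 * (Δ_xy * r +
  Δ_xx) + 20 * r_yy * r * Δ) * r + 5 * (3 * (Δ_x + Δ_y * r) - 16 * r_y * Δ) * r_x + 5 * r_xx *
  Δ + 20 * r_xy * r * Δ) * φ_y ^ 2 + 15 * (((3 * Δ_x + Δ_y * r - 8 * r_y * Δ) * r - 4 * r_x *
  Δ) * φ_y - 6 * φ_yy * r ^ 2 * Δ) * φ_yy * r + 20 * φ_yyy * φ_y * r ^ 3 * Δ)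

def J₀ : ℝ :=
  -(φ_y ^ 2 * Δ)⁻¹ * (((2 * ((5 * r_yy * r * Δ - 3 * Δ_xx) * r + 5 * r_xx * Δ + 5 * r_xy * r *
  Δ) - 5 * (7 * r_y * Δ - 6 * Δ_x) * r_y * r) * r - 5 * (2 * (7 * r_y * Δ - 3 * Δ_x) * r + 9 *
  r_x * Δ) * r_x) * φ_y ^ 2 - 5 * (3 * (2 * ((2 * r_y * Δ - Δ_x) * r + 2 * r_x * Δ) * φ_y + 3 *
  φ_yy * r ^ 2 * Δ) * φ_yy - 2 * φ_yyy * φ_y * r ^ 2 * Δ) * r ^ 2)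

def K₇ : ℝ :=
  -(φ_y ^ 2 * Δ)⁻¹ * (φ_yyyy * φ_y ^ 2 * ψ_y - 10 * φ_yyy * φ_yy * φ_y * ψ_y + 4 * φ_yyy *
  φ_y ^ 2 * ψ_yy + 15 * φ_yy ^ 3 * ψ_y - 15 * φ_yy ^ 2 * φ_y * ψ_yy + 6 * φ_yy * φ_y ^ 2 *
  ψ_yyy - φ_y ^ 7 * β * ψ - φ_y ^ 6 * ψ_y * α - φ_y ^ 3 * ψ_yyyy)

def K₆ : ℝ :=
  (φ_y ^ 3 * Δ)⁻¹ * (3 * (5 * ((7 * φ_y * ψ_yy * r - 6 * Δ_y) * φ_y - 7 * (φ_y * ψ_y * r - Δ) *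
  φ_yy) * φ_yy - 2 * (7 * φ_y * ψ_yyy * r - 5 * Δ_yy) * φ_y ^ 2) * φ_yy + (7 * φ_y ^ 5 * β * ψ *
  r + 7 * φ_y ^ 4 * ψ_y * α * r - φ_y ^ 3 * α * Δ + 7 * φ_y * ψ_yyyy * r - 4 * Δ_yyy) *
  φ_y ^ 3 + 2 * (35 * φ_yy * φ_y * ψ_y * r - 30 * φ_yy * Δ - 14 * φ_y ^ 2 * ψ_yy * r + 10 *
  φ_y * Δ_y) * φ_yyy * φ_y - (7 * φ_y * ψ_y * r - 5 * Δ) * φ_yyyy * φ_y ^ 2)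

def K₅ : ℝ :=
  -(φ_y ^ 3 * Δ)⁻¹ * ((2 * (3 * (Δ_xyy + 3 * Δ_yyy * r - 5 * r_y * Δ_yy - 5 * r_yy * Δ_y) - 5 *
  r_yyy * Δ) - 3 * (7 * φ_y ^ 4 * β * ψ * r + 7 * φ_y ^ 3 * ψ_y * α * r - 2 * φ_y ^ 2 * α * Δ +
  7 * ψ_yyyy * r) * φ_y * r) * φ_y ^ 3 - 3 * (2 * (5 * (Δ_xy + 5 * Δ_yy * r - 4 * r_y * Δ_y -
  2 * r_yy * Δ) - 21 * φ_y * ψ_yyy * r ^ 2) * φ_y ^ 2 - 15 * ((Δ_x + 11 * Δ_y * r - 3 * r_y *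
  Δ - 7 * φ_y * ψ_yy * r ^ 2) * φ_y + 7 * (φ_y * ψ_y * r - 2 * Δ) * φ_yy * r) * φ_yy) * φ_yy -
  2 * ((5 * (Δ_x + 11 * Δ_y * r - 3 * r_y * Δ) - 42 * φ_y * ψ_yy * r ^ 2) * φ_y + 15 * (7 *
  φ_y * ψ_y * r - 12 * Δ) * φ_yy * r) * φ_yyy * φ_y + 3 * (7 * φ_y * ψ_y * r - 10 * Δ) *
  φ_yyyy * φ_y ^ 2 * r)

def K₄ : ℝ :=
  -(φ_y ^ 3 * Δ)⁻¹ * ((2 * (45 * r_yy * r_y * Δ - 10 * r_yy * Δ_x - 55 * r_yy * Δ_y * r + 50 *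
  r_y ^ 2 * Δ_y - 20 * r_y * Δ_xy - 50 * r_y * Δ_yy * r + 11 * Δ_xyy * r + 2 * Δ_xxy + 17 *
  Δ_yyy * r ^ 2 - 20 * r_yyy * r * Δ - 5 * r_x * Δ_yy - 10 * r_xy * Δ_y - 5 * r_xyy * Δ) - 5 *
  (7 * φ_y ^ 4 * β * ψ * r + 7 * φ_y ^ 3 * ψ_y * α * r - 3 * φ_y ^ 2 * α * Δ + 7 * ψ_yyyy * r) *
  φ_y * r ^ 2) * φ_y ^ 3 + 15 * ((3 * ((5 * (Δ_x + 5 * Δ_y * r) - 14 * r_y * Δ) * r - r_x * Δ) -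
  35 * φ_y * ψ_yy * r ^ 3) * φ_y + 35 * (φ_y * ψ_y * r - 3 * Δ) * φ_yy * r ^ 2) * φ_yy ^ 2 -
  10 * (Δ_xx + 31 * Δ_yy * r ^ 2 + 13 * Δ_xy * r - 8 * (Δ_x + 6 * Δ_y * r - 2 * r_y * Δ) * r_y -
  26 * r_yy * r * Δ - 4 * r_x * Δ_y - 4 * r_xy * Δ - 21 * φ_y * ψ_yyy * r ^ 3) * φ_yy *
  φ_y ^ 2 - 10 * (((5 * (Δ_x + 5 * Δ_y * r) - 14 * r_y * Δ) * r - r_x * Δ - 14 * φ_y * ψ_yy *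
  r ^ 3) * φ_y + 5 * (7 * φ_y * ψ_y * r - 18 * Δ) * φ_yy * r ^ 2) * φ_yyy * φ_y + 5 * (7 * φ_y *
  ψ_y * r - 15 * Δ) * φ_yyyy * φ_y ^ 2 * r ^ 2)

def K₃ : ℝ :=
  -(φ_y ^ 3 * Δ)⁻¹ * (((13 * Δ_xxy + 35 * Δ_yyy * r ^ 2) * r + Δ_xxx + 31 * Δ_xyy * r ^ 2 - 5 *
  (3 * Δ_xx + 26 * Δ_yy * r ^ 2 + 23 * Δ_xy * r - (15 * Δ_x + 49 * Δ_y * r - 25 * r_y * Δ) *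
  r_y) * r_y - 5 * (13 * Δ_x + 32 * Δ_y * r - 50 * r_y * Δ) * r_yy * r - 65 * r_yyy * r ^ 2 *
  Δ - 5 * (3 * Δ_xy + 5 * Δ_yy * r - 16 * r_y * Δ_y - 7 * r_yy * Δ) * r_x - 5 * r_xx * Δ_y - 5 *
  r_xxy * Δ - 5 * (3 * Δ_x + 11 * Δ_y * r - 15 * r_y * Δ) * r_xy - 30 * r_xyy * r * Δ - 5 * (7 *
  φ_y ^ 4 * β * ψ * r + 7 * φ_y ^ 3 * ψ_y * α * r - 4 * φ_y ^ 2 * α * Δ + 7 * ψ_yyyy * r) *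
  φ_y * r ^ 3) * φ_y ^ 3 - 5 * (2 * ((2 * (2 * Δ_xx + 17 * Δ_yy * r ^ 2 + 11 * Δ_xy * r) - (29 *
  Δ_x + 75 * Δ_y * r - 51 * r_y * Δ) * r_y - 45 * r_yy * r * Δ) * r - (3 * Δ_x + 13 * Δ_y * r -
  13 * r_y * Δ) * r_x - r_xx * Δ - 14 * r_xy * r * Δ - 21 * φ_y * ψ_yyy * r ^ 4) * φ_y ^ 2 - 3 *
  ((6 * ((5 * (Δ_x + 3 * Δ_y * r) - 13 * r_y * Δ) * r - 2 * r_x * Δ) - 35 * φ_y * ψ_yy *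
  r ^ 3) * φ_y + 35 * (φ_y * ψ_y * r - 4 * Δ) * φ_yy * r ^ 2) * φ_yy * r) * φ_yy - 10 * (2 *
  ((5 * (Δ_x + 3 * Δ_y * r) - 13 * r_y * Δ) * r - 2 * r_x * Δ - 7 * φ_y * ψ_yy * r ^ 3) * φ_y +
  5 * (7 * φ_y * ψ_y * r - 24 * Δ) * φ_yy * r ^ 2) * φ_yyy * φ_y * r + 5 * (7 * φ_y * ψ_y * r -
  20 * Δ) * φ_yyyy * φ_y ^ 2 * r ^ 3)

def K₂ : ℝ :=
  -(φ_y ^ 3 * Δ)⁻¹ * (((3 * ((5 * Δ_xxy + 7 * Δ_yyy * r ^ 2) * r + Δ_xxx + 7 * Δ_xyy * r ^ 2) -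
  (3 * (13 * Δ_xx + 28 * Δ_yy * r ^ 2 + 39 * Δ_xy * r) + (204 * r_y * Δ - 161 * Δ_x - 217 *
  Δ_y * r) * r_y) * r_y - (79 * Δ_x + 116 * Δ_y * r - 264 * r_y * Δ) * r_yy * r - 54 * r_yyy *
  r ^ 2 * Δ) * r - (3 * (2 * Δ_xx + 7 * Δ_yy * r ^ 2 + 11 * Δ_xy * r) + (171 * r_y * Δ - 64 *
  Δ_x - 140 * Δ_y * r) * r_y - 72 * r_yy * r * Δ - 18 * r_x * Δ_y) * r_x - (4 * Δ_x + 11 * Δ_y *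
  r - 21 * r_y * Δ) * r_xx - 12 * r_xxy * r * Δ - r_xxx * Δ - ((37 * Δ_x + 53 * Δ_y * r - 150 *
  r_y * Δ) * r - 33 * r_x * Δ) * r_xy - 33 * r_xyy * r ^ 2 * Δ - 3 * (7 * φ_y ^ 4 * β * ψ * r +
  7 * φ_y ^ 3 * ψ_y * α * r - 5 * φ_y ^ 2 * α * Δ + 7 * ψ_yyyy * r) * φ_y * r ^ 4) * φ_y ^ 3 -
  3 * (2 * (5 * ((2 * Δ_xx + 7 * Δ_yy * r ^ 2 + 6 * Δ_xy * r - (13 * Δ_x + 19 * Δ_y * r - 20 *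
  r_y * Δ) * r_y - 13 * r_yy * r * Δ) * r ^ 2 - ((3 * Δ_x + 5 * Δ_y * r - 11 * r_y * Δ) * r -
  r_x * Δ) * r_x - r_xx * r * Δ - 6 * r_xy * r ^ 2 * Δ) - 21 * φ_y * ψ_yyy * r ^ 5) * φ_y ^ 2 -
  15 * ((2 * ((5 * (Δ_x + 2 * Δ_y * r) - 12 * r_y * Δ) * r - 3 * r_x * Δ) - 7 * φ_y * ψ_yy *
  r ^ 3) * φ_y + 7 * (φ_y * ψ_y * r - 5 * Δ) * φ_yy * r ^ 2) * φ_yy * r ^ 2) * φ_yy - 2 * (2 *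
  (5 * ((5 * (Δ_x + 2 * Δ_y * r) - 12 * r_y * Δ) * r - 3 * r_x * Δ) - 21 * φ_y * ψ_yy * r ^ 3) *
  φ_y + 15 * (7 * φ_y * ψ_y * r - 30 * Δ) * φ_yy * r ^ 2) * φ_yyy * φ_y * r ^ 2 + 3 * (7 * φ_y *
  ψ_y * r - 25 * Δ) * φ_yyyy * φ_y ^ 2 * r ^ 4)

def K₁ : ℝ :=
  -(φ_y ^ 3 * Δ)⁻¹ * (((7 * (Δ_xxy + Δ_yyy * r ^ 2) * r + 3 * Δ_xxx + 7 * Δ_xyy * r ^ 2 - (33 *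
  Δ_xx + 28 * Δ_yy * r ^ 2 + 49 * Δ_xy * r + 2 * (59 * r_y * Δ - 56 * Δ_x - 42 * Δ_y * r) *
  r_y) * r_y - (43 * Δ_x + 42 * Δ_y * r - 128 * r_y * Δ) * r_yy * r - 23 * r_yyy * r ^ 2 * Δ) *
  r ^ 2 - ((12 * Δ_xx + 7 * Δ_yy * r ^ 2 + 21 * Δ_xy * r + 2 * (86 * r_y * Δ - 49 * Δ_x - 35 *
  Δ_y * r) * r_y - 49 * r_yy * r * Δ) * r + (85 * r_y * Δ - 15 * Δ_x - 21 * Δ_y * r) * r_x) *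
  r_x - ((8 * Δ_x + 7 * Δ_y * r - 32 * r_y * Δ) * r - 10 * r_x * Δ) * r_xx - 9 * r_xxy * r ^ 2 *
  Δ - 2 * r_xxx * r * Δ - ((29 * Δ_x + 21 * Δ_y * r - 95 * r_y * Δ) * r - 46 * r_x * Δ) * r_xy *
  r - 16 * r_xyy * r ^ 3 * Δ - (7 * φ_y ^ 4 * β * ψ * r + 7 * φ_y ^ 3 * ψ_y * α * r - 6 *
  φ_y ^ 2 * α * Δ + 7 * ψ_yyyy * r) * φ_y * r ^ 5) * φ_y ^ 3 - (2 * (5 * ((4 * Δ_xx + 7 * Δ_yy *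
  r ^ 2 + 7 * Δ_xy * r - (23 * Δ_x + 21 * Δ_y * r - 31 * r_y * Δ) * r_y - 17 * r_yy * r * Δ) *
  r ^ 2 - ((9 * Δ_x + 7 * Δ_y * r - 27 * r_y * Δ) * r - 6 * r_x * Δ) * r_x - 3 * r_xx * r * Δ -
  10 * r_xy * r ^ 2 * Δ) - 21 * φ_y * ψ_yyy * r ^ 5) * φ_y ^ 2 - 15 * ((3 * ((5 * Δ_x + 7 *
  Δ_y * r - 11 * r_y * Δ) * r - 4 * r_x * Δ) - 7 * φ_y * ψ_yy * r ^ 3) * φ_y + 7 * (φ_y * ψ_y *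
  r - 6 * Δ) * φ_yy * r ^ 2) * φ_yy * r ^ 2) * φ_yy * r - 2 * ((5 * ((5 * Δ_x + 7 * Δ_y * r -
  11 * r_y * Δ) * r - 4 * r_x * Δ) - 14 * φ_y * ψ_yy * r ^ 3) * φ_y + 5 * (7 * φ_y * ψ_y * r -
  36 * Δ) * φ_yy * r ^ 2) * φ_yyy * φ_y * r ^ 3 + (7 * φ_y * ψ_y * r - 30 * Δ) * φ_yyyy *
  φ_y ^ 2 * r ^ 5)

def K₀ : ℝ :=
  (φ_y ^ 3 * Δ)⁻¹ * (((((2 * (r_xxy + 2 * r_yyy * r ^ 2) * r + r_xxx + 3 * r_xyy * r ^ 2) * Δ +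
  3 * (3 * Δ_x + 2 * Δ_y * r - 8 * r_y * Δ) * r_yy * r ^ 2) * r - ((10 * r_x + 11 * r_y * r) *
  Δ - (4 * Δ_x + Δ_y * r) * r) * r_xx - ((13 * r_x + 20 * r_y * r) * Δ - (7 * Δ_x + 3 * Δ_y *
  r) * r) * r_xy * r + ((φ_y ^ 4 * β * ψ + φ_y ^ 3 * ψ_y * α + ψ_yyyy) * r - φ_y ^ 2 * α * Δ) *
  φ_y * r ^ 5 + (9 * Δ_xx + 4 * Δ_yy * r ^ 2 + 7 * Δ_xy * r - 2 * (13 * Δ_x + 6 * Δ_y * r - 12 *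
  r_y * Δ) * r_y) * r_y * r ^ 2 - ((Δ_xxy + Δ_yyy * r ^ 2) * r + Δ_xxx + Δ_xyy * r ^ 2) *
  r ^ 2) * r - ((2 * ((17 * Δ_x + 5 * Δ_y * r - 23 * r_y * Δ) * r_y + 6 * r_yy * r * Δ) - (6 *
  Δ_xx + Δ_yy * r ^ 2 + 3 * Δ_xy * r)) * r ^ 2 - (5 * (3 * r_x + 8 * r_y * r) * Δ - 3 * (5 *
  Δ_x + Δ_y * r) * r) * r_x) * r_x) * φ_y ^ 3 - ((2 * ((5 * (r_xx + 3 * r_yy * r ^ 2 + 2 *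
  r_xy * r) * Δ + 3 * φ_y * ψ_yyy * r ^ 4 + 5 * (5 * Δ_x + 3 * Δ_y * r - 6 * r_y * Δ) * r_y *
  r - 5 * (Δ_xx + Δ_yy * r ^ 2 + Δ_xy * r) * r) * r - 5 * ((3 * r_x + 7 * r_y * r) * Δ - (3 *
  Δ_x + Δ_y * r) * r) * r_x) * φ_y ^ 2 - 15 * ((3 * (r_x + 2 * r_y * r) * Δ + φ_y * ψ_yy *
  r ^ 3 - 3 * (Δ_x + Δ_y * r) * r) * φ_y - (φ_y * ψ_y * r - 7 * Δ) * φ_yy * r ^ 2) * φ_yy *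
  r ^ 2) * φ_yy + (2 * ((5 * (r_x + 2 * r_y * r) * Δ + 2 * φ_y * ψ_yy * r ^ 3 - 5 * (Δ_x + Δ_y *
  r) * r) * φ_y - 5 * (φ_y * ψ_y * r - 6 * Δ) * φ_yy * r ^ 2) * φ_yyy + (φ_y * ψ_y * r - 5 *
  Δ) * φ_yyyy * φ_y * r ^ 2) * φ_y * r ^ 2) * r ^ 2)

end LaguerreSecond

end LaguerreSecond

/-- The coefficients of the first class that `u⁗ + a(t) u' + b(t) u = 0` produces under
`t = φ(x,y)`, `u = ψ(x,y)` when `φ_y = 0`. -/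
def firstCoeffs (phi psi : ℝ → ℝ → ℝ) (a b : ℝ → ℝ) : FirstCoeffs where
  A₁ := LaguerreFirst.A₁ psi
  A₀ := LaguerreFirst.A₀ phi psi
  B₀ := LaguerreFirst.B₀ psi
  C₂ := LaguerreFirst.C₂ psi
  C₁ := LaguerreFirst.C₁ phi psi
  C₀ := LaguerreFirst.C₀ phi psi
  D₄ := LaguerreFirst.D₄ psi
  D₃ := LaguerreFirst.D₃ phi psi
  D₂ := LaguerreFirst.D₂ phi psi
  D₁ := LaguerreFirst.D₁ phi psi a
  D₀ := LaguerreFirst.D₀ phi psi a b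

/-- The coefficients of the second class that `u⁗ + a(t) u' + b(t) u = 0` produces under
`t = φ(x,y)`, `u = ψ(x,y)` when `φ_y ≠ 0`. -/
def secondCoeffs (phi psi : ℝ → ℝ → ℝ) (a b : ℝ → ℝ) : SecondCoeffs where
  r := ratio phi
  F₂ := LaguerreSecond.F₂ phi psi
  F₁ := LaguerreSecond.F₁ phi psi
  F₀ := LaguerreSecond.F₀ phi psi
  H₂ := LaguerreSecond.H₂ phi psi
  H₁ := LaguerreSecond.H₁ phi psi
  H₀ := LaguerreSecond.H₀ phi psi
  J₄ := LaguerreSecond.J₄ phi psi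
  J₃ := LaguerreSecond.J₃ phi psi
  J₂ := LaguerreSecond.J₂ phi psi
  J₁ := LaguerreSecond.J₁ phi psi
  J₀ := LaguerreSecond.J₀ phi psi
  K₇ := LaguerreSecond.K₇ phi psi a b
  K₆ := LaguerreSecond.K₆ phi psi a b
  K₅ := LaguerreSecond.K₅ phi psi a b
  K₄ := LaguerreSecond.K₄ phi psi a b
  K₃ := LaguerreSecond.K₃ phi psi a b
  K₂ := LaguerreSecond.K₂ phi psi a b
  K₁ := LaguerreSecond.K₁ phi psi a b
  K₀ := LaguerreSecond.K₀ phi psi a b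

end FourthOrder

end

/-! Write `D` for the total derivative along a graph `y = y(x)` and `P = Dφ = φ_x + y'φ_y`. The
relation `u(φ) = ψ` gives `u^(k+1) = D(u^(k)) / P`, so the linear expression `u⁗ + ⋯ - b` equals `E
/ P⁷` with `E` polynomial in `y', …, y⁗` (`transformedEquation`). In `E` the derivative `y⁗` occurs
only with the coefficient `P²Δ`, which is nonzero on regular jets (`transformedEquation_eq_add`).
Over a jet of `Ω`, choose `w` with `E = 0` and the quartic polynomial with this 4-jet; the inverse
function theorem supplies `u`, the linear equation holds by the choice of `w`, and the hypothesis
forces `w = f` (`ObtainedFromLinear.exists_solution`). So `f` is the unique root of an explicit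
equation at each jet, which is why regularity of `f` and of the linear coefficients plays no role.
Since `E` is also affine in `y'''`, so is `f`.

If `φ_y = 0`, then `P` and its derivatives do not involve `y', y'', …`, and `E / P³` is a linear
differential expression along the graph in `ψ(x, y(x))`. The class (I) is the chain rule for `ψ`.

If `φ_y ≠ 0`, put `m = y' + r`, so that `P = φ_y m`, and `X = ∂_x - r ∂_y`, so that `Xφ = 0` and `D
= X + m ∂_y` on functions of `(x, y)`. Then `Dψ = ψ_y m - Δ/φ_y`, hence `u' = ψ_y/φ_y - Δ/(φ_y² m)`
and `u'' = W/(φ_y³ m³)` with `W = Δ y''` plus a cubic in `m`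
(`IsPointTransformation.hasDerivAt_first`). Two more derivatives give `u⁗ = N₄/(φ_y⁵ m⁷)`; sorting
the numerator by `y'''`, `y''` and `m` gives (II) in powers of `m` (`FrameData.equation_eq`), and a
binomial expansion gives powers of `y'`.

For the explicit coefficients of (II), the jets of the coefficients of `W` follow from those of `Δ`,
`r`, `L = φ_yy/φ_y` and `S = φ_y ψ_yy - ψ_y φ_yy`. Truncated jets obey a product rule
(`frameJet_mul`), and the `x`-derivatives of `L` and `S` are eliminated through the commutator `[X,
∂_y] = r_y ∂_y`. What remains are `y`-derivatives of `φ, ψ` and partial derivatives of `Δ, r`,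
precisely the quantities in the stated formulas, and each coefficient is a rational identity in
them. For arbitrary `φ`, the two cases apply on `{φ_y ≠ 0}` and on the interior of `{φ_y = 0}`. -/

noncomputable section

namespace FourthOrder

open Filter Topology

/-! ### Partial derivatives of functions of class `Cⁿ` on an open set. -/

section SmoothFunctions

/-- A function of two variables is `n` times continuously differentiable on `U`. -/
def SmoothOn (n : ℕ) (U : Set (ℝ × ℝ)) (g : ℝ → ℝ → ℝ) : Prop :=
  ContDiffOn ℝ n (fun z : ℝ × ℝ => g z.1 z.2) U

variable {U : Set (ℝ × ℝ)} {g h : ℝ → ℝ → ℝ} {x y : ℝ} {n : ℕ}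

theorem SmoothOn.mono {m : ℕ} (hg : SmoothOn n U g) (hmn : m ≤ n) : SmoothOn m U g :=
  ContDiffOn.of_le hg (by exact_mod_cast hmn)

theorem SmoothOn.contDiffAt (hg : SmoothOn n U g) (hU : IsOpen U) (hz : (x, y) ∈ U) :
    ContDiffAt ℝ n (fun z : ℝ × ℝ => g z.1 z.2) (x, y) :=
  ContDiffOn.contDiffAt hg (hU.mem_nhds hz)

theorem SmoothOn.hasFDerivAt (hg : SmoothOn (n + 1) U g) (hU : IsOpen U) (hz : (x, y) ∈ U) :
    HasFDerivAt (fun z : ℝ × ℝ => g z.1 z.2)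
      (fderiv ℝ (fun z : ℝ × ℝ => g z.1 z.2) (x, y)) (x, y) :=
  ((hg.contDiffAt hU hz).differentiableAt (by simp)).hasFDerivAt

theorem SmoothOn.hasDerivAt_comp (hg : SmoothOn (n + 1) U g) (hU : IsOpen U) {v w : ℝ → ℝ}
    {v' w' t : ℝ} (hz : (v t, w t) ∈ U) (hv : HasDerivAt v v' t) (hw : HasDerivAt w w' t) :
    HasDerivAt (fun t => g (v t) (w t))
      (fderiv ℝ (fun z : ℝ × ℝ => g z.1 z.2) (v t, w t) (v', w')) t :=
  HasFDerivAt.comp_hasDerivAt (f := fun t => (v t, w t)) t (hg.hasFDerivAt hU hz) (hv.prodMk hw)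

theorem SmoothOn.dx_eq (hg : SmoothOn (n + 1) U g) (hU : IsOpen U) (hz : (x, y) ∈ U) :
    dx g x y = fderiv ℝ (fun z : ℝ × ℝ => g z.1 z.2) (x, y) (1, 0) :=
  (hg.hasDerivAt_comp hU (v := fun t => t) (w := fun _ => y) hz (hasDerivAt_id x)
    (hasDerivAt_const x y)).deriv

theorem SmoothOn.dy_eq (hg : SmoothOn (n + 1) U g) (hU : IsOpen U) (hz : (x, y) ∈ U) :
    dy g x y = fderiv ℝ (fun z : ℝ × ℝ => g z.1 z.2) (x, y) (0, 1) :=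
  (hg.hasDerivAt_comp hU (v := fun _ => x) (w := fun t => t) hz (hasDerivAt_const y x)
    (hasDerivAt_id y)).deriv

theorem SmoothOn.hasDerivAt_graph (hg : SmoothOn (n + 1) U g) (hU : IsOpen U) {c : ℝ → ℝ}
    {c' : ℝ} (hz : (x, c x) ∈ U) (hc : HasDerivAt c c' x) :
    HasDerivAt (fun x => g x (c x)) (dx g x (c x) + c' * dy g x (c x)) x := by
  have := hg.hasDerivAt_comp hU (v := fun t => t) hz (hasDerivAt_id x) hc
  rw [hg.dx_eq hU hz, hg.dy_eq hU hz]
  convert this using 1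
  rw [← smul_eq_mul, ← map_smul, ← map_add]
  simp

theorem SmoothOn.hasDerivAt_dx (hg : SmoothOn (n + 1) U g) (hU : IsOpen U) (hz : (x, y) ∈ U) :
    HasDerivAt (fun s => g s y) (dx g x y) x := by
  simpa using hg.hasDerivAt_graph hU (c := fun _ => y) hz (hasDerivAt_const x y)

theorem SmoothOn.hasDerivAt_dy (hg : SmoothOn (n + 1) U g) (hU : IsOpen U) (hz : (x, y) ∈ U) :
    HasDerivAt (fun s => g x s) (dy g x y) y := by
  have := hg.hasDerivAt_comp hU (v := fun _ => x) (w := fun t => t) hz (hasDerivAt_const y x)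
    (hasDerivAt_id y)
  rwa [← hg.dy_eq hU hz] at this

theorem SmoothOn.dx (hg : SmoothOn (n + 1) U g) (hU : IsOpen U) : SmoothOn n U (dx g) := by
  have h1 : ContDiffOn ℝ n (fderiv ℝ (fun z : ℝ × ℝ => g z.1 z.2)) U :=
    ContDiffOn.fderiv_of_isOpen hg hU (by simp)
  exact (h1.clm_apply (contDiffOn_const (c := ((1 : ℝ), (0 : ℝ))))).congr
    fun z hz => hg.dx_eq hU hz

theorem SmoothOn.dy (hg : SmoothOn (n + 1) U g) (hU : IsOpen U) : SmoothOn n U (dy g) := by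
  have h1 : ContDiffOn ℝ n (fderiv ℝ (fun z : ℝ × ℝ => g z.1 z.2)) U :=
    ContDiffOn.fderiv_of_isOpen hg hU (by simp)
  exact (h1.clm_apply (contDiffOn_const (c := ((0 : ℝ), (1 : ℝ))))).congr
    fun z hz => hg.dy_eq hU hz

/-- The mixed second partial derivatives agree. -/
theorem SmoothOn.dx_dy (hg : SmoothOn (n + 2) U g) (hU : IsOpen U) (hz : (x, y) ∈ U) :
    FourthOrder.dx (FourthOrder.dy g) x y = FourthOrder.dy (FourthOrder.dx g) x y := by
  set G := fun z : ℝ × ℝ => g z.1 z.2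
  have hG : ContDiffAt ℝ ((n + 2 : ℕ)) G (x, y) := hg.contDiffAt hU hz
  have hd : DifferentiableAt ℝ (fderiv ℝ G) (x, y) :=
    (hG.fderiv_right (m := ((n + 1 : ℕ))) (by norm_cast)).differentiableAt (by simp)
  have hsymm : IsSymmSndFDerivAt ℝ G (x, y) :=
    hG.isSymmSndFDerivAt (by simp)
  -- Both mixed partials are values of the second Fréchet derivative on the two basis vectors, taken
  -- in opposite orders; `hsymm` exchanges them.
  have e1 : HasDerivAt (fun s => FourthOrder.dy g s y)
      (fderiv ℝ (fderiv ℝ G) (x, y) (1, 0) (0, 1)) x := by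
    have h1 : HasDerivAt (fun s => fderiv ℝ G (s, y)) (fderiv ℝ (fderiv ℝ G) (x, y) (1, 0)) x :=
      hd.hasFDerivAt.comp_hasDerivAt x ((hasDerivAt_id x).prodMk (hasDerivAt_const x y))
    have h2 := h1.clm_apply (hasDerivAt_const x ((0 : ℝ), (1 : ℝ)))
    simp only [map_zero, add_zero] at h2
    refine h2.congr_of_eventuallyEq ?_
    have : ∀ᶠ s in 𝓝 x, (s, y) ∈ U :=
      (Continuous.prodMk_left y).continuousAt.preimage_mem_nhds (hU.mem_nhds hz)
    filter_upwards [this] with s hs using hg.dy_eq hU hs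
  have e2 : HasDerivAt (fun s => FourthOrder.dx g x s)
      (fderiv ℝ (fderiv ℝ G) (x, y) (0, 1) (1, 0)) y := by
    have h1 : HasDerivAt (fun s => fderiv ℝ G (x, s)) (fderiv ℝ (fderiv ℝ G) (x, y) (0, 1)) y :=
      hd.hasFDerivAt.comp_hasDerivAt y ((hasDerivAt_const y x).prodMk (hasDerivAt_id y))
    have h2 := h1.clm_apply (hasDerivAt_const y ((1 : ℝ), (0 : ℝ)))
    simp only [map_zero, add_zero] at h2
    refine h2.congr_of_eventuallyEq ?_
    have : ∀ᶠ s in 𝓝 y, (x, s) ∈ U :=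
      (Continuous.prodMk_right x).continuousAt.preimage_mem_nhds (hU.mem_nhds hz)
    filter_upwards [this] with s hs using hg.dx_eq hU hs
  exact e1.deriv.trans ((hsymm (1, 0) (0, 1)).trans e2.deriv.symm)

theorem dx_congr (hU : IsOpen U) (hgh : ∀ x y, (x, y) ∈ U → g x y = h x y) (hz : (x, y) ∈ U) :
    dx g x y = dx h x y := by
  apply Filter.EventuallyEq.deriv_eq
  have : ∀ᶠ s in 𝓝 x, (s, y) ∈ U :=
    (Continuous.prodMk_left y).continuousAt.preimage_mem_nhds (hU.mem_nhds hz)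
  filter_upwards [this] with s hs using hgh s y hs

theorem dy_congr (hU : IsOpen U) (hgh : ∀ x y, (x, y) ∈ U → g x y = h x y) (hz : (x, y) ∈ U) :
    dy g x y = dy h x y := by
  apply Filter.EventuallyEq.deriv_eq
  have : ∀ᶠ s in 𝓝 y, (x, s) ∈ U :=
    (Continuous.prodMk_right x).continuousAt.preimage_mem_nhds (hU.mem_nhds hz)
  filter_upwards [this] with s hs using hgh x s hs

theorem SmoothOn.add (hg : SmoothOn n U g) (hh : SmoothOn n U h) : SmoothOn n U (g + h) :=
  ContDiffOn.add hg hh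

theorem SmoothOn.sub (hg : SmoothOn n U g) (hh : SmoothOn n U h) : SmoothOn n U (g - h) :=
  ContDiffOn.sub hg hh

theorem SmoothOn.mul (hg : SmoothOn n U g) (hh : SmoothOn n U h) : SmoothOn n U (g * h) :=
  ContDiffOn.mul hg hh

theorem SmoothOn.const_smul (c : ℝ) (hg : SmoothOn n U g) : SmoothOn n U (c • g) :=
  ContDiffOn.const_smul c hg

theorem SmoothOn.div (hg : SmoothOn n U g) (hh : SmoothOn n U h)
    (h0 : ∀ x y, (x, y) ∈ U → h x y ≠ 0) : SmoothOn n U (g / h) :=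
  ContDiffOn.div hg hh fun z hz => h0 z.1 z.2 hz

theorem dx_add (hU : IsOpen U) (hg : SmoothOn (n + 1) U g) (hh : SmoothOn (n + 1) U h)
    (hz : (x, y) ∈ U) : dx (g + h) x y = dx g x y + dx h x y :=
  ((hg.hasDerivAt_dx hU hz).add (hh.hasDerivAt_dx hU hz)).deriv

theorem dy_add (hU : IsOpen U) (hg : SmoothOn (n + 1) U g) (hh : SmoothOn (n + 1) U h)
    (hz : (x, y) ∈ U) : dy (g + h) x y = dy g x y + dy h x y :=
  ((hg.hasDerivAt_dy hU hz).add (hh.hasDerivAt_dy hU hz)).deriv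

theorem dx_sub (hU : IsOpen U) (hg : SmoothOn (n + 1) U g) (hh : SmoothOn (n + 1) U h)
    (hz : (x, y) ∈ U) : dx (g - h) x y = dx g x y - dx h x y :=
  ((hg.hasDerivAt_dx hU hz).sub (hh.hasDerivAt_dx hU hz)).deriv

theorem dy_sub (hU : IsOpen U) (hg : SmoothOn (n + 1) U g) (hh : SmoothOn (n + 1) U h)
    (hz : (x, y) ∈ U) : dy (g - h) x y = dy g x y - dy h x y :=
  ((hg.hasDerivAt_dy hU hz).sub (hh.hasDerivAt_dy hU hz)).deriv

theorem dx_mul (hU : IsOpen U) (hg : SmoothOn (n + 1) U g) (hh : SmoothOn (n + 1) U h)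
    (hz : (x, y) ∈ U) : dx (g * h) x y = dx g x y * h x y + g x y * dx h x y :=
  ((hg.hasDerivAt_dx hU hz).mul (hh.hasDerivAt_dx hU hz)).deriv

theorem dy_mul (hU : IsOpen U) (hg : SmoothOn (n + 1) U g) (hh : SmoothOn (n + 1) U h)
    (hz : (x, y) ∈ U) : dy (g * h) x y = dy g x y * h x y + g x y * dy h x y :=
  ((hg.hasDerivAt_dy hU hz).mul (hh.hasDerivAt_dy hU hz)).deriv

theorem dx_const_smul (c : ℝ) (g : ℝ → ℝ → ℝ) : dx (c • g) = c • dx g := by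
  funext x y
  exact congrFun (deriv_const_mul_field' (v := fun s => g s y) c) x

theorem dy_const_smul (c : ℝ) (g : ℝ → ℝ → ℝ) : dy (c • g) = c • dy g := by
  funext x y
  exact congrFun (deriv_const_mul_field' (v := fun s => g x s) c) y

end SmoothFunctions

/-! ### Derivatives with respect to a new independent variable, and quartic test curves. -/

theorem ContDiffAt.differentiableAt_iteratedDeriv {u : ℝ → ℝ} {t : ℝ} {n k : ℕ}
    (hu : ContDiffAt ℝ n u t) (hk : k < n) : DifferentiableAt ℝ (iteratedDeriv k u) t := by
  have h : ContDiffAt ℝ 1 (iteratedFDeriv ℝ k u) t :=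
    hu.iteratedFDeriv_right (by norm_cast; omega)
  rw [iteratedDeriv_eq_equiv_comp]
  exact ((ContinuousMultilinearMap.piFieldEquiv ℝ (Fin k)
    ℝ).symm.toContinuousLinearEquiv.differentiableAt).comp t (h.differentiableAt (by simp))

/-- If `u^(k) ∘ F = v` near `x₀` and `v' = v₁ F'` with `F' ≠ 0`, then `u^(k+1) ∘ F = v₁`
near `x₀`. -/
theorem iteratedDeriv_succ_comp_eventuallyEq {u F v v₁ P : ℝ → ℝ} {x₀ : ℝ} {k : ℕ} (hk : k < 4)
    (hu : ContDiffAt ℝ 4 u (F x₀)) (hF : ∀ᶠ x in 𝓝 x₀, HasDerivAt F (P x) x)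
    (hP : ∀ᶠ x in 𝓝 x₀, P x ≠ 0) (hv : ∀ᶠ x in 𝓝 x₀, HasDerivAt v (v₁ x * P x) x)
    (h : ∀ᶠ x in 𝓝 x₀, iteratedDeriv k u (F x) = v x) :
    ∀ᶠ x in 𝓝 x₀, iteratedDeriv (k + 1) u (F x) = v₁ x := by
  have hu' : ∀ᶠ t in 𝓝 (F x₀), ContDiffAt ℝ 4 u t := hu.eventually (by simp)
  have hu'' := hF.self_of_nhds.continuousAt.eventually hu'
  filter_upwards [hF, hP, hv, h.eventually_nhds, hu''] with x hF hP hv h hu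
  have hd : HasDerivAt (iteratedDeriv k u) (iteratedDeriv (k + 1) u (F x)) (F x) := by
    rw [iteratedDeriv_succ]
    exact (ContDiffAt.differentiableAt_iteratedDeriv hu hk).hasDerivAt
  have h1 := hd.comp x hF
  -- Equality on a neighbourhood, not only at `x₀`, is what allows differentiation here, and it is
  -- also what the next order needs.
  have h2 : HasDerivAt (iteratedDeriv k u ∘ F) (v₁ x * P x) x := hv.congr_of_eventuallyEq h
  exact mul_right_cancel₀ hP (h1.unique h2)

/-- The derivatives of `u` at `F x₀` when `u ∘ F = G`, found by repeated differentiation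
with respect to `F`. -/
theorem iteratedDeriv_of_comp {u F G P v₁ v₂ v₃ v₄ : ℝ → ℝ} {x₀ : ℝ}
    (hu : ContDiffAt ℝ 4 u (F x₀)) (huG : ∀ᶠ x in 𝓝 x₀, u (F x) = G x)
    (hF : ∀ᶠ x in 𝓝 x₀, HasDerivAt F (P x) x) (hP : ∀ᶠ x in 𝓝 x₀, P x ≠ 0)
    (h0 : ∀ᶠ x in 𝓝 x₀, HasDerivAt G (v₁ x * P x) x)
    (h1 : ∀ᶠ x in 𝓝 x₀, HasDerivAt v₁ (v₂ x * P x) x)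
    (h2 : ∀ᶠ x in 𝓝 x₀, HasDerivAt v₂ (v₃ x * P x) x)
    (h3 : ∀ᶠ x in 𝓝 x₀, HasDerivAt v₃ (v₄ x * P x) x) :
    iteratedDeriv 1 u (F x₀) = v₁ x₀ ∧ iteratedDeriv 2 u (F x₀) = v₂ x₀ ∧
      iteratedDeriv 3 u (F x₀) = v₃ x₀ ∧ iteratedDeriv 4 u (F x₀) = v₄ x₀ := by
  have e0 : ∀ᶠ x in 𝓝 x₀, iteratedDeriv 0 u (F x) = G x := by simpa using huG
  have e1 := iteratedDeriv_succ_comp_eventuallyEq (by norm_num) hu hF hP h0 e0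
  have e2 := iteratedDeriv_succ_comp_eventuallyEq (by norm_num) hu hF hP h1 e1
  have e3 := iteratedDeriv_succ_comp_eventuallyEq (by norm_num) hu hF hP h2 e2
  have e4 := iteratedDeriv_succ_comp_eventuallyEq (by norm_num) hu hF hP h3 e3
  exact ⟨e1.self_of_nhds, e2.self_of_nhds, e3.self_of_nhds, e4.self_of_nhds⟩

/-- A parametrized curve `(F, G)` with `F' ≠ 0` is locally the graph of a function. -/
theorem exists_comp_eventuallyEq {F G : ℝ → ℝ} {x₀ F' : ℝ} (hF : ContDiffAt ℝ 4 F x₀)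
    (hG : ContDiffAt ℝ 4 G x₀) (hF' : HasDerivAt F F' x₀) (h0 : F' ≠ 0) :
    ∃ u : ℝ → ℝ, ContDiffAt ℝ 4 u (F x₀) ∧ ∀ᶠ x in 𝓝 x₀, u (F x) = G x := by
  set e : ℝ ≃L[ℝ] ℝ := ContinuousLinearEquiv.unitsEquivAut ℝ (Units.mk0 F' h0)
  have he : HasFDerivAt F (e : ℝ →L[ℝ] ℝ) x₀ := by
    have : (e : ℝ →L[ℝ] ℝ) = ContinuousLinearMap.toSpanSingleton ℝ F' := by
      ext; simp [e]
    rw [this]; exact hF'.hasFDerivAt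
  have h4 : (4 : WithTop ℕ∞) ≠ 0 := by simp
  have hs := hF.hasStrictFDerivAt' he h4
  -- The inverse function theorem gives a `C⁴` local inverse of `F`, so `u = G ∘ F⁻¹`.
  refine ⟨G ∘ hF.localInverse he h4, ?_, ?_⟩
  · refine ContDiffAt.comp _ ?_ (hF.to_localInverse he h4)
    rwa [hF.localInverse_apply_image he h4]
  · have := hs.eventually_left_inverse
    filter_upwards [this] with x hx
    exact congrArg G hx

/-- The polynomial `y₀ + p (x - x₀) + ⋯ + w (x - x₀)⁴ / 24`. -/
def taylorQuartic (x₀ y₀ p q s w x : ℝ) : ℝ :=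
  y₀ + p * (x - x₀) + q / 2 * (x - x₀) ^ 2 + s / 6 * (x - x₀) ^ 3 + w / 24 * (x - x₀) ^ 4

/-- With the factorials built in, differentiation merely shifts the list of coefficients. All
derivatives of the test curve thus stay in the same family. -/
theorem hasDerivAt_taylorQuartic (x₀ y₀ p q s w x : ℝ) :
    HasDerivAt (taylorQuartic x₀ y₀ p q s w) (taylorQuartic x₀ p q s w 0 x) x := by
  have h := (hasDerivAt_id x).sub_const x₀
  have := ((((h.const_mul p).const_add y₀).add ((h.pow 2).const_mul (q / 2))).add
    ((h.pow 3).const_mul (s / 6))).add ((h.pow 4).const_mul (w / 24))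
  refine this.congr_deriv ?_
  simp [taylorQuartic]
  ring

theorem contDiff_taylorQuartic (x₀ y₀ p q s w : ℝ) :
    ContDiff ℝ 4 (taylorQuartic x₀ y₀ p q s w) := by
  unfold taylorQuartic
  fun_prop

@[simp] theorem taylorQuartic_self (x₀ y₀ p q s w : ℝ) : taylorQuartic x₀ y₀ p q s w x₀ = y₀ := by
  simp [taylorQuartic]

theorem iteratedDeriv_taylorQuartic (x₀ y₀ p q s w : ℝ) :
    iteratedDeriv 1 (taylorQuartic x₀ y₀ p q s w) x₀ = p ∧
    iteratedDeriv 2 (taylorQuartic x₀ y₀ p q s w) x₀ = q ∧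
    iteratedDeriv 3 (taylorQuartic x₀ y₀ p q s w) x₀ = s ∧
    iteratedDeriv 4 (taylorQuartic x₀ y₀ p q s w) x₀ = w := by
  have hd : ∀ y₀ p q s w, deriv (taylorQuartic x₀ y₀ p q s w) = taylorQuartic x₀ p q s w 0 :=
    fun y₀ p q s w => funext fun x => (hasDerivAt_taylorQuartic x₀ y₀ p q s w x).deriv
  simp [iteratedDeriv_succ', hd]

/-! ### Total derivatives of `g(x, y(x))` up to order four. -/

section TotalDerivatives

/-- The first total derivative of `g(x, y(x))`; here `p = y'`. -/
def total₁ (g : ℝ → ℝ → ℝ) (x y p : ℝ) : ℝ := dx g x y + p * dy g x y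

/-- The second total derivative of `g(x, y(x))`; here `p = y'`, `q = y''`. -/
def total₂ (g : ℝ → ℝ → ℝ) (x y p q : ℝ) : ℝ :=
  dx (dx g) x y + 2 * p * dy (dx g) x y + p ^ 2 * dy (dy g) x y + q * dy g x y

/-- The third total derivative of `g(x, y(x))`; here `p = y'`, `q = y''`, `s = y'''`. -/
def total₃ (g : ℝ → ℝ → ℝ) (x y p q s : ℝ) : ℝ :=
  dx (dx (dx g)) x y + 3 * p * dy (dx (dx g)) x y + 3 * p ^ 2 * dy (dy (dx g)) x y
    + p ^ 3 * dy (dy (dy g)) x y + 3 * q * (dy (dx g) x y + p * dy (dy g) x y) + s * dy g x y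

/-- The fourth total derivative of `g(x, y(x))`; here `p = y'`, `q = y''`, `s = y'''`,
`w = y''''`. -/
def total₄ (g : ℝ → ℝ → ℝ) (x y p q s w : ℝ) : ℝ :=
  dx (dx (dx (dx g))) x y + 4 * p * dy (dx (dx (dx g))) x y + 6 * p ^ 2 * dy (dy (dx (dx g))) x y
    + 4 * p ^ 3 * dy (dy (dy (dx g))) x y + p ^ 4 * dy (dy (dy (dy g))) x y
    + 6 * q * (dy (dx (dx g)) x y + 2 * p * dy (dy (dx g)) x y + p ^ 2 * dy (dy (dy g)) x y)
    + 3 * q ^ 2 * dy (dy g) x y + 4 * s * (dy (dx g) x y + p * dy (dy g) x y) + w * dy g x y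

variable {U : Set (ℝ × ℝ)} {g y y₁ y₂ y₃ : ℝ → ℝ → ℝ} {x : ℝ} {n : ℕ}

theorem SmoothOn.hasDerivAt_total₀ {c : ℝ → ℝ} {p : ℝ} (hg : SmoothOn (n + 1) U g) (hU : IsOpen U)
    (hz : (x, c x) ∈ U) (hc : HasDerivAt c p x) :
    HasDerivAt (fun x => g x (c x)) (total₁ g x (c x) p) x :=
  hg.hasDerivAt_graph hU hz hc

/-- The chain rule produces mixed partials in both orders; here and at the higher orders they are
normalised so that the `x`-derivatives are taken first. -/
theorem SmoothOn.hasDerivAt_total₁ {c c₁ : ℝ → ℝ} {q : ℝ} (hg : SmoothOn (n + 2) U g)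
    (hU : IsOpen U) (hz : (x, c x) ∈ U) (hc : HasDerivAt c (c₁ x) x) (hc₁ : HasDerivAt c₁ q x) :
    HasDerivAt (fun x => total₁ g x (c x) (c₁ x)) (total₂ g x (c x) (c₁ x) q) x := by
  have h1 := (hg.dx hU).hasDerivAt_graph hU hz hc
  have h2 := (hg.dy hU).hasDerivAt_graph hU hz hc
  refine (h1.add (hc₁.mul h2)).congr_deriv ?_
  rw [hg.dx_dy hU hz, total₂]
  ring

/-- The `x`-derivative is moved inwards one place at a time: past the outer `y`-derivative by
symmetry for `g_y`, then past the inner one by differentiating the symmetry for `g`, valid on all of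
`U`. -/
theorem SmoothOn.dx_dy_dy (hg : SmoothOn (n + 3) U g) (hU : IsOpen U) {x y : ℝ}
    (hz : (x, y) ∈ U) :
    FourthOrder.dx (FourthOrder.dy (FourthOrder.dy g)) x y
      = FourthOrder.dy (FourthOrder.dy (FourthOrder.dx g)) x y :=
  ((hg.dy hU).dx_dy hU hz).trans
    (dy_congr hU (fun _ _ h => (hg.mono (by omega) : SmoothOn (n + 2) U g).dx_dy hU h) hz)

theorem SmoothOn.dx_dy_dy_dy (hg : SmoothOn (n + 4) U g) (hU : IsOpen U) {x y : ℝ}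
    (hz : (x, y) ∈ U) :
    FourthOrder.dx (FourthOrder.dy (FourthOrder.dy (FourthOrder.dy g))) x y
      = FourthOrder.dy (FourthOrder.dy (FourthOrder.dy (FourthOrder.dx g))) x y :=
  (((hg.dy hU).dy hU).dx_dy hU hz).trans
    (dy_congr hU (fun _ _ h => (hg.mono (by omega) : SmoothOn (n + 3) U g).dx_dy_dy hU h) hz)

theorem SmoothOn.hasDerivAt_total₂ {c c₁ c₂ : ℝ → ℝ} {s : ℝ} (hg : SmoothOn (n + 3) U g)
    (hU : IsOpen U) (hz : (x, c x) ∈ U) (hc : HasDerivAt c (c₁ x) x)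
    (hc₁ : HasDerivAt c₁ (c₂ x) x) (hc₂ : HasDerivAt c₂ s x) :
    HasDerivAt (fun x => total₂ g x (c x) (c₁ x) (c₂ x)) (total₃ g x (c x) (c₁ x) (c₂ x) s) x := by
  have h1 := ((hg.dx hU).dx hU).hasDerivAt_graph hU hz hc
  have h2 := ((hg.dx hU).dy hU).hasDerivAt_graph hU hz hc
  have h3 := ((hg.dy hU).dy hU).hasDerivAt_graph hU hz hc
  have h4 := (hg.dy hU).hasDerivAt_graph hU hz hc
  refine (((h1.add ((hc₁.const_mul 2).mul h2)).add ((hc₁.pow 2).mul h3)).add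
    (hc₂.mul h4)).congr_deriv ?_
  rw [(hg.dx hU).dx_dy hU hz, hg.dx_dy_dy hU hz,
    (hg.mono (by omega) : SmoothOn (n + 1 + 2) U g).dx_dy hU hz, total₃]
  simp only [Pi.pow_apply]
  push_cast
  ring

theorem SmoothOn.hasDerivAt_total₃ {c c₁ c₂ c₃ : ℝ → ℝ} {w : ℝ} (hg : SmoothOn (n + 4) U g)
    (hU : IsOpen U) (hz : (x, c x) ∈ U) (hc : HasDerivAt c (c₁ x) x)
    (hc₁ : HasDerivAt c₁ (c₂ x) x) (hc₂ : HasDerivAt c₂ (c₃ x) x) (hc₃ : HasDerivAt c₃ w x) :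
    HasDerivAt (fun x => total₃ g x (c x) (c₁ x) (c₂ x) (c₃ x))
      (total₄ g x (c x) (c₁ x) (c₂ x) (c₃ x) w) x := by
  have h1 := (((hg.dx hU).dx hU).dx hU).hasDerivAt_graph hU hz hc
  have h2 := (((hg.dx hU).dx hU).dy hU).hasDerivAt_graph hU hz hc
  have h3 := (((hg.dx hU).dy hU).dy hU).hasDerivAt_graph hU hz hc
  have h4 := (((hg.dy hU).dy hU).dy hU).hasDerivAt_graph hU hz hc
  have h5 := ((hg.dx hU).dy hU).hasDerivAt_graph hU hz hc
  have h6 := ((hg.dy hU).dy hU).hasDerivAt_graph hU hz hc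
  have h7 := (hg.dy hU).hasDerivAt_graph hU hz hc
  have e1 := (hg.mono (by omega) : SmoothOn (n + 2 + 2) U g).dx_dy hU hz
  have e2 := (hg.mono (by omega) : SmoothOn (n + 1 + 3) U g).dx_dy_dy hU hz
  refine ((((((h1.add ((hc₁.const_mul 3).mul h2)).add (((hc₁.pow 2).const_mul 3).mul h3)).add
    ((hc₁.pow 3).mul h4)).add ((hc₂.const_mul 3).mul (h5.add (hc₁.mul h6)))).add
    (hc₃.mul h7))).congr_deriv ?_
  rw [((hg.dx hU).dx hU).dx_dy hU hz, (hg.dx hU).dx_dy_dy hU hz, hg.dx_dy_dy_dy hU hz,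
    ((hg.dx hU).mono (by omega) : SmoothOn (n + 1 + 2) U (FourthOrder.dx g)).dx_dy hU hz,
    e1, e2, total₄]
  simp only [Pi.pow_apply, Pi.add_apply, Pi.mul_apply]
  push_cast
  ring

end TotalDerivatives

/-! ### The equation satisfied by the value of `f` at each jet. -/

section TransformedEquation

/-- The derivatives of `u` at `F x₀` when `u ∘ F = G`, in terms of those of `F` and `G`. -/
theorem iteratedDeriv_of_comp_eq {u F G P P₁ P₂ P₃ A A₁ A₂ A₃ : ℝ → ℝ} {x₀ : ℝ}
    (hu : ContDiffAt ℝ 4 u (F x₀)) (huG : ∀ᶠ x in 𝓝 x₀, u (F x) = G x)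
    (hP : ∀ᶠ x in 𝓝 x₀, P x ≠ 0)
    (hF : ∀ᶠ x in 𝓝 x₀, HasDerivAt F (P x) x) (hF₁ : ∀ᶠ x in 𝓝 x₀, HasDerivAt P (P₁ x) x)
    (hF₂ : ∀ᶠ x in 𝓝 x₀, HasDerivAt P₁ (P₂ x) x) (hF₃ : ∀ᶠ x in 𝓝 x₀, HasDerivAt P₂ (P₃ x) x)
    (hG : ∀ᶠ x in 𝓝 x₀, HasDerivAt G (A x) x) (hG₁ : ∀ᶠ x in 𝓝 x₀, HasDerivAt A (A₁ x) x)
    (hG₂ : ∀ᶠ x in 𝓝 x₀, HasDerivAt A₁ (A₂ x) x) (hG₃ : ∀ᶠ x in 𝓝 x₀, HasDerivAt A₂ (A₃ x) x) :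
    iteratedDeriv 1 u (F x₀) = A x₀ / P x₀ ∧
    iteratedDeriv 2 u (F x₀) = (P x₀ * A₁ x₀ - A x₀ * P₁ x₀) / P x₀ ^ 3 ∧
    iteratedDeriv 3 u (F x₀) = (P x₀ * (P x₀ * A₂ x₀ - A x₀ * P₂ x₀)
      - 3 * P₁ x₀ * (P x₀ * A₁ x₀ - A x₀ * P₁ x₀)) / P x₀ ^ 5 ∧
    iteratedDeriv 4 u (F x₀) =
      (P x₀ ^ 2 * (P x₀ * A₃ x₀ + P₁ x₀ * A₂ x₀ - A₁ x₀ * P₂ x₀ - A x₀ * P₃ x₀)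
      - 7 * P x₀ * P₁ x₀ * (P x₀ * A₂ x₀ - A x₀ * P₂ x₀)
      + (15 * P₁ x₀ ^ 2 - 3 * P x₀ * P₂ x₀) * (P x₀ * A₁ x₀ - A x₀ * P₁ x₀)) / P x₀ ^ 7 := by
  -- Each `vₖ₊₁` is `vₖ' / P`. Since `(P A₁ - A P₁)' = P A₂ - A P₂`, the terms `P₁ A₁` cancel and
  -- the denominators are `P, P³, P⁵, P⁷`.
  refine iteratedDeriv_of_comp
    (v₁ := fun x => A x / P x)
    (v₂ := fun x => (P x * A₁ x - A x * P₁ x) / P x ^ 3)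
    (v₃ := fun x => (P x * (P x * A₂ x - A x * P₂ x)
      - 3 * P₁ x * (P x * A₁ x - A x * P₁ x)) / P x ^ 5)
    (v₄ := fun x => (P x ^ 2 * (P x * A₃ x + P₁ x * A₂ x - A₁ x * P₂ x - A x * P₃ x)
      - 7 * P x * P₁ x * (P x * A₂ x - A x * P₂ x)
      + (15 * P₁ x ^ 2 - 3 * P x * P₂ x) * (P x * A₁ x - A x * P₁ x)) / P x ^ 7)
    hu huG hF hP ?_ ?_ ?_ ?_
  · filter_upwards [hG, hP] with x hG hP
    convert hG using 1
    field_simp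
  · filter_upwards [hG₁, hF₁, hP] with x hG hF hP
    refine (hG.div hF hP).congr_deriv ?_
    field_simp
  · filter_upwards [hG₁, hG₂, hF₁, hF₂, hP] with x hG hG₂ hF hF₂ hP
    refine (((hF.mul hG₂).sub (hG.mul hF₂)).div (hF.pow 3) (pow_ne_zero 3 hP)).congr_deriv ?_
    simp only [Pi.pow_apply, Pi.sub_apply, Pi.mul_apply]
    push_cast
    field_simp
    ring
  · filter_upwards [hG₁, hG₂, hG₃, hF₁, hF₂, hF₃, hP] with x hG hG₂ hG₃ hF hF₂ hF₃ hP
    refine (((hF.mul ((hF.mul hG₃).sub (hG.mul hF₃))).sub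
      ((hF₂.const_mul 3).mul ((hF.mul hG₂).sub (hG.mul hF₂)))).div (hF.pow 5)
      (pow_ne_zero 5 hP)).congr_deriv ?_
    simp only [Pi.pow_apply, Pi.sub_apply, Pi.mul_apply]
    push_cast
    field_simp
    ring

/-- The transform of `u⁗ + a₃ u''' + a₂ u'' + a₁ u' + a₀ u - b`, multiplied by the seventh power
of `φ_x + y' φ_y`. -/
def transformedEquation (phi psi : ℝ → ℝ → ℝ) (a₃ a₂ a₁ a₀ b : ℝ → ℝ) (x y p q s w : ℝ) : ℝ :=
  let P := total₁ phi x y p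
  let P₁ := total₂ phi x y p q
  let P₂ := total₃ phi x y p q s
  let P₃ := total₄ phi x y p q s w
  let A := total₁ psi x y p
  let A₁ := total₂ psi x y p q
  let A₂ := total₃ psi x y p q s
  let A₃ := total₄ psi x y p q s w
  let t := phi x y
  P ^ 2 * (P * A₃ + P₁ * A₂ - A₁ * P₂ - A * P₃) - 7 * P * P₁ * (P * A₂ - A * P₂)
    + (15 * P₁ ^ 2 - 3 * P * P₂) * (P * A₁ - A * P₁)
    + a₃ t * P ^ 2 * (P * (P * A₂ - A * P₂) - 3 * P₁ * (P * A₁ - A * P₁))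
    + a₂ t * P ^ 4 * (P * A₁ - A * P₁) + a₁ t * P ^ 6 * A + (a₀ t * psi x y - b t) * P ^ 7

/-- Only `A₃` and `P₃` contain `w`, with coefficients `ψ_y` and `φ_y`, so `w` is multiplied by `P²
(P ψ_y - A φ_y)`. The terms with `p` cancel in the bracket and leave `Δ`. -/
theorem transformedEquation_eq_add (phi psi : ℝ → ℝ → ℝ) (a₃ a₂ a₁ a₀ b : ℝ → ℝ)
    (x y p q s w : ℝ) :
    transformedEquation phi psi a₃ a₂ a₁ a₀ b x y p q s w =
      transformedEquation phi psi a₃ a₂ a₁ a₀ b x y p q s 0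
        + total₁ phi x y p ^ 2 * jacobian phi psi x y * w := by
  simp only [transformedEquation, total₁, total₄, jacobian]
  ring

variable {U : Set (ℝ × ℝ)} {φ ψ : ℝ → ℝ → ℝ} {Ω : Set (ℝ × ℝ × ℝ × ℝ × ℝ)}
  {f : ℝ × ℝ × ℝ × ℝ × ℝ → ℝ} {a₃ a₂ a₁ a₀ b : ℝ → ℝ} {x₀ y₀ p q s w : ℝ} {u : ℝ → ℝ}

theorem IsPointTransformation.smoothOn_phi (hT : IsPointTransformation U φ ψ) : SmoothOn 4 U φ :=
  hT.contDiffOn_phi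

theorem IsPointTransformation.smoothOn_psi (hT : IsPointTransformation U φ ψ) : SmoothOn 4 U ψ :=
  hT.contDiffOn_psi

theorem eventually_mem_graph (hU : IsOpen U) {c : ℝ → ℝ} (hc : ContinuousAt c x₀)
    (hz : (x₀, c x₀) ∈ U) : ∀ᶠ x in 𝓝 x₀, (x, c x) ∈ U :=
  (continuousAt_id.prodMk hc).eventually (hU.mem_nhds hz)

theorem eventually_total₁_ne_zero (hT : IsPointTransformation U φ ψ) (hz : (x₀, y₀) ∈ U)
    (hP : total₁ φ x₀ y₀ p ≠ 0) :
    ∀ᶠ x in 𝓝 x₀, total₁ φ x (taylorQuartic x₀ y₀ p q s w x)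
      (taylorQuartic x₀ p q s w 0 x) ≠ 0 := by
  have h := hT.smoothOn_phi.hasDerivAt_total₁ (n := 2) hT.isOpen (x := x₀)
    (c := taylorQuartic x₀ y₀ p q s w) (c₁ := taylorQuartic x₀ p q s w 0) (by simpa using hz)
    (hasDerivAt_taylorQuartic _ _ _ _ _ _ _) (hasDerivAt_taylorQuartic _ _ _ _ _ _ _)
  exact h.continuousAt.eventually_ne (by simpa using hP)

/-- Along the graph of a quartic polynomial, the linear expression in `u` is the transformed
expression up to the factor `(φ_x + y' φ_y)⁷`. -/
theorem linear_eq_transformedEquation_div (hT : IsPointTransformation U φ ψ)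
    (hz : (x₀, y₀) ∈ U) (hP : total₁ φ x₀ y₀ p ≠ 0) (hu : ContDiffAt ℝ 4 u (φ x₀ y₀))
    (huG : ∀ᶠ x in 𝓝 x₀, u (φ x (taylorQuartic x₀ y₀ p q s w x)) =
      ψ x (taylorQuartic x₀ y₀ p q s w x)) :
    iteratedDeriv 4 u (φ x₀ y₀) + a₃ (φ x₀ y₀) * iteratedDeriv 3 u (φ x₀ y₀)
        + a₂ (φ x₀ y₀) * iteratedDeriv 2 u (φ x₀ y₀) + a₁ (φ x₀ y₀) * iteratedDeriv 1 u (φ x₀ y₀)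
        + a₀ (φ x₀ y₀) * u (φ x₀ y₀) - b (φ x₀ y₀) =
      transformedEquation φ ψ a₃ a₂ a₁ a₀ b x₀ y₀ p q s w / total₁ φ x₀ y₀ p ^ 7 := by
  set c := taylorQuartic x₀ y₀ p q s w with hc
  set c₁ := taylorQuartic x₀ p q s w 0 with hc₁
  set c₂ := taylorQuartic x₀ q s w 0 0 with hc₂
  set c₃ := taylorQuartic x₀ s w 0 0 0 with hc₃
  have h0 : ∀ x, HasDerivAt c (c₁ x) x := hasDerivAt_taylorQuartic _ _ _ _ _ _
  have h1 : ∀ x, HasDerivAt c₁ (c₂ x) x := hasDerivAt_taylorQuartic _ _ _ _ _ _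
  have h2 : ∀ x, HasDerivAt c₂ (c₃ x) x := hasDerivAt_taylorQuartic _ _ _ _ _ _
  have h3 : ∀ x, HasDerivAt c₃ w x := fun x => by
    simpa [taylorQuartic] using hasDerivAt_taylorQuartic x₀ s w 0 0 0 x
  have hU : ∀ᶠ x in 𝓝 x₀, (x, c x) ∈ U :=
    eventually_mem_graph hT.isOpen (h0 x₀).continuousAt (by simpa [hc] using hz)
  have hφ := hT.smoothOn_phi
  have hψ := hT.smoothOn_psi
  have hne := eventually_total₁_ne_zero (q := q) (s := s) (w := w) hT hz hP
  have hu0 : u (φ x₀ y₀) = ψ x₀ y₀ := by simpa [hc] using huG.self_of_nhds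
  obtain ⟨e1, e2, e3, e4⟩ := iteratedDeriv_of_comp_eq
    (F := fun x => φ x (c x)) (G := fun x => ψ x (c x))
    (P := fun x => total₁ φ x (c x) (c₁ x)) (P₁ := fun x => total₂ φ x (c x) (c₁ x) (c₂ x))
    (P₂ := fun x => total₃ φ x (c x) (c₁ x) (c₂ x) (c₃ x))
    (P₃ := fun x => total₄ φ x (c x) (c₁ x) (c₂ x) (c₃ x) w)
    (A := fun x => total₁ ψ x (c x) (c₁ x)) (A₁ := fun x => total₂ ψ x (c x) (c₁ x) (c₂ x))
    (A₂ := fun x => total₃ ψ x (c x) (c₁ x) (c₂ x) (c₃ x))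
    (A₃ := fun x => total₄ ψ x (c x) (c₁ x) (c₂ x) (c₃ x) w)
    (by simpa [hc] using hu) huG hne
    -- The values `n = 3, 2, 1, 0` count the orders of differentiability left after each total
    -- derivative; the fourth one uses up the class `C⁴`.
    (hU.mono fun x hx => hφ.hasDerivAt_total₀ (n := 3) hT.isOpen hx (h0 x))
    (hU.mono fun x hx => hφ.hasDerivAt_total₁ (n := 2) hT.isOpen hx (h0 x) (h1 x))
    (hU.mono fun x hx => hφ.hasDerivAt_total₂ (n := 1) hT.isOpen hx (h0 x) (h1 x) (h2 x))
    (hU.mono fun x hx => hφ.hasDerivAt_total₃ (n := 0) hT.isOpen hx (h0 x) (h1 x) (h2 x) (h3 x))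
    (hU.mono fun x hx => hψ.hasDerivAt_total₀ (n := 3) hT.isOpen hx (h0 x))
    (hU.mono fun x hx => hψ.hasDerivAt_total₁ (n := 2) hT.isOpen hx (h0 x) (h1 x))
    (hU.mono fun x hx => hψ.hasDerivAt_total₂ (n := 1) hT.isOpen hx (h0 x) (h1 x) (h2 x))
    (hU.mono fun x hx => hψ.hasDerivAt_total₃ (n := 0) hT.isOpen hx (h0 x) (h1 x) (h2 x) (h3 x))
  simp only [hc, hc₁, hc₂, hc₃, taylorQuartic_self] at e1 e2 e3 e4
  rw [e1, e2, e3, e4, hu0, transformedEquation]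
  field_simp
  ring

/-- Through every jet of `Ω` there is a quartic polynomial which satisfies the equation
`y⁗ = f` at the base point, and whose graph is carried to that of a function satisfying the
linear equation. -/
theorem ObtainedFromLinear.exists_solution (hT : IsPointTransformation U φ ψ)
    (hΩ : Ω ⊆ regularJets U φ) (h : ObtainedFromLinear Ω f φ ψ a₃ a₂ a₁ a₀ b)
    (hj : (x₀, y₀, p, q, s) ∈ Ω) :
    ∃ u : ℝ → ℝ, ContDiffAt ℝ 4 u (φ x₀ y₀) ∧
      (∀ᶠ x in 𝓝 x₀, u (φ x (taylorQuartic x₀ y₀ p q s (f (x₀, y₀, p, q, s)) x)) =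
        ψ x (taylorQuartic x₀ y₀ p q s (f (x₀, y₀, p, q, s)) x)) ∧
      iteratedDeriv 4 u (φ x₀ y₀) + a₃ (φ x₀ y₀) * iteratedDeriv 3 u (φ x₀ y₀)
        + a₂ (φ x₀ y₀) * iteratedDeriv 2 u (φ x₀ y₀) + a₁ (φ x₀ y₀) * iteratedDeriv 1 u (φ x₀ y₀)
        + a₀ (φ x₀ y₀) * u (φ x₀ y₀) = b (φ x₀ y₀) := by
  obtain ⟨hz, hP⟩ := hΩ hj
  change total₁ φ x₀ y₀ p ≠ 0 at hP
  change (x₀, y₀) ∈ U at hz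
  -- The expression is affine in `w` with slope `P²Δ ≠ 0`, so it has a root.
  obtain ⟨w, hw⟩ : ∃ w, transformedEquation φ ψ a₃ a₂ a₁ a₀ b x₀ y₀ p q s w = 0 := by
    refine ⟨-transformedEquation φ ψ a₃ a₂ a₁ a₀ b x₀ y₀ p q s 0 /
      (total₁ φ x₀ y₀ p ^ 2 * jacobian φ ψ x₀ y₀), ?_⟩
    have := hT.jacobian_ne_zero _ _ hz
    rw [transformedEquation_eq_add]
    field_simp
    ring
  set c := taylorQuartic x₀ y₀ p q s w with hc
  have hc0 : c x₀ = y₀ := taylorQuartic_self _ _ _ _ _ _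
  have hcd : ContDiffAt ℝ 4 c x₀ := (contDiff_taylorQuartic _ _ _ _ _ _).contDiffAt
  have hpair : ContDiffAt ℝ 4 (fun x => (x, c x)) x₀ := contDiffAt_id.prodMk hcd
  have hF : ContDiffAt ℝ 4 (fun x => φ x (c x)) x₀ :=
    ContDiffAt.comp (g := fun z : ℝ × ℝ => φ z.1 z.2) (f := fun x => (x, c x)) x₀
      (hT.smoothOn_phi.contDiffAt hT.isOpen (by simpa [hc0] using hz)) hpair
  have hG : ContDiffAt ℝ 4 (fun x => ψ x (c x)) x₀ :=
    ContDiffAt.comp (g := fun z : ℝ × ℝ => ψ z.1 z.2) (f := fun x => (x, c x)) x₀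
      (hT.smoothOn_psi.contDiffAt hT.isOpen (by simpa [hc0] using hz)) hpair
  have hF' : HasDerivAt (fun x => φ x (c x)) (total₁ φ x₀ (c x₀) p) x₀ :=
    hT.smoothOn_phi.hasDerivAt_total₀ (n := 3) hT.isOpen (by simpa [hc0] using hz)
      (by simpa using hasDerivAt_taylorQuartic x₀ y₀ p q s w x₀)
  obtain ⟨u, hu, huG⟩ := exists_comp_eventuallyEq hF hG hF' (by rwa [hc0])
  simp only [hc0] at hu
  have hlin := linear_eq_transformedEquation_div (a₃ := a₃) (a₂ := a₂) (a₁ := a₁) (a₀ := a₀)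
    (b := b) hT hz hP hu huG
  rw [hw, zero_div, sub_eq_zero] at hlin
  obtain ⟨i1, i2, i3, i4⟩ := iteratedDeriv_taylorQuartic x₀ y₀ p q s w
  -- The linear equation holds by the choice of `w`, so the equation for `y` holds at `x₀`, which
  -- says that `w` is the value of `f`.
  have key := (h x₀ (φ x₀ y₀) c u (by rw [hc0]) hcd hu huG (by rwa [hc0, i1, i2, i3])).2 hlin
  rw [hc0, i1, i2, i3, i4] at key
  rw [← key]
  exact ⟨u, hu, huG, hlin⟩

/-- On the quartic of `exists_solution` the linear expression vanishes; multiplying by `P⁷ ≠ 0`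
leaves its numerator. -/
theorem ObtainedFromLinear.transformedEquation_eq_zero (hT : IsPointTransformation U φ ψ)
    (hΩ : Ω ⊆ regularJets U φ) (h : ObtainedFromLinear Ω f φ ψ a₃ a₂ a₁ a₀ b)
    (hj : (x₀, y₀, p, q, s) ∈ Ω) :
    transformedEquation φ ψ a₃ a₂ a₁ a₀ b x₀ y₀ p q s (f (x₀, y₀, p, q, s)) = 0 := by
  obtain ⟨u, hu, huG, hlin⟩ := h.exists_solution hT hΩ hj
  have hP : total₁ φ x₀ y₀ p ≠ 0 := (hΩ hj).2
  have := linear_eq_transformedEquation_div (a₃ := a₃) (a₂ := a₂) (a₁ := a₁) (a₀ := a₀)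
    (b := b) hT (hΩ hj).1 hP hu huG
  rw [hlin, sub_self] at this
  simpa [hP] using this.symm

end TransformedEquation

/-! ### Linearity in `y'''`, and the first class when `φ_y = 0`. -/

section FirstForm

/-- The quantities containing `s` are the third and fourth total derivatives, each affine in `s`,
and no two of them are multiplied together. An affine function is determined by its values at `0`
and `1`. -/
theorem transformedEquation_linear (phi psi : ℝ → ℝ → ℝ) (a₃ a₂ a₁ a₀ b : ℝ → ℝ)
    (x y p q s : ℝ) :
    transformedEquation phi psi a₃ a₂ a₁ a₀ b x y p q s 0 =
      transformedEquation phi psi a₃ a₂ a₁ a₀ b x y p q 0 0 +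
        s * (transformedEquation phi psi a₃ a₂ a₁ a₀ b x y p q 1 0 -
          transformedEquation phi psi a₃ a₂ a₁ a₀ b x y p q 0 0) := by
  simp only [transformedEquation, total₃, total₄]
  ring

variable {U : Set (ℝ × ℝ)} {φ ψ : ℝ → ℝ → ℝ} {Ω : Set (ℝ × ℝ × ℝ × ℝ × ℝ)}
  {f : ℝ × ℝ × ℝ × ℝ × ℝ → ℝ} {a₃ a₂ a₁ a₀ b : ℝ → ℝ}

theorem ObtainedFromLinear.isLinearInThirdDerivative (hT : IsPointTransformation U φ ψ)
    (hΩ : Ω ⊆ regularJets U φ) (h : ObtainedFromLinear Ω f φ ψ a₃ a₂ a₁ a₀ b) :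
    IsLinearInThirdDerivative Ω f := by
  refine ⟨fun x y p q => -(transformedEquation φ ψ a₃ a₂ a₁ a₀ b x y p q 1 0 -
      transformedEquation φ ψ a₃ a₂ a₁ a₀ b x y p q 0 0) /
      (total₁ φ x y p ^ 2 * jacobian φ ψ x y),
    fun x y p q => -transformedEquation φ ψ a₃ a₂ a₁ a₀ b x y p q 0 0 /
      (total₁ φ x y p ^ 2 * jacobian φ ψ x y), fun x y p q s hj => ?_⟩
  have hP : total₁ φ x y p ≠ 0 := (hΩ hj).2
  have hD := hT.jacobian_ne_zero _ _ (hΩ hj).1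
  have := h.transformedEquation_eq_zero hT hΩ hj
  rw [transformedEquation_eq_add, transformedEquation_linear] at this
  field_simp
  linear_combination this

theorem dx_eq_zero {g : ℝ → ℝ → ℝ} (hU : IsOpen U) (hg : ∀ x y, (x, y) ∈ U → g x y = 0) {x y : ℝ}
    (hz : (x, y) ∈ U) : dx g x y = 0 := by
  rw [dx_congr hU (h := fun _ _ => 0) hg hz]
  simp [dx]

theorem dy_eq_zero {g : ℝ → ℝ → ℝ} (hU : IsOpen U) (hg : ∀ x y, (x, y) ∈ U → g x y = 0) {x y : ℝ}
    (hz : (x, y) ∈ U) : dy g x y = 0 := by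
  rw [dy_congr hU (h := fun _ _ => 0) hg hz]
  simp [dy]

/-- The coefficients of the first class that a linear equation produces when `φ_y = 0`. -/
def generalFirstCoeffs (φ ψ : ℝ → ℝ → ℝ) (a₃ a₂ a₁ a₀ b : ℝ → ℝ) : FirstCoeffs :=
  let P := dx φ
  let P₁ := dx (dx φ)
  let P₂ := dx (dx (dx φ))
  let P₃ := dx (dx (dx (dx φ)))
  -- When `t = φ` does not depend on `y`, multiplying the linear expression by `P⁴` turns it into
  -- `D⁴ψ + κ₂ D³ψ + κ₁ D²ψ + κ₀ Dψ + (a₀ψ - b) P⁴`. The coefficients below come from substituting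
  -- the total derivatives of `ψ` and dividing by `ψ_y`, the coefficient of `y⁗`.
  let κ₂ : ℝ → ℝ → ℝ := fun x y => a₃ (φ x y) * P x y - 6 * P₁ x y / P x y
  let κ₁ : ℝ → ℝ → ℝ := fun x y => a₂ (φ x y) * P x y ^ 2 - 3 * a₃ (φ x y) * P₁ x y
    - 4 * P₂ x y / P x y + 15 * P₁ x y ^ 2 / P x y ^ 2
  let κ₀ : ℝ → ℝ → ℝ := fun x y => a₁ (φ x y) * P x y ^ 3 - a₂ (φ x y) * P x y * P₁ x y
    + a₃ (φ x y) * (3 * P₁ x y ^ 2 / P x y - P₂ x y) - P₃ x y / P x y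
    + 10 * P₁ x y * P₂ x y / P x y ^ 2 - 15 * P₁ x y ^ 3 / P x y ^ 3
  { A₁ := fun x y => 4 * dy (dy ψ) x y / dy ψ x y
    A₀ := fun x y => (4 * dy (dx ψ) x y + κ₂ x y * dy ψ x y) / dy ψ x y
    B₀ := fun x y => 3 * dy (dy ψ) x y / dy ψ x y
    C₂ := fun x y => 6 * dy (dy (dy ψ)) x y / dy ψ x y
    C₁ := fun x y => (12 * dy (dy (dx ψ)) x y + 3 * κ₂ x y * dy (dy ψ) x y) / dy ψ x y
    C₀ := fun x y => (6 * dy (dx (dx ψ)) x y + 3 * κ₂ x y * dy (dx ψ) x y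
      + κ₁ x y * dy ψ x y) / dy ψ x y
    D₄ := fun x y => dy (dy (dy (dy ψ))) x y / dy ψ x y
    D₃ := fun x y => (4 * dy (dy (dy (dx ψ))) x y + κ₂ x y * dy (dy (dy ψ)) x y) / dy ψ x y
    D₂ := fun x y => (6 * dy (dy (dx (dx ψ))) x y + 3 * κ₂ x y * dy (dy (dx ψ)) x y
      + κ₁ x y * dy (dy ψ) x y) / dy ψ x y
    D₁ := fun x y => (4 * dy (dx (dx (dx ψ))) x y + 3 * κ₂ x y * dy (dx (dx ψ)) x y
      + 2 * κ₁ x y * dy (dx ψ) x y + κ₀ x y * dy ψ x y) / dy ψ x y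
    D₀ := fun x y => (dx (dx (dx (dx ψ))) x y + κ₂ x y * dx (dx (dx ψ)) x y
      + κ₁ x y * dx (dx ψ) x y + κ₀ x y * dx ψ x y
      + (a₀ (φ x y) * ψ x y - b (φ x y)) * P x y ^ 4) / dy ψ x y }

/-- Since `φ_y` vanishes on an open set, so does every partial derivative of `φ` involving `y`. All
dependence on `y', y'', y'''` then comes from the total derivatives of `ψ`, which are polynomial. -/
theorem ObtainedFromLinear.hasFirstForm (hT : IsPointTransformation U φ ψ)
    (hΩ : Ω ⊆ regularJets U φ) (h : ObtainedFromLinear Ω f φ ψ a₃ a₂ a₁ a₀ b)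
    (hφ : ∀ x y, (x, y) ∈ U → dy φ x y = 0) :
    HasFirstForm Ω f (generalFirstCoeffs φ ψ a₃ a₂ a₁ a₀ b) := by
  intro x y p q s hj
  obtain ⟨hz, hP⟩ := hΩ hj
  change (x, y) ∈ U at hz
  have hU := hT.isOpen
  have hs : SmoothOn (0 + 4) U φ := hT.smoothOn_phi
  have e1 : ∀ x y, (x, y) ∈ U → dy (dx φ) x y = 0 := fun x y hz =>
    ((hs.mono (by norm_num) : SmoothOn (0 + 2) U φ).dx_dy hU hz).symm.trans (dx_eq_zero hU hφ hz)
  have e2 : ∀ x y, (x, y) ∈ U → dy (dx (dx φ)) x y = 0 := fun x y hz =>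
    (((hs.dx hU).mono (by norm_num) : SmoothOn (0 + 2) U (dx φ)).dx_dy hU hz).symm.trans
      (dx_eq_zero hU e1 hz)
  have e3 : ∀ x y, (x, y) ∈ U → dy (dx (dx (dx φ))) x y = 0 := fun x y hz =>
    ((((hs.dx hU).dx hU).mono (by norm_num) : SmoothOn (0 + 2) U (dx (dx φ))).dx_dy hU
      hz).symm.trans (dx_eq_zero hU e2 hz)
  have e4 : ∀ x y, (x, y) ∈ U → dy (dy φ) x y = 0 := fun x y hz => dy_eq_zero hU hφ hz
  have e5 : ∀ x y, (x, y) ∈ U → dy (dy (dx φ)) x y = 0 := fun x y hz => dy_eq_zero hU e1 hz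
  have e6 : ∀ x y, (x, y) ∈ U → dy (dy (dx (dx φ))) x y = 0 := fun x y hz => dy_eq_zero hU e2 hz
  have e7 : ∀ x y, (x, y) ∈ U → dy (dy (dy φ)) x y = 0 := fun x y hz => dy_eq_zero hU e4 hz
  have e8 : ∀ x y, (x, y) ∈ U → dy (dy (dy (dx φ))) x y = 0 := fun x y hz => dy_eq_zero hU e5 hz
  have e9 : ∀ x y, (x, y) ∈ U → dy (dy (dy (dy φ))) x y = 0 := fun x y hz => dy_eq_zero hU e7 hz
  have hJ := hT.jacobian_ne_zero _ _ hz
  simp only [jacobian, hφ x y hz, zero_mul, sub_zero] at hJ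
  have hφx := left_ne_zero_of_mul hJ
  have hψy := right_ne_zero_of_mul hJ
  have key := h.transformedEquation_eq_zero hT hΩ hj
  simp only [transformedEquation, total₁, total₂, total₃, total₄, hφ x y hz, e1 x y hz, e2 x y hz,
    e3 x y hz, e4 x y hz, e5 x y hz, e6 x y hz, e7 x y hz, e8 x y hz, e9 x y hz, mul_zero,
    add_zero] at key
  simp only [generalFirstCoeffs]
  generalize f (x, y, p, q, s) = w at key ⊢
  -- This is `P²Δ`, the coefficient of `y⁗`, for `φ_y = 0`.
  have h3 : dx φ x y ^ 3 * dy ψ x y ≠ 0 := mul_ne_zero (pow_ne_zero 3 hφx) hψy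
  refine (mul_right_inj' h3).1 ?_
  rw [mul_zero, ← key]
  field_simp
  ring

theorem ObtainedFromLaguerre.hasFirstForm {α β : ℝ → ℝ} (hT : IsPointTransformation U φ ψ)
    (hΩ : Ω ⊆ regularJets U φ) (h : ObtainedFromLaguerre Ω f φ ψ α β)
    (hφ : ∀ x y, (x, y) ∈ U → dy φ x y = 0) :
    HasFirstForm Ω f (firstCoeffs φ ψ α β) := by
  intro x y p q s hj
  have hz : (x, y) ∈ U := (hΩ hj).1
  have hJ := hT.jacobian_ne_zero _ _ hz
  simp only [jacobian, hφ x y hz, zero_mul, sub_zero] at hJ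
  have hφx := left_ne_zero_of_mul hJ
  have hψy := right_ne_zero_of_mul hJ
  have key := ObtainedFromLinear.hasFirstForm hT hΩ h hφ x y p q s hj
  set c := generalFirstCoeffs φ ψ (fun _ => 0) (fun _ => 0) α β (fun _ => 0) with hc
  have eA₁ : LaguerreFirst.A₁ ψ x y = c.A₁ x y := by
    simp only [hc, LaguerreFirst.A₁, generalFirstCoeffs]; field_simp
  have eA₀ : LaguerreFirst.A₀ φ ψ x y = c.A₀ x y := by
    simp only [hc, LaguerreFirst.A₀, generalFirstCoeffs]; field_simp; ring
  have eB₀ : LaguerreFirst.B₀ ψ x y = c.B₀ x y := by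
    simp only [hc, LaguerreFirst.B₀, generalFirstCoeffs]; field_simp
  have eC₂ : LaguerreFirst.C₂ ψ x y = c.C₂ x y := by
    simp only [hc, LaguerreFirst.C₂, generalFirstCoeffs]; field_simp
  have eC₁ : LaguerreFirst.C₁ φ ψ x y = c.C₁ x y := by
    simp only [hc, LaguerreFirst.C₁, generalFirstCoeffs]; field_simp; ring
  have eC₀ : LaguerreFirst.C₀ φ ψ x y = c.C₀ x y := by
    simp only [hc, LaguerreFirst.C₀, generalFirstCoeffs]; field_simp; ring
  have eD₄ : LaguerreFirst.D₄ ψ x y = c.D₄ x y := by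
    simp only [hc, LaguerreFirst.D₄, generalFirstCoeffs]; field_simp
  have eD₃ : LaguerreFirst.D₃ φ ψ x y = c.D₃ x y := by
    simp only [hc, LaguerreFirst.D₃, generalFirstCoeffs]; field_simp; ring
  have eD₂ : LaguerreFirst.D₂ φ ψ x y = c.D₂ x y := by
    simp only [hc, LaguerreFirst.D₂, generalFirstCoeffs]; field_simp; ring
  have eD₁ : LaguerreFirst.D₁ φ ψ α x y = c.D₁ x y := by
    simp only [hc, LaguerreFirst.D₁, generalFirstCoeffs]; field_simp; ring
  have eD₀ : LaguerreFirst.D₀ φ ψ α β x y = c.D₀ x y := by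
    simp only [hc, LaguerreFirst.D₀, generalFirstCoeffs]; field_simp; ring
  simp only [firstCoeffs, eA₁, eA₀, eB₀, eC₂, eC₁, eC₀, eD₄, eD₃, eD₂, eD₁, eD₀]
  exact key

end FirstForm

/-! ### Second-order jets in the frame `X = ∂_x - r ∂_y`, `∂_y`. -/

section FrameJets

variable {U : Set (ℝ × ℝ)} {g h r : ℝ → ℝ → ℝ} {x y : ℝ} {n : ℕ}

theorem dx_div (hU : IsOpen U) (hg : SmoothOn (n + 1) U g) (hh : SmoothOn (n + 1) U h)
    (hz : (x, y) ∈ U) (h0 : h x y ≠ 0) :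
    dx (g / h) x y = (dx g x y * h x y - g x y * dx h x y) / h x y ^ 2 :=
  ((hg.hasDerivAt_dx hU hz).div (hh.hasDerivAt_dx hU hz) h0).deriv

theorem dy_div (hU : IsOpen U) (hg : SmoothOn (n + 1) U g) (hh : SmoothOn (n + 1) U h)
    (hz : (x, y) ∈ U) (h0 : h x y ≠ 0) :
    dy (g / h) x y = (dy g x y * h x y - g x y * dy h x y) / h x y ^ 2 :=
  ((hg.hasDerivAt_dy hU hz).div (hh.hasDerivAt_dy hU hz) h0).deriv

/-- The value of a function `g` at a point together with the coefficients of its first two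
derivatives along a graph `y = y(x)`, written as polynomials in `m = y' + r` and `q = y''`:
`g' = y m + X` and `g'' = y q + c₂ m² + c₁ m + c₀`. -/
structure FrameJet where
  (v y X c₂ c₁ c₀ : ℝ)

namespace FrameJet

instance : Add FrameJet :=
  ⟨fun j k => ⟨j.v + k.v, j.y + k.y, j.X + k.X, j.c₂ + k.c₂, j.c₁ + k.c₁, j.c₀ + k.c₀⟩⟩

instance : Sub FrameJet :=
  ⟨fun j k => ⟨j.v - k.v, j.y - k.y, j.X - k.X, j.c₂ - k.c₂, j.c₁ - k.c₁, j.c₀ - k.c₀⟩⟩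

instance : SMul ℝ FrameJet :=
  ⟨fun c j => ⟨c * j.v, c * j.y, c * j.X, c * j.c₂, c * j.c₁, c * j.c₀⟩⟩

/-- Leibniz rule for the first two total derivatives: the cross term `2 g' h' = 2 (y m + X)(y m +
X)` is distributed over the three powers of `m`. A single slot `y` suffices because `g_y` is both
the coefficient of `m` in `g'` and that of `q` in `g''`. -/
instance : Mul FrameJet :=
  ⟨fun j k => ⟨j.v * k.v, j.y * k.v + j.v * k.y, j.X * k.v + j.v * k.X,
    j.c₂ * k.v + 2 * j.y * k.y + j.v * k.c₂,
    j.c₁ * k.v + 2 * (j.y * k.X + j.X * k.y) + j.v * k.c₁,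
    j.c₀ * k.v + 2 * j.X * k.X + j.v * k.c₀⟩⟩

theorem add_def (j k : FrameJet) : j + k =
    ⟨j.v + k.v, j.y + k.y, j.X + k.X, j.c₂ + k.c₂, j.c₁ + k.c₁, j.c₀ + k.c₀⟩ := rfl

theorem sub_def (j k : FrameJet) : j - k =
    ⟨j.v - k.v, j.y - k.y, j.X - k.X, j.c₂ - k.c₂, j.c₁ - k.c₁, j.c₀ - k.c₀⟩ := rfl

theorem smul_def (c : ℝ) (j : FrameJet) : c • j =
    ⟨c * j.v, c * j.y, c * j.X, c * j.c₂, c * j.c₁, c * j.c₀⟩ := rfl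

theorem mul_def (j k : FrameJet) : j * k =
    ⟨j.v * k.v, j.y * k.v + j.v * k.y, j.X * k.v + j.v * k.X,
    j.c₂ * k.v + 2 * j.y * k.y + j.v * k.c₂,
    j.c₁ * k.v + 2 * (j.y * k.X + j.X * k.y) + j.v * k.c₁,
    j.c₀ * k.v + 2 * j.X * k.X + j.v * k.c₀⟩ := rfl

/-- The first derivative along a graph with `y' + r = m`. -/
def deriv₁ (j : FrameJet) (m : ℝ) : ℝ := j.y * m + j.X

/-- The second derivative along a graph with `y' + r = m`, `y'' = q`. -/
def deriv₂ (j : FrameJet) (m q : ℝ) : ℝ := j.y * q + j.c₂ * m ^ 2 + j.c₁ * m + j.c₀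

end FrameJet

/-- The frame jet of a function at a point. -/
def frameJet (r g : ℝ → ℝ → ℝ) (x y : ℝ) : FrameJet where
  v := g x y
  y := dy g x y
  X := dx g x y - r x y * dy g x y
  c₂ := dy (dy g) x y
  c₁ := 2 * (dy (dx g) x y - r x y * dy (dy g) x y)
  c₀ := dx (dx g) x y - 2 * r x y * dy (dx g) x y + r x y ^ 2 * dy (dy g) x y

theorem total₁_eq_deriv₁ (r g : ℝ → ℝ → ℝ) (x y p : ℝ) :
    total₁ g x y p = (frameJet r g x y).deriv₁ (p + r x y) := by
  simp only [total₁, frameJet, FrameJet.deriv₁]; ring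

theorem total₂_eq_deriv₂ (r g : ℝ → ℝ → ℝ) (x y p q : ℝ) :
    total₂ g x y p q = (frameJet r g x y).deriv₂ (p + r x y) q := by
  simp only [total₂, frameJet, FrameJet.deriv₂]; ring

/-- With the next three lemmas: taking frame jets respects sums, differences, scalars and products
of `C²` functions. Jets of composite expressions can then be computed by algebra, without expanding
their second partial derivatives. -/
theorem frameJet_add (hU : IsOpen U) (hg : SmoothOn 2 U g) (hh : SmoothOn 2 U h)
    (hz : (x, y) ∈ U) : frameJet r (g + h) x y = frameJet r g x y + frameJet r h x y := by
  have hg1 : SmoothOn (0 + 1) U g := hg.mono (by norm_num)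
  have hh1 : SmoothOn (0 + 1) U h := hh.mono (by norm_num)
  have ex : ∀ x y, (x, y) ∈ U → dx (g + h) x y = (dx g + dx h) x y :=
    fun x y hz => dx_add hU hg1 hh1 hz
  have ey : ∀ x y, (x, y) ∈ U → dy (g + h) x y = (dy g + dy h) x y :=
    fun x y hz => dy_add hU hg1 hh1 hz
  have hgx := SmoothOn.dx (n := 1) hg hU
  have hhx := SmoothOn.dx (n := 1) hh hU
  have hgy := SmoothOn.dy (n := 1) hg hU
  have hhy := SmoothOn.dy (n := 1) hh hU
  have exx := (dx_congr hU ex hz).trans (dx_add (n := 0) hU hgx hhx hz)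
  have exy := (dy_congr hU ex hz).trans (dy_add (n := 0) hU hgx hhx hz)
  have eyy := (dy_congr hU ey hz).trans (dy_add (n := 0) hU hgy hhy hz)
  simp only [frameJet, FrameJet.add_def, ex x y hz, ey x y hz, exx, exy, eyy, Pi.add_apply,
    FrameJet.mk.injEq, true_and]
  refine ⟨?_, ?_, ?_⟩ <;> ring

theorem frameJet_sub (hU : IsOpen U) (hg : SmoothOn 2 U g) (hh : SmoothOn 2 U h)
    (hz : (x, y) ∈ U) : frameJet r (g - h) x y = frameJet r g x y - frameJet r h x y := by
  have hg1 : SmoothOn (0 + 1) U g := hg.mono (by norm_num)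
  have hh1 : SmoothOn (0 + 1) U h := hh.mono (by norm_num)
  have ex : ∀ x y, (x, y) ∈ U → dx (g - h) x y = (dx g - dx h) x y :=
    fun x y hz => dx_sub hU hg1 hh1 hz
  have ey : ∀ x y, (x, y) ∈ U → dy (g - h) x y = (dy g - dy h) x y :=
    fun x y hz => dy_sub hU hg1 hh1 hz
  have hgx := SmoothOn.dx (n := 1) hg hU
  have hhx := SmoothOn.dx (n := 1) hh hU
  have hgy := SmoothOn.dy (n := 1) hg hU
  have hhy := SmoothOn.dy (n := 1) hh hU
  have exx := (dx_congr hU ex hz).trans (dx_sub (n := 0) hU hgx hhx hz)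
  have exy := (dy_congr hU ex hz).trans (dy_sub (n := 0) hU hgx hhx hz)
  have eyy := (dy_congr hU ey hz).trans (dy_sub (n := 0) hU hgy hhy hz)
  simp only [frameJet, FrameJet.sub_def, ex x y hz, ey x y hz, exx, exy, eyy, Pi.sub_apply,
    FrameJet.mk.injEq, true_and]
  refine ⟨?_, ?_, ?_⟩ <;> ring

theorem frameJet_const_smul (c : ℝ) : frameJet r (c • g) x y = c • frameJet r g x y := by
  simp only [frameJet, FrameJet.smul_def, dx_const_smul, dy_const_smul, Pi.smul_apply, smul_eq_mul,
    FrameJet.mk.injEq, true_and]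
  refine ⟨?_, ?_, ?_⟩ <;> ring

theorem frameJet_mul (hU : IsOpen U) (hg : SmoothOn 2 U g) (hh : SmoothOn 2 U h)
    (hz : (x, y) ∈ U) : frameJet r (g * h) x y = frameJet r g x y * frameJet r h x y := by
  have hg1 : SmoothOn (0 + 1) U g := hg.mono (by norm_num)
  have hh1 : SmoothOn (0 + 1) U h := hh.mono (by norm_num)
  have ex : ∀ x y, (x, y) ∈ U → dx (g * h) x y = (dx g * h + g * dx h) x y :=
    fun x y hz => dx_mul hU hg1 hh1 hz
  have ey : ∀ x y, (x, y) ∈ U → dy (g * h) x y = (dy g * h + g * dy h) x y :=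
    fun x y hz => dy_mul hU hg1 hh1 hz
  have hgx : SmoothOn (0 + 1) U (dx g) := SmoothOn.dx (n := 1) hg hU
  have hhx : SmoothOn (0 + 1) U (dx h) := SmoothOn.dx (n := 1) hh hU
  have hgy : SmoothOn (0 + 1) U (dy g) := SmoothOn.dy (n := 1) hg hU
  have hhy : SmoothOn (0 + 1) U (dy h) := SmoothOn.dy (n := 1) hh hU
  have exx := dx_congr hU ex hz
  have exy := dy_congr hU ex hz
  have eyy := dy_congr hU ey hz
  rw [dx_add hU (hgx.mul hh1) (hg1.mul hhx) hz, dx_mul hU hgx hh1 hz, dx_mul hU hg1 hhx hz] at exx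
  rw [dy_add hU (hgx.mul hh1) (hg1.mul hhx) hz, dy_mul hU hgx hh1 hz, dy_mul hU hg1 hhx hz] at exy
  rw [dy_add hU (hgy.mul hh1) (hg1.mul hhy) hz, dy_mul hU hgy hh1 hz, dy_mul hU hg1 hhy hz] at eyy
  simp only [frameJet, FrameJet.mul_def, ex x y hz, ey x y hz, exx, exy, eyy, Pi.add_apply,
    Pi.mul_apply, FrameJet.mk.injEq, true_and]
  refine ⟨?_, ?_, ?_, ?_⟩ <;> ring

theorem frameJet_dy (hU : IsOpen U) (hg : SmoothOn 3 U g) (hz : (x, y) ∈ U) :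
    frameJet r (dy g) x y = ⟨dy g x y, dy (dy g) x y, dy (dx g) x y - r x y * dy (dy g) x y,
      dy (dy (dy g)) x y, 2 * (dy (dy (dx g)) x y - r x y * dy (dy (dy g)) x y),
      dy (dx (dx g)) x y - 2 * r x y * dy (dy (dx g)) x y + r x y ^ 2 * dy (dy (dy g)) x y⟩ := by
  have e1 : ∀ x y, (x, y) ∈ U → dx (dy g) x y = dy (dx g) x y := fun x y hz =>
    (hg.mono (by norm_num) : SmoothOn (0 + 2) U g).dx_dy hU hz
  have e2 : dx (dx (dy g)) x y = dy (dx (dx g)) x y :=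
    (dx_congr hU e1 hz).trans ((SmoothOn.dx (n := 2) hg hU).dx_dy (n := 0) hU hz)
  simp only [frameJet, e1 x y hz, e2, dy_congr hU e1 hz]

/-- The frame jet of `g` when `g_x - r g_y = h` is known. -/
theorem frameJet_of_dx_eq (hU : IsOpen U) (hg : SmoothOn 2 U g) (hr : SmoothOn 1 U r)
    (hh : SmoothOn 1 U h) (hgh : ∀ x y, (x, y) ∈ U → dx g x y = r x y * dy g x y + h x y)
    (hz : (x, y) ∈ U) :
    frameJet r g x y = ⟨g x y, dy g x y, h x y, dy (dy g) x y,
      2 * (dy h x y + dy r x y * dy g x y),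
      (dx r x y - r x y * dy r x y) * dy g x y + (dx h x y - r x y * dy h x y)⟩ := by
  have hgy : SmoothOn (0 + 1) U (dy g) := SmoothOn.dy (n := 1) hg hU
  have e : ∀ x y, (x, y) ∈ U → dx g x y = (r * dy g + h) x y := hgh
  -- Differentiating `g_x = r g_y + h` gives `g_xy` and `g_xx`. In terms of `X = ∂_x - r ∂_y` the
  -- last slot is `X(Xg) + (Xr) g_y` with `Xg = h`.
  have exx := dx_congr hU e hz
  have exy := dy_congr hU e hz
  have hr' : SmoothOn (0 + 1) U r := hr
  have hh' : SmoothOn (0 + 1) U h := hh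
  rw [dx_add hU (hr'.mul hgy) hh' hz, dx_mul hU hr' hgy hz, SmoothOn.dx_dy (n := 0) hg hU hz,
    exy, dy_add hU (hr'.mul hgy) hh' hz, dy_mul hU hr' hgy hz] at exx
  rw [dy_add hU (hr'.mul hgy) hh' hz, dy_mul hU hr' hgy hz] at exy
  simp only [frameJet, exx, exy, hgh x y hz, FrameJet.mk.injEq, true_and]
  refine ⟨?_, ?_, ?_⟩ <;> ring

end FrameJets

/-! ### The numerator of the linear expression, sorted in powers of `m = y' + r`. -/

section FrameDataForms

/-- The jets at a point that determine the transform of a linear equation when `φ_y ≠ 0`: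
those of `Δ`, `r`, `r_y`, `L = φ_yy / φ_y` and of the coefficients `w₀, …, w₃` of the numerator
`Δ y'' + w₃ (y' + r)³ + w₂ (y' + r)² + w₁ (y' + r) + w₀` of `u''`, the values `a = φ_y`,
`c = ψ_y`, `u = ψ`, and the values of the coefficients of the linear equation. -/
structure FrameData where
  (Δ r ry L w₀ w₁ w₂ w₃ : FrameJet)
  (a c u a₃ a₂ a₁ a₀ b : ℝ)

namespace FrameData

variable (d : FrameData) (m q s w : ℝ)

/-- The derivative of `m = y' + r`. -/
def m₁ : ℝ := q + d.r.deriv₁ m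

/-- The second derivative of `m = y' + r`. -/
def m₂ : ℝ := s + d.r.deriv₂ m q

/-- The derivative of `φ_y m`, divided by `φ_y`. -/
def π₁ : ℝ := d.L.v * m ^ 2 + d.r.y * m + d.m₁ m q

/-- The derivative of `π₁`. -/
def dπ₁ : ℝ :=
  d.L.deriv₁ m * m ^ 2 + 2 * d.L.v * m * d.m₁ m q + d.ry.deriv₁ m * m + d.r.y * d.m₁ m q
    + d.m₂ m q s

/-- The numerator of `u''`. -/
def W : ℝ := d.Δ.v * q + d.w₃.v * m ^ 3 + d.w₂.v * m ^ 2 + d.w₁.v * m + d.w₀.v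

/-- The derivative of `W`. -/
def dW : ℝ :=
  d.Δ.deriv₁ m * q + d.Δ.v * s + d.w₃.deriv₁ m * m ^ 3 + d.w₂.deriv₁ m * m ^ 2 + d.w₁.deriv₁ m * m
    + d.w₀.deriv₁ m + (3 * d.w₃.v * m ^ 2 + 2 * d.w₂.v * m + d.w₁.v) * d.m₁ m q

/-- The second derivative of `W`. -/
def ddW : ℝ :=
  d.Δ.deriv₂ m q * q + 2 * d.Δ.deriv₁ m * s + d.Δ.v * w + d.w₃.deriv₂ m q * m ^ 3
    + d.w₂.deriv₂ m q * m ^ 2 + d.w₁.deriv₂ m q * m + d.w₀.deriv₂ m q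
    + 2 * (3 * d.w₃.deriv₁ m * m ^ 2 + 2 * d.w₂.deriv₁ m * m + d.w₁.deriv₁ m) * d.m₁ m q
    + (6 * d.w₃.v * m + 2 * d.w₂.v) * d.m₁ m q ^ 2
    + (3 * d.w₃.v * m ^ 2 + 2 * d.w₂.v * m + d.w₁.v) * d.m₂ m q s

/-- The numerator of `u'''`. -/
def N₃ : ℝ := m * d.dW m q s - 3 * d.π₁ m q * d.W m q

/-- The numerator of `u⁗`. -/
def N₄ : ℝ :=
  m ^ 2 * d.ddW m q s w - 7 * m * d.π₁ m q * d.dW m q s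
    + (12 * d.π₁ m q ^ 2 + 3 * d.π₁ m q * d.m₁ m q - 3 * m * d.dπ₁ m q s) * d.W m q

/-- The numerator of `u⁗ + a₃ u''' + a₂ u'' + a₁ u' + a₀ u - b`. -/
def equation : ℝ :=
  d.N₄ m q s w + d.a₃ * d.a * m ^ 2 * d.N₃ m q s + d.a₂ * d.a ^ 2 * m ^ 4 * d.W m q
    + d.a₁ * (d.a ^ 4 * d.c * m ^ 7 - d.a ^ 3 * d.Δ.v * m ^ 6)
    + (d.a₀ * d.u - d.b) * d.a ^ 5 * m ^ 7

end FrameData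

/-- The coefficient `F₀` in powers of `y' + r`. -/
def FrameData.F₀ (d : FrameData) : ℝ :=
  (-3 * d.w₀.v - 7 * d.Δ.v * d.r.X) / d.Δ.v

/-- The coefficient `F₁` in powers of `y' + r`. -/
def FrameData.F₁ (d : FrameData) : ℝ :=
  (-14 * d.r.y * d.Δ.v - 2 * d.w₁.v + 2 * d.Δ.X) / d.Δ.v

/-- The coefficient `F₂` in powers of `y' + r`. -/
def FrameData.F₂ (d : FrameData) : ℝ :=
  (-7 * d.L.v * d.Δ.v - d.w₂.v + 2 * d.Δ.y + d.a₃ * d.a * (d.Δ.v)) / d.Δ.v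

/-- The coefficient `H₀` in powers of `y' + r`. -/
def FrameData.H₀ (d : FrameData) : ℝ :=
  (15 * d.w₀.v + 30 * d.Δ.v * d.r.X) / d.Δ.v

/-- The coefficient `H₁` in powers of `y' + r`. -/
def FrameData.H₁ (d : FrameData) : ℝ :=
  (51 * d.r.y * d.Δ.v + 8 * d.w₁.v - 7 * d.Δ.X) / d.Δ.v

/-- The coefficient `H₂` in powers of `y' + r`. -/
def FrameData.H₂ (d : FrameData) : ℝ :=
  (21 * d.L.v * d.Δ.v + 3 * d.w₂.v - 6 * d.Δ.y + d.a₃ * d.a * (-3 * d.Δ.v)) / d.Δ.v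

/-- The coefficient `J₀` in powers of `y' + r`. -/
def FrameData.J₀ (d : FrameData) : ℝ :=
  (30 * d.w₀.v * d.r.X + 15 * d.Δ.v * d.r.X ^ 2) / d.Δ.v

/-- The coefficient `J₁` in powers of `y' + r`. -/
def FrameData.J₁ (d : FrameData) : ℝ :=
  (-3 * d.r.c₀ * d.Δ.v + 51 * d.r.y * d.w₀.v + 54 * d.r.y * d.Δ.v * d.r.X - 7 * d.w₀.X + 16 *
    d.w₁.v * d.r.X - 7 * d.Δ.X * d.r.X) / d.Δ.v

/-- The coefficient `J₂` in powers of `y' + r`. -/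
def FrameData.J₂ (d : FrameData) : ℝ :=
  (21 * d.L.v * d.w₀.v + 21 * d.L.v * d.Δ.v * d.r.X - 3 * d.r.c₁ * d.Δ.v + 31 * d.r.y * d.w₁.v -
    14 * d.r.y * d.Δ.X + 51 * d.r.y ^ 2 * d.Δ.v - 3 * d.ry.X * d.Δ.v - 6 * d.w₀.y - 5 * d.w₁.X + 6
    * d.w₂.v * d.r.X + d.Δ.c₀ - 7 * d.Δ.y * d.r.X + d.a₃ * d.a * (-3 * d.w₀.v - 3 * d.Δ.v *
    d.r.X)) / d.Δ.v

/-- The coefficient `J₃` in powers of `y' + r`. -/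
def FrameData.J₃ (d : FrameData) : ℝ :=
  (45 * d.L.v * d.r.y * d.Δ.v + 14 * d.L.v * d.w₁.v - 7 * d.L.v * d.Δ.X - 3 * d.L.X * d.Δ.v - 3 *
    d.r.c₂ * d.Δ.v + 15 * d.r.y * d.w₂.v - 14 * d.r.y * d.Δ.y - 3 * d.ry.y * d.Δ.v - 4 * d.w₁.y -
    3 * d.w₂.X + d.Δ.c₁ + d.a₃ * d.a * (-6 * d.r.y * d.Δ.v - 2 * d.w₁.v + d.Δ.X)) / d.Δ.v

/-- The coefficient `J₄` in powers of `y' + r`. -/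
def FrameData.J₄ (d : FrameData) : ℝ :=
  (7 * d.L.v * d.w₂.v - 7 * d.L.v * d.Δ.y + 12 * d.L.v ^ 2 * d.Δ.v - 3 * d.L.y * d.Δ.v + 3 * d.r.y
    * d.w₃.v - 2 * d.w₂.y - d.w₃.X + d.Δ.c₂ + d.a₃ * d.a * (-3 * d.L.v * d.Δ.v - d.w₂.v + d.Δ.y) +
    d.a₂ * d.a ^ 2 * d.Δ.v) / d.Δ.v

/-- The coefficient `K₀` in powers of `y' + r`. -/
def FrameData.K₀ (d : FrameData) : ℝ :=
  (15 * d.w₀.v * d.r.X ^ 2) / d.Δ.v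

/-- The coefficient `K₁` in powers of `y' + r`. -/
def FrameData.K₁ (d : FrameData) : ℝ :=
  (-3 * d.r.c₀ * d.w₀.v + 54 * d.r.y * d.w₀.v * d.r.X - 7 * d.w₀.X * d.r.X + 8 * d.w₁.v * d.r.X ^
    2) / d.Δ.v

/-- The coefficient `K₂` in powers of `y' + r`. -/
def FrameData.K₂ (d : FrameData) : ℝ :=
  (21 * d.L.v * d.w₀.v * d.r.X - 2 * d.r.c₀ * d.w₁.v - 3 * d.r.c₁ * d.w₀.v - 14 * d.r.y * d.w₀.X +
    33 * d.r.y * d.w₁.v * d.r.X + 51 * d.r.y ^ 2 * d.w₀.v - 3 * d.ry.X * d.w₀.v + d.w₀.c₀ - 7 *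
    d.w₀.y * d.r.X - 5 * d.w₁.X * d.r.X + 3 * d.w₂.v * d.r.X ^ 2 + d.a₃ * d.a * (-3 * d.w₀.v *
    d.r.X)) / d.Δ.v

/-- The coefficient `K₃` in powers of `y' + r`. -/
def FrameData.K₃ (d : FrameData) : ℝ :=
  (45 * d.L.v * d.r.y * d.w₀.v - 7 * d.L.v * d.w₀.X + 14 * d.L.v * d.w₁.v * d.r.X - 3 * d.L.X *
    d.w₀.v - d.r.c₀ * d.w₂.v - 2 * d.r.c₁ * d.w₁.v - 3 * d.r.c₂ * d.w₀.v - 14 * d.r.y * d.w₀.y -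
    12 * d.r.y * d.w₁.X + 16 * d.r.y * d.w₂.v * d.r.X + 37 * d.r.y ^ 2 * d.w₁.v - 3 * d.ry.X *
    d.w₁.v - 3 * d.ry.y * d.w₀.v + d.w₀.c₁ + d.w₁.c₀ - 5 * d.w₁.y * d.r.X - 3 * d.w₂.X * d.r.X +
    d.a₃ * d.a * (-6 * d.r.y * d.w₀.v + d.w₀.X - 2 * d.w₁.v * d.r.X)) / d.Δ.v

/-- The coefficient `K₄` in powers of `y' + r`. -/
def FrameData.K₄ (d : FrameData) : ℝ :=
  (38 * d.L.v * d.r.y * d.w₁.v - 7 * d.L.v * d.w₀.y - 7 * d.L.v * d.w₁.X + 7 * d.L.v * d.w₂.v *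
    d.r.X + 12 * d.L.v ^ 2 * d.w₀.v - 3 * d.L.X * d.w₁.v - 3 * d.L.y * d.w₀.v - d.r.c₁ * d.w₂.v -
    2 * d.r.c₂ * d.w₁.v - 12 * d.r.y * d.w₁.y - 10 * d.r.y * d.w₂.X + 3 * d.r.y * d.w₃.v * d.r.X +
    25 * d.r.y ^ 2 * d.w₂.v - 3 * d.ry.X * d.w₂.v - 3 * d.ry.y * d.w₁.v + d.w₀.c₂ + d.w₁.c₁ +
    d.w₂.c₀ - 3 * d.w₂.y * d.r.X - d.w₃.X * d.r.X + d.a₃ * d.a * (-3 * d.L.v * d.w₀.v - 5 * d.r.y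
    * d.w₁.v + d.w₀.y + d.w₁.X - d.w₂.v * d.r.X) + d.a₂ * d.a ^ 2 * d.w₀.v) / d.Δ.v

/-- The coefficient `K₅` in powers of `y' + r`. -/
def FrameData.K₅ (d : FrameData) : ℝ :=
  (31 * d.L.v * d.r.y * d.w₂.v - 7 * d.L.v * d.w₁.y - 7 * d.L.v * d.w₂.X + 12 * d.L.v ^ 2 * d.w₁.v
    - 3 * d.L.X * d.w₂.v - 3 * d.L.y * d.w₁.v - d.r.c₂ * d.w₂.v - 10 * d.r.y * d.w₂.y - 8 * d.r.y
    * d.w₃.X + 15 * d.r.y ^ 2 * d.w₃.v - 3 * d.ry.X * d.w₃.v - 3 * d.ry.y * d.w₂.v + d.w₁.c₂ +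
    d.w₂.c₁ + d.w₃.c₀ - d.w₃.y * d.r.X + d.a₃ * d.a * (-3 * d.L.v * d.w₁.v - 4 * d.r.y * d.w₂.v +
    d.w₁.y + d.w₂.X) + d.a₂ * d.a ^ 2 * d.w₁.v) / d.Δ.v

/-- The coefficient `K₆` in powers of `y' + r`. -/
def FrameData.K₆ (d : FrameData) : ℝ :=
  (24 * d.L.v * d.r.y * d.w₃.v - 7 * d.L.v * d.w₂.y - 7 * d.L.v * d.w₃.X + 12 * d.L.v ^ 2 * d.w₂.v
    - 3 * d.L.X * d.w₃.v - 3 * d.L.y * d.w₂.v - 8 * d.r.y * d.w₃.y - 3 * d.ry.y * d.w₃.v + d.w₂.c₂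
    + d.w₃.c₁ + d.a₃ * d.a * (-3 * d.L.v * d.w₂.v - 3 * d.r.y * d.w₃.v + d.w₂.y + d.w₃.X) + d.a₂ *
    d.a ^ 2 * d.w₂.v - d.a₁ * d.a ^ 3 * d.Δ.v) / d.Δ.v

/-- The coefficient `K₇` in powers of `y' + r`. -/
def FrameData.K₇ (d : FrameData) : ℝ :=
  (-7 * d.L.v * d.w₃.y + 12 * d.L.v ^ 2 * d.w₃.v - 3 * d.L.y * d.w₃.v + d.w₃.c₂ + d.a₃ * d.a * (-3
    * d.L.v * d.w₃.v + d.w₃.y) + d.a₂ * d.a ^ 2 * d.w₃.v + d.a₁ * d.a ^ 4 * d.c + (d.a₀ * d.u -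
    d.b) * d.a ^ 5) / d.Δ.v

/-- The coefficients of the second class in powers of `y' + r`. -/
def centeredCoeffs (d : ℝ → ℝ → FrameData) : SecondCoeffs where
  r := fun x y => (d x y).r.v
  F₂ := fun x y => (d x y).F₂
  F₁ := fun x y => (d x y).F₁
  F₀ := fun x y => (d x y).F₀
  H₂ := fun x y => (d x y).H₂
  H₁ := fun x y => (d x y).H₁
  H₀ := fun x y => (d x y).H₀
  J₄ := fun x y => (d x y).J₄
  J₃ := fun x y => (d x y).J₃
  J₂ := fun x y => (d x y).J₂
  J₁ := fun x y => (d x y).J₁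
  J₀ := fun x y => (d x y).J₀
  K₇ := fun x y => (d x y).K₇
  K₆ := fun x y => (d x y).K₆
  K₅ := fun x y => (d x y).K₅
  K₄ := fun x y => (d x y).K₄
  K₃ := fun x y => (d x y).K₃
  K₂ := fun x y => (d x y).K₂
  K₁ := fun x y => (d x y).K₁
  K₀ := fun x y => (d x y).K₀

/-- The coefficients of the second class in powers of `y'`, from those in powers of `y' + r`. -/
def SecondCoeffs.expand (c : SecondCoeffs) : SecondCoeffs where
  r := c.r
  F₂ := fun x y => c.F₂ x y
  F₁ := fun x y => c.F₁ x y + 2 * c.r x y * c.F₂ x y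
  F₀ := fun x y => c.F₀ x y + c.r x y * c.F₁ x y + c.r x y ^ 2 * c.F₂ x y
  H₂ := fun x y => c.H₂ x y
  H₁ := fun x y => c.H₁ x y + 2 * c.r x y * c.H₂ x y
  H₀ := fun x y => c.H₀ x y + c.r x y * c.H₁ x y + c.r x y ^ 2 * c.H₂ x y
  J₄ := fun x y => c.J₄ x y
  J₃ := fun x y => c.J₃ x y + 4 * c.r x y * c.J₄ x y
  J₂ := fun x y => c.J₂ x y + 3 * c.r x y * c.J₃ x y + 6 * c.r x y ^ 2 * c.J₄ x y
  J₁ := fun x y => c.J₁ x y + 2 * c.r x y * c.J₂ x y + 3 * c.r x y ^ 2 * c.J₃ x y + 4 * c.r x y ^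
    3 * c.J₄ x y
  J₀ := fun x y => c.J₀ x y + c.r x y * c.J₁ x y + c.r x y ^ 2 * c.J₂ x y + c.r x y ^ 3 * c.J₃ x y
    + c.r x y ^ 4 * c.J₄ x y
  K₇ := fun x y => c.K₇ x y
  K₆ := fun x y => c.K₆ x y + 7 * c.r x y * c.K₇ x y
  K₅ := fun x y => c.K₅ x y + 6 * c.r x y * c.K₆ x y + 21 * c.r x y ^ 2 * c.K₇ x y
  K₄ := fun x y => c.K₄ x y + 5 * c.r x y * c.K₅ x y + 15 * c.r x y ^ 2 * c.K₆ x y + 35 * c.r x y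
    ^ 3 * c.K₇ x y
  K₃ := fun x y => c.K₃ x y + 4 * c.r x y * c.K₄ x y + 10 * c.r x y ^ 2 * c.K₅ x y + 20 * c.r x y
    ^ 3 * c.K₆ x y + 35 * c.r x y ^ 4 * c.K₇ x y
  K₂ := fun x y => c.K₂ x y + 3 * c.r x y * c.K₃ x y + 6 * c.r x y ^ 2 * c.K₄ x y + 10 * c.r x y ^
    3 * c.K₅ x y + 15 * c.r x y ^ 4 * c.K₆ x y + 21 * c.r x y ^ 5 * c.K₇ x y
  K₁ := fun x y => c.K₁ x y + 2 * c.r x y * c.K₂ x y + 3 * c.r x y ^ 2 * c.K₃ x y + 4 * c.r x y ^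
    3 * c.K₄ x y + 5 * c.r x y ^ 4 * c.K₅ x y + 6 * c.r x y ^ 5 * c.K₆ x y + 7 * c.r x y ^ 6 *
    c.K₇ x y
  K₀ := fun x y => c.K₀ x y + c.r x y * c.K₁ x y + c.r x y ^ 2 * c.K₂ x y + c.r x y ^ 3 * c.K₃ x y
    + c.r x y ^ 4 * c.K₄ x y + c.r x y ^ 5 * c.K₅ x y + c.r x y ^ 6 * c.K₆ x y + c.r x y ^ 7 *
    c.K₇ x y

/-- Everything is polynomial in `m, q, s, w`, so this is a comparison of coefficients. The universal
constants come from the leading terms `π₁ = q + ⋯`, `W = Δ q + ⋯`: `-10 = -7 - 3` from `-7 m π₁ dW`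
and `-3 m dπ₁ W`, and `15 = 12 + 3` from `(12 π₁² + 3 π₁ m₁) W`. -/
theorem FrameData.equation_eq (d : FrameData) (m q s w : ℝ) (hΔ : d.Δ.v ≠ 0) :
    d.equation m q s w = d.Δ.v * (m ^ 2 * w
      + m * (-10 * q + d.F₂ * m ^ 2 + d.F₁ * m + d.F₀) * s
      + (15 * q ^ 3 + (d.H₂ * m ^ 2 + d.H₁ * m + d.H₀) * q ^ 2
        + (d.J₄ * m ^ 4 + d.J₃ * m ^ 3 + d.J₂ * m ^ 2 + d.J₁ * m + d.J₀) * q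
        + d.K₇ * m ^ 7 + d.K₆ * m ^ 6 + d.K₅ * m ^ 5 + d.K₄ * m ^ 4 + d.K₃ * m ^ 3
        + d.K₂ * m ^ 2 + d.K₁ * m + d.K₀)) := by
  simp only [equation, N₄, N₃, ddW, dW, W, dπ₁, π₁, m₂, m₁, FrameJet.deriv₁, FrameJet.deriv₂,
    F₂, F₁, F₀, H₂, H₁, H₀, J₄, J₃, J₂, J₁, J₀, K₇, K₆, K₅, K₄, K₃, K₂, K₁, K₀]
  field_simp
  ring

/-- The equation in powers of `y' + r` is the equation of the second class whose coefficients are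
obtained by expansion in powers of `y'`. -/
theorem FrameData.secondForm_of_equation_eq_zero (d : ℝ → ℝ → FrameData) {x y p q s w : ℝ}
    (hΔ : (d x y).Δ.v ≠ 0) (hm : p + (d x y).r.v ≠ 0)
    (h : (d x y).equation (p + (d x y).r.v) q s w = 0) :
    let c := (centeredCoeffs d).expand
    w + 1 / (p + c.r x y) * (-10 * q + c.F₂ x y * p ^ 2 + c.F₁ x y * p + c.F₀ x y) * s
      + 1 / (p + c.r x y) ^ 2 *
        (15 * q ^ 3 + (c.H₂ x y * p ^ 2 + c.H₁ x y * p + c.H₀ x y) * q ^ 2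
          + (c.J₄ x y * p ^ 4 + c.J₃ x y * p ^ 3 + c.J₂ x y * p ^ 2 + c.J₁ x y * p + c.J₀ x y) * q
          + c.K₇ x y * p ^ 7 + c.K₆ x y * p ^ 6 + c.K₅ x y * p ^ 5 + c.K₄ x y * p ^ 4
          + c.K₃ x y * p ^ 3 + c.K₂ x y * p ^ 2 + c.K₁ x y * p + c.K₀ x y) = 0 := by
  rw [FrameData.equation_eq _ _ _ _ _ hΔ, mul_eq_zero, or_iff_right hΔ] at h
  simp only [SecondCoeffs.expand, centeredCoeffs]
  have h2 := pow_ne_zero 2 hm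
  refine (mul_right_inj' h2).1 ?_
  rw [mul_zero, ← h]
  field_simp
  ring

end FrameDataForms

/-! ### Differential identities for `L`, `S` and the mixed partials of `φ` and `ψ`. -/

section Frame

/-- `L = φ_yy / φ_y`. -/
def logDerivY (φ : ℝ → ℝ → ℝ) : ℝ → ℝ → ℝ := dy (dy φ) / dy φ

/-- `S = φ_y ψ_yy - ψ_y φ_yy`. -/
def wronskianY (φ ψ : ℝ → ℝ → ℝ) : ℝ → ℝ → ℝ := dy φ * dy (dy ψ) - dy ψ * dy (dy φ)

/-- The coefficient of `(y' + r)²` in the numerator of `u''`. -/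
def numerator₂ (φ ψ : ℝ → ℝ → ℝ) : ℝ → ℝ → ℝ :=
  (3 : ℝ) • (jacobian φ ψ * logDerivY φ) - (2 : ℝ) • dy (jacobian φ ψ)

/-- The coefficient of `y' + r` in the numerator of `u''`. -/
def numerator₁ (φ ψ : ℝ → ℝ → ℝ) : ℝ → ℝ → ℝ :=
  (3 : ℝ) • (jacobian φ ψ * dy (ratio φ)) - dx (jacobian φ ψ) + ratio φ * dy (jacobian φ ψ)

/-- The coefficient of `(y' + r)⁰` in the numerator of `u''`. -/
def numerator₀ (φ ψ : ℝ → ℝ → ℝ) : ℝ → ℝ → ℝ :=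
  jacobian φ ψ * (dx (ratio φ) - ratio φ * dy (ratio φ))

/-- The frame data of a point transformation and a linear equation. -/
def frameData (φ ψ : ℝ → ℝ → ℝ) (a₃ a₂ a₁ a₀ b : ℝ → ℝ) (x y : ℝ) : FrameData where
  Δ := frameJet (ratio φ) (jacobian φ ψ) x y
  r := frameJet (ratio φ) (ratio φ) x y
  ry := frameJet (ratio φ) (dy (ratio φ)) x y
  L := frameJet (ratio φ) (logDerivY φ) x y
  w₀ := frameJet (ratio φ) (numerator₀ φ ψ) x y
  w₁ := frameJet (ratio φ) (numerator₁ φ ψ) x y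
  w₂ := frameJet (ratio φ) (numerator₂ φ ψ) x y
  w₃ := frameJet (ratio φ) (wronskianY φ ψ) x y
  a := dy φ x y
  c := dy ψ x y
  u := ψ x y
  a₃ := a₃ (φ x y)
  a₂ := a₂ (φ x y)
  a₁ := a₁ (φ x y)
  a₀ := a₀ (φ x y)
  b := b (φ x y)

variable {U : Set (ℝ × ℝ)} {φ ψ : ℝ → ℝ → ℝ} {x y : ℝ}

section

variable (hT : IsPointTransformation U φ ψ)
include hT

theorem IsPointTransformation.smoothOn_jacobian : SmoothOn 3 U (jacobian φ ψ) :=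
  ((hT.smoothOn_phi.dx (n := 3) hT.isOpen).mul (hT.smoothOn_psi.dy (n := 3) hT.isOpen)).sub
    ((hT.smoothOn_phi.dy (n := 3) hT.isOpen).mul (hT.smoothOn_psi.dx (n := 3) hT.isOpen))

theorem IsPointTransformation.smoothOn_wronskianY : SmoothOn 2 U (wronskianY φ ψ) :=
  have ha := hT.smoothOn_phi.dy (n := 3) hT.isOpen
  have hc := hT.smoothOn_psi.dy (n := 3) hT.isOpen
  ((ha.mono (by norm_num)).mul (hc.dy (n := 2) hT.isOpen)).sub
    ((hc.mono (by norm_num)).mul (ha.dy (n := 2) hT.isOpen))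

variable (hφ : ∀ x y, (x, y) ∈ U → dy φ x y ≠ 0)
include hφ

theorem IsPointTransformation.smoothOn_ratio : SmoothOn 3 U (ratio φ) :=
  (hT.smoothOn_phi.dx (n := 3) hT.isOpen).div (hT.smoothOn_phi.dy (n := 3) hT.isOpen) hφ

theorem IsPointTransformation.smoothOn_logDerivY : SmoothOn 2 U (logDerivY φ) :=
  have ha := hT.smoothOn_phi.dy (n := 3) hT.isOpen
  (ha.dy (n := 2) hT.isOpen).div (ha.mono (by norm_num)) hφ

theorem IsPointTransformation.smoothOn_numerator₂ : SmoothOn 2 U (numerator₂ φ ψ) :=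
  ((((hT.smoothOn_jacobian.mono (by norm_num)).mul (hT.smoothOn_logDerivY hφ))).const_smul 3).sub
    ((hT.smoothOn_jacobian.dy (n := 2) hT.isOpen).const_smul 2)

theorem IsPointTransformation.smoothOn_numerator₁ : SmoothOn 2 U (numerator₁ φ ψ) :=
  have hD := hT.smoothOn_jacobian
  have hr := hT.smoothOn_ratio hφ
  ((((hD.mono (by norm_num)).mul (hr.dy (n := 2) hT.isOpen)).const_smul 3).sub
    (hD.dx (n := 2) hT.isOpen)).add ((hr.mono (by norm_num)).mul (hD.dy (n := 2) hT.isOpen))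

theorem IsPointTransformation.smoothOn_numerator₀ : SmoothOn 2 U (numerator₀ φ ψ) :=
  have hD := hT.smoothOn_jacobian
  have hr := hT.smoothOn_ratio hφ
  (hD.mono (by norm_num)).mul ((hr.dx (n := 2) hT.isOpen).sub
    ((hr.mono (by norm_num)).mul (hr.dy (n := 2) hT.isOpen)))

/-- This and the next three lemmas differentiate `φ_x = r φ_y` and `ψ_x = r ψ_y - Δ/φ_y` in `y`.
They trade `x`-derivatives of `φ` and `ψ` for `y`-derivatives and for derivatives of `r` and `Δ`. -/
theorem IsPointTransformation.dx_dy_phi (hz : (x, y) ∈ U) :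
    dx (dy φ) x y = dy (ratio φ) x y * dy φ x y + ratio φ x y * dy (dy φ) x y := by
  have h : ∀ x y, (x, y) ∈ U → dx φ x y = (ratio φ * dy φ) x y := fun x y hz =>
    (div_mul_cancel₀ _ (hφ x y hz)).symm
  rw [hT.smoothOn_phi.dx_dy (n := 2) hT.isOpen hz, dy_congr hT.isOpen h hz,
    dy_mul hT.isOpen (hT.smoothOn_ratio hφ) (hT.smoothOn_phi.dy (n := 3) hT.isOpen) hz]

theorem IsPointTransformation.dx_dy_psi (hz : (x, y) ∈ U) :
    dx (dy ψ) x y = dy (ratio φ) x y * dy ψ x y + ratio φ x y * dy (dy ψ) x y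
      + (jacobian φ ψ x y * logDerivY φ x y - dy (jacobian φ ψ) x y) / dy φ x y := by
  have h : ∀ x y, (x, y) ∈ U → dx ψ x y = (ratio φ * dy ψ - jacobian φ ψ / dy φ) x y := by
    intro x y hz
    have := hφ x y hz
    simp only [Pi.sub_apply, Pi.mul_apply, Pi.div_apply, ratio, jacobian]
    field_simp
    ring
  have hr := hT.smoothOn_ratio hφ
  have hD := hT.smoothOn_jacobian
  have ha := hT.smoothOn_phi.dy (n := 3) hT.isOpen
  have hc := hT.smoothOn_psi.dy (n := 3) hT.isOpen
  have := hφ x y hz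
  rw [hT.smoothOn_psi.dx_dy (n := 2) hT.isOpen hz, dy_congr hT.isOpen h hz,
    dy_sub (n := 2) hT.isOpen (hr.mul hc) (hD.div ha hφ) hz, dy_mul (n := 2) hT.isOpen hr hc hz,
    dy_div (n := 2) hT.isOpen hD ha hz this]
  simp only [logDerivY, Pi.div_apply]
  field_simp
  ring

theorem IsPointTransformation.dx_dy_dy_phi (hz : (x, y) ∈ U) :
    dx (dy (dy φ)) x y = dy (dy (ratio φ)) x y * dy φ x y
      + 2 * dy (ratio φ) x y * dy (dy φ) x y + ratio φ x y * dy (dy (dy φ)) x y := by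
  have hU := hT.isOpen
  have hr := hT.smoothOn_ratio hφ
  have ha := hT.smoothOn_phi.dy (n := 3) hU
  have h : ∀ x y, (x, y) ∈ U →
      dx (dy φ) x y = (dy (ratio φ) * dy φ + ratio φ * dy (dy φ)) x y :=
    fun x y hz => hT.dx_dy_phi hφ hz
  have hr1 := hr.dy (n := 2) hU
  have ha1 := ha.dy (n := 2) hU
  have hr' : SmoothOn 2 U (ratio φ) := hr.mono (by norm_num)
  have ha' : SmoothOn 2 U (dy φ) := ha.mono (by norm_num)
  rw [ha.dx_dy (n := 1) hU hz, dy_congr hU h hz, dy_add (n := 1) hU (hr1.mul ha') (hr'.mul ha1) hz,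
    dy_mul (n := 1) hU hr1 ha' hz, dy_mul (n := 1) hU hr' ha1 hz]
  ring

theorem IsPointTransformation.dx_dy_dy_psi (hz : (x, y) ∈ U) :
    dx (dy (dy ψ)) x y = dy (dy (ratio φ)) x y * dy ψ x y
      + 2 * dy (ratio φ) x y * dy (dy ψ) x y + ratio φ x y * dy (dy (dy ψ)) x y
      + (dy (jacobian φ ψ) x y * logDerivY φ x y + jacobian φ ψ x y * dy (logDerivY φ) x y
          - dy (dy (jacobian φ ψ)) x y) / dy φ x y
      - (jacobian φ ψ x y * logDerivY φ x y - dy (jacobian φ ψ) x y) * logDerivY φ x y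
          / dy φ x y := by
  have hU := hT.isOpen
  have hr := hT.smoothOn_ratio hφ
  have ha := hT.smoothOn_phi.dy (n := 3) hU
  have hc := hT.smoothOn_psi.dy (n := 3) hU
  have hL := hT.smoothOn_logDerivY hφ
  have hD := hT.smoothOn_jacobian
  have h : ∀ x y, (x, y) ∈ U → dx (dy ψ) x y = (dy (ratio φ) * dy ψ + ratio φ * dy (dy ψ)
      + (jacobian φ ψ * logDerivY φ - dy (jacobian φ ψ)) / dy φ) x y :=
    fun x y hz => hT.dx_dy_psi hφ hz
  have hr1 := hr.dy (n := 2) hU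
  have hc1 := hc.dy (n := 2) hU
  have hD1 := hD.dy (n := 2) hU
  have hr' : SmoothOn 2 U (ratio φ) := hr.mono (by norm_num)
  have ha' : SmoothOn 2 U (dy φ) := ha.mono (by norm_num)
  have hc' : SmoothOn 2 U (dy ψ) := hc.mono (by norm_num)
  have hD' : SmoothOn 2 U (jacobian φ ψ) := hD.mono (by norm_num)
  have h0 := hφ x y hz
  rw [hc.dx_dy (n := 1) hU hz, dy_congr hU h hz,
    dy_add (n := 1) hU ((hr1.mul hc').add (hr'.mul hc1)) (((hD'.mul hL).sub hD1).div ha' hφ) hz,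
    dy_add (n := 1) hU (hr1.mul hc') (hr'.mul hc1) hz,
    dy_mul (n := 1) hU hr1 hc' hz, dy_mul (n := 1) hU hr' hc1 hz,
    dy_div (n := 1) hU ((hD'.mul hL).sub hD1) ha' hz h0,
    dy_sub (n := 1) hU (hD'.mul hL) hD1 hz, dy_mul (n := 1) hU hD' hL hz]
  simp only [Pi.sub_apply, Pi.mul_apply]
  have e : dy (dy φ) x y = logDerivY φ x y * dy φ x y := (div_mul_cancel₀ _ h0).symm
  rw [e]
  field_simp
  ring

theorem IsPointTransformation.dy_logDerivY (hz : (x, y) ∈ U) :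
    dy (logDerivY φ) x y =
      (dy (dy (dy φ)) x y * dy φ x y - dy (dy φ) x y * dy (dy φ) x y) / dy φ x y ^ 2 :=
  have ha := hT.smoothOn_phi.dy (n := 3) hT.isOpen
  dy_div (n := 1) hT.isOpen (ha.dy (n := 2) hT.isOpen) (ha.mono (by norm_num)) hz (hφ x y hz)

/-- With `X = ∂_x - r ∂_y` one has `Xφ_y = r_y φ_y` and `[X, ∂_y] = r_y ∂_y`. Applied to `L = ∂_y
log|φ_y|` this gives `XL = r_yy + r_y L`, from which the second-order jet of `L` is read off. -/
theorem IsPointTransformation.dx_logDerivY (hz : (x, y) ∈ U) :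
    dx (logDerivY φ) x y = ratio φ x y * dy (logDerivY φ) x y
      + (dy (dy (ratio φ)) + dy (ratio φ) * logDerivY φ) x y := by
  have ha := hT.smoothOn_phi.dy (n := 3) hT.isOpen
  have h0 := hφ x y hz
  have h1 : dx (logDerivY φ) x y =
      (dx (dy (dy φ)) x y * dy φ x y - dy (dy φ) x y * dx (dy φ) x y) / dy φ x y ^ 2 :=
    dx_div (n := 1) hT.isOpen (ha.dy (n := 2) hT.isOpen) (ha.mono (by norm_num)) hz (hφ x y hz)
  rw [h1, hT.dy_logDerivY hφ hz, hT.dx_dy_phi hφ hz, hT.dx_dy_dy_phi hφ hz]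
  simp only [logDerivY, Pi.add_apply, Pi.mul_apply, Pi.div_apply]
  field_simp
  ring

/-- Here `S = φ_y² ∂_y(ψ_y/φ_y)` and `X(ψ_y/φ_y) = (ΔL - Δ_y)/φ_y²`. The factor `φ_y²` contributes
`2 r_y S` and the commutator `r_y S`; the remaining terms are `∂_y(ΔL - Δ_y) - 2L(ΔL - Δ_y)`. -/
theorem IsPointTransformation.dx_wronskianY (hz : (x, y) ∈ U) :
    dx (wronskianY φ ψ) x y = ratio φ x y * dy (wronskianY φ ψ) x y
      + ((3 : ℝ) • (dy (ratio φ) * wronskianY φ ψ) - dy (dy (jacobian φ ψ))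
        + (3 : ℝ) • (dy (jacobian φ ψ) * logDerivY φ) + jacobian φ ψ * dy (logDerivY φ)
        - (2 : ℝ) • (jacobian φ ψ * (logDerivY φ * logDerivY φ))) x y := by
  have hU := hT.isOpen
  have ha := hT.smoothOn_phi.dy (n := 3) hU
  have hc := hT.smoothOn_psi.dy (n := 3) hU
  have ha1 := ha.dy (n := 2) hU
  have hc1 := hc.dy (n := 2) hU
  have ha' : SmoothOn 2 U (dy φ) := ha.mono (by norm_num)
  have hc' : SmoothOn 2 U (dy ψ) := hc.mono (by norm_num)
  have h0 := hφ x y hz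
  have h1 : dx (wronskianY φ ψ) x y = dx (dy φ) x y * dy (dy ψ) x y
      + dy φ x y * dx (dy (dy ψ)) x y - (dx (dy ψ) x y * dy (dy φ) x y
        + dy ψ x y * dx (dy (dy φ)) x y) := by
    rw [wronskianY, dx_sub (n := 1) hU (ha'.mul hc1) (hc'.mul ha1) hz,
      dx_mul (n := 1) hU ha' hc1 hz, dx_mul (n := 1) hU hc' ha1 hz]
  have h2 : dy (wronskianY φ ψ) x y = dy (dy φ) x y * dy (dy ψ) x y
      + dy φ x y * dy (dy (dy ψ)) x y - (dy (dy ψ) x y * dy (dy φ) x y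
        + dy ψ x y * dy (dy (dy φ)) x y) := by
    rw [wronskianY, dy_sub (n := 1) hU (ha'.mul hc1) (hc'.mul ha1) hz,
      dy_mul (n := 1) hU ha' hc1 hz, dy_mul (n := 1) hU hc' ha1 hz]
  rw [h1, h2, hT.dx_dy_phi hφ hz, hT.dx_dy_dy_phi hφ hz, hT.dx_dy_psi hφ hz,
    hT.dx_dy_dy_psi hφ hz]
  have e : dy (dy φ) x y = logDerivY φ x y * dy φ x y := (div_mul_cancel₀ _ h0).symm
  simp only [wronskianY, Pi.add_apply, Pi.sub_apply, Pi.mul_apply, Pi.smul_apply, smul_eq_mul, e]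
  field_simp
  ring

end

end Frame

/-! ### Derivatives of the frame quantities along a graph. -/

section AlongGraph

variable {U : Set (ℝ × ℝ)} {φ ψ g r : ℝ → ℝ → ℝ} {c c₁ c₂ c₃ : ℝ → ℝ} {x q s w : ℝ} {n : ℕ}

theorem SmoothOn.hasDerivAt_frameJet_v (hg : SmoothOn (n + 1) U g) (hU : IsOpen U)
    (hz : (x, c x) ∈ U) (hc : HasDerivAt c (c₁ x) x) :
    HasDerivAt (fun x => (frameJet r g x (c x)).v)
      ((frameJet r g x (c x)).deriv₁ (c₁ x + r x (c x))) x := by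
  rw [← total₁_eq_deriv₁]
  exact hg.hasDerivAt_total₀ hU hz hc

theorem SmoothOn.hasDerivAt_frameJet_deriv₁ (hg : SmoothOn (n + 2) U g) (hU : IsOpen U)
    (hz : (x, c x) ∈ U) (hc : HasDerivAt c (c₁ x) x) (hc₁ : HasDerivAt c₁ q x) :
    HasDerivAt (fun x => (frameJet r g x (c x)).deriv₁ (c₁ x + r x (c x)))
      ((frameJet r g x (c x)).deriv₂ (c₁ x + r x (c x)) q) x := by
  rw [← total₂_eq_deriv₂]
  simp only [← total₁_eq_deriv₁]
  exact hg.hasDerivAt_total₁ hU hz hc hc₁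

namespace IsPointTransformation

variable (hT : IsPointTransformation U φ ψ) (hφ : ∀ x y, (x, y) ∈ U → dy φ x y ≠ 0)
  (a₃ a₂ a₁ a₀ b : ℝ → ℝ) (hz : (x, c x) ∈ U) (hc : HasDerivAt c (c₁ x) x)
include hT hφ hz hc

/-- Along the graph of `c`, the derivative of `y' + r`. -/
theorem hasDerivAt_add_ratio (hc₁ : HasDerivAt c₁ q x) :
    HasDerivAt (fun x => c₁ x + ratio φ x (c x))
      ((frameData φ ψ a₃ a₂ a₁ a₀ b x (c x)).m₁ (c₁ x + ratio φ x (c x)) q) x :=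
  hc₁.add ((hT.smoothOn_ratio hφ).hasDerivAt_frameJet_v (n := 2) hT.isOpen hz hc)

theorem hasDerivAt_m₁ (hc₁ : HasDerivAt c₁ (c₂ x) x) (hc₂ : HasDerivAt c₂ s x) :
    HasDerivAt (fun x => (frameData φ ψ a₃ a₂ a₁ a₀ b x (c x)).m₁ (c₁ x + ratio φ x (c x)) (c₂ x))
      ((frameData φ ψ a₃ a₂ a₁ a₀ b x (c x)).m₂ (c₁ x + ratio φ x (c x)) (c₂ x) s) x :=
  hc₂.add ((hT.smoothOn_ratio hφ).hasDerivAt_frameJet_deriv₁ (n := 1) hT.isOpen hz hc hc₁)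

theorem hasDerivAt_π₁ (hc₁ : HasDerivAt c₁ (c₂ x) x) (hc₂ : HasDerivAt c₂ s x) :
    HasDerivAt (fun x => (frameData φ ψ a₃ a₂ a₁ a₀ b x (c x)).π₁ (c₁ x + ratio φ x (c x)) (c₂ x))
      ((frameData φ ψ a₃ a₂ a₁ a₀ b x (c x)).dπ₁ (c₁ x + ratio φ x (c x)) (c₂ x) s) x := by
  have hm := hasDerivAt_add_ratio hT hφ a₃ a₂ a₁ a₀ b hz hc hc₁
  have hm₁ := hasDerivAt_m₁ hT hφ a₃ a₂ a₁ a₀ b hz hc hc₁ hc₂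
  have hL := (hT.smoothOn_logDerivY hφ).hasDerivAt_frameJet_v (n := 1) (r := ratio φ)
    hT.isOpen hz hc
  have hr := ((hT.smoothOn_ratio hφ).dy (n := 2) hT.isOpen).hasDerivAt_frameJet_v (n := 1)
    (r := ratio φ) hT.isOpen hz hc
  refine (((hL.mul (hm.pow 2)).add (hr.mul hm)).add hm₁).congr_deriv ?_
  simp only [FrameData.dπ₁, frameData, Pi.pow_apply]
  simp only [frameJet, FrameJet.deriv₁, FrameData.m₁, FrameData.m₂]
  push_cast
  ring

theorem hasDerivAt_W (hc₁ : HasDerivAt c₁ (c₂ x) x) (hc₂ : HasDerivAt c₂ s x) :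
    HasDerivAt (fun x => (frameData φ ψ a₃ a₂ a₁ a₀ b x (c x)).W (c₁ x + ratio φ x (c x)) (c₂ x))
      ((frameData φ ψ a₃ a₂ a₁ a₀ b x (c x)).dW (c₁ x + ratio φ x (c x)) (c₂ x) s) x := by
  have hm := hasDerivAt_add_ratio hT hφ a₃ a₂ a₁ a₀ b hz hc hc₁
  have hD := hT.smoothOn_jacobian.hasDerivAt_frameJet_v (n := 2) (r := ratio φ) hT.isOpen hz hc
  have h0 := (hT.smoothOn_numerator₀ hφ).hasDerivAt_frameJet_v (n := 1) (r := ratio φ)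
    hT.isOpen hz hc
  have h1 := (hT.smoothOn_numerator₁ hφ).hasDerivAt_frameJet_v (n := 1) (r := ratio φ)
    hT.isOpen hz hc
  have h2 := (hT.smoothOn_numerator₂ hφ).hasDerivAt_frameJet_v (n := 1) (r := ratio φ)
    hT.isOpen hz hc
  have h3 := hT.smoothOn_wronskianY.hasDerivAt_frameJet_v (n := 1) (r := ratio φ) hT.isOpen hz hc
  refine (((((hD.mul hc₂).add (h3.mul (hm.pow 3))).add (h2.mul (hm.pow 2))).add
    (h1.mul hm)).add h0).congr_deriv ?_
  simp only [FrameData.dW, frameData, Pi.pow_apply]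
  push_cast
  ring

theorem hasDerivAt_dW (hc₁ : HasDerivAt c₁ (c₂ x) x) (hc₂ : HasDerivAt c₂ (c₃ x) x)
    (hc₃ : HasDerivAt c₃ w x) :
    HasDerivAt (fun x => (frameData φ ψ a₃ a₂ a₁ a₀ b x (c x)).dW (c₁ x + ratio φ x (c x)) (c₂ x)
        (c₃ x))
      ((frameData φ ψ a₃ a₂ a₁ a₀ b x (c x)).ddW (c₁ x + ratio φ x (c x)) (c₂ x) (c₃ x) w) x := by
  have hU := hT.isOpen
  have hm := hasDerivAt_add_ratio hT hφ a₃ a₂ a₁ a₀ b hz hc hc₁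
  have hm₁ := hasDerivAt_m₁ hT hφ a₃ a₂ a₁ a₀ b hz hc hc₁ hc₂
  have sD := hT.smoothOn_jacobian
  have s0 := hT.smoothOn_numerator₀ hφ
  have s1 := hT.smoothOn_numerator₁ hφ
  have s2 := hT.smoothOn_numerator₂ hφ
  have s3 := hT.smoothOn_wronskianY
  have hD := sD.hasDerivAt_frameJet_v (n := 2) (r := ratio φ) hU hz hc
  have h1 := s1.hasDerivAt_frameJet_v (n := 1) (r := ratio φ) hU hz hc
  have h2 := s2.hasDerivAt_frameJet_v (n := 1) (r := ratio φ) hU hz hc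
  have h3 := s3.hasDerivAt_frameJet_v (n := 1) (r := ratio φ) hU hz hc
  have hD' := sD.hasDerivAt_frameJet_deriv₁ (n := 1) (r := ratio φ) hU hz hc hc₁
  have h0' := s0.hasDerivAt_frameJet_deriv₁ (n := 0) (r := ratio φ) hU hz hc hc₁
  have h1' := s1.hasDerivAt_frameJet_deriv₁ (n := 0) (r := ratio φ) hU hz hc hc₁
  have h2' := s2.hasDerivAt_frameJet_deriv₁ (n := 0) (r := ratio φ) hU hz hc hc₁
  have h3' := s3.hasDerivAt_frameJet_deriv₁ (n := 0) (r := ratio φ) hU hz hc hc₁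
  refine (((((((hD'.mul hc₂).add (hD.mul hc₃)).add (h3'.mul (hm.pow 3))).add
    (h2'.mul (hm.pow 2))).add (h1'.mul hm)).add h0').add
    (((((h3.const_mul 3).mul (hm.pow 2)).add ((h2.const_mul 2).mul hm)).add h1).mul
      hm₁)).congr_deriv ?_
  simp only [FrameData.ddW, frameData, Pi.pow_apply, Pi.add_apply, Pi.mul_apply]
  push_cast
  ring

theorem hasDerivAt_dy_phi :
    HasDerivAt (fun x => dy φ x (c x)) (dy φ x (c x) *
      (logDerivY φ x (c x) * (c₁ x + ratio φ x (c x)) + dy (ratio φ) x (c x))) x := by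
  refine ((hT.smoothOn_phi.dy (n := 3) hT.isOpen).hasDerivAt_total₀ (n := 2) hT.isOpen hz
    hc).congr_deriv ?_
  rw [total₁, hT.dx_dy_phi hφ hz]
  have := hφ _ _ hz
  simp only [logDerivY, Pi.div_apply]
  field_simp
  ring

/-- The function differentiated is `u' = Dψ/Dφ`, since `Dψ = ψ_y m - Δ/φ_y` and `Dφ = φ_y m`. Its
derivative is `u''` times `φ_y m`. This is the origin of the coefficients of `W`: with `X = ∂_x - r
∂_y` they are `S`, `3ΔL - 2Δ_y`, `3Δ r_y - XΔ` and `Δ·Xr`. -/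
theorem hasDerivAt_first (hc₁ : HasDerivAt c₁ q x) (hm0 : c₁ x + ratio φ x (c x) ≠ 0) :
    HasDerivAt (fun x => dy ψ x (c x) / dy φ x (c x)
        - jacobian φ ψ x (c x) / (dy φ x (c x) ^ 2 * (c₁ x + ratio φ x (c x))))
      ((frameData φ ψ a₃ a₂ a₁ a₀ b x (c x)).W (c₁ x + ratio φ x (c x)) q /
        (dy φ x (c x) ^ 2 * (c₁ x + ratio φ x (c x)) ^ 2)) x := by
  have hm := hasDerivAt_add_ratio hT hφ a₃ a₂ a₁ a₀ b hz hc hc₁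
  have ha := hasDerivAt_dy_phi hT hφ hz hc
  have hcc := (hT.smoothOn_psi.dy (n := 3) hT.isOpen).hasDerivAt_total₀ (n := 2) hT.isOpen hz hc
  have hD := hT.smoothOn_jacobian.hasDerivAt_total₀ (n := 2) hT.isOpen hz hc
  have h0 := hφ _ _ hz
  refine ((hcc.div ha h0).sub (hD.div ((ha.pow 2).mul hm)
    (mul_ne_zero (pow_ne_zero 2 h0) hm0))).congr_deriv ?_
  simp only [Pi.pow_apply, Pi.mul_apply]
  rw [total₁, total₁, hT.dx_dy_psi hφ hz]
  have e : dy (dy φ) x (c x) = logDerivY φ x (c x) * dy φ x (c x) := (div_mul_cancel₀ _ h0).symm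
  simp only [FrameData.W, FrameData.m₁, frameData, frameJet, FrameJet.deriv₁, wronskianY,
    numerator₂, numerator₁, numerator₀, Pi.add_apply, Pi.sub_apply, Pi.mul_apply, Pi.smul_apply,
    smul_eq_mul, e]
  generalize ratio φ x (c x) = ρ at *
  -- Taking `m` rather than `y'` as the variable makes the two sides comparable as rational
  -- expressions.
  have e1 : c₁ x = (c₁ x + ρ) - ρ := by ring
  generalize c₁ x + ρ = m at *
  rw [e1]
  push_cast
  field_simp
  ring

end IsPointTransformation

end AlongGraph

/-! ### The second class when `φ_y ≠ 0`. -/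

section SecondForm

variable {U : Set (ℝ × ℝ)} {φ ψ : ℝ → ℝ → ℝ} {Ω : Set (ℝ × ℝ × ℝ × ℝ × ℝ)}
  {f : ℝ × ℝ × ℝ × ℝ × ℝ → ℝ} {a₃ a₂ a₁ a₀ b : ℝ → ℝ} {x₀ y₀ p q s w : ℝ} {u : ℝ → ℝ}

theorem total₁_phi_eq (hφ : dy φ x₀ y₀ ≠ 0) :
    total₁ φ x₀ y₀ p = dy φ x₀ y₀ * (p + ratio φ x₀ y₀) := by
  simp only [total₁, ratio]
  field_simp
  ring

theorem add_ratio_ne_zero (hφ : dy φ x₀ y₀ ≠ 0) (hP : total₁ φ x₀ y₀ p ≠ 0) :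
    p + ratio φ x₀ y₀ ≠ 0 := by
  rw [total₁_phi_eq hφ] at hP
  exact right_ne_zero_of_mul hP

/-- Along the graph of a quartic polynomial, the linear expression in `u` in terms of the frame
data. -/
theorem linear_eq_frameData_equation_div (hT : IsPointTransformation U φ ψ)
    (hφ : ∀ x y, (x, y) ∈ U → dy φ x y ≠ 0)
    (hz : (x₀, y₀) ∈ U) (hP : total₁ φ x₀ y₀ p ≠ 0) (hu : ContDiffAt ℝ 4 u (φ x₀ y₀))
    (huG : ∀ᶠ x in 𝓝 x₀, u (φ x (taylorQuartic x₀ y₀ p q s w x)) =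
      ψ x (taylorQuartic x₀ y₀ p q s w x)) :
    iteratedDeriv 4 u (φ x₀ y₀) + a₃ (φ x₀ y₀) * iteratedDeriv 3 u (φ x₀ y₀)
        + a₂ (φ x₀ y₀) * iteratedDeriv 2 u (φ x₀ y₀) + a₁ (φ x₀ y₀) * iteratedDeriv 1 u (φ x₀ y₀)
        + a₀ (φ x₀ y₀) * u (φ x₀ y₀) - b (φ x₀ y₀) =
      (frameData φ ψ a₃ a₂ a₁ a₀ b x₀ y₀).equation (p + ratio φ x₀ y₀) q s w /
        (dy φ x₀ y₀ ^ 5 * (p + ratio φ x₀ y₀) ^ 7) := by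
  set c := taylorQuartic x₀ y₀ p q s w with hc
  set c₁ := taylorQuartic x₀ p q s w 0 with hc₁
  set c₂ := taylorQuartic x₀ q s w 0 0 with hc₂
  set c₃ := taylorQuartic x₀ s w 0 0 0 with hc₃
  have h0 : ∀ x, HasDerivAt c (c₁ x) x := hasDerivAt_taylorQuartic _ _ _ _ _ _
  have h1 : ∀ x, HasDerivAt c₁ (c₂ x) x := hasDerivAt_taylorQuartic _ _ _ _ _ _
  have h2 : ∀ x, HasDerivAt c₂ (c₃ x) x := hasDerivAt_taylorQuartic _ _ _ _ _ _
  have h3 : ∀ x, HasDerivAt c₃ w x := fun x => by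
    simpa [taylorQuartic] using hasDerivAt_taylorQuartic x₀ s w 0 0 0 x
  have hU : ∀ᶠ x in 𝓝 x₀, (x, c x) ∈ U :=
    eventually_mem_graph hT.isOpen (h0 x₀).continuousAt (by simpa [hc] using hz)
  have hne := eventually_total₁_ne_zero (q := q) (s := s) (w := w) hT hz hP
  have hu0 : u (φ x₀ y₀) = ψ x₀ y₀ := by simpa [hc] using huG.self_of_nhds
  set d : ℝ → FrameData := fun x => frameData φ ψ a₃ a₂ a₁ a₀ b x (c x) with hd
  set a : ℝ → ℝ := fun x => dy φ x (c x) with ha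
  set m : ℝ → ℝ := fun x => c₁ x + ratio φ x (c x) with hm
  have hgood : ∀ᶠ x in 𝓝 x₀, (x, c x) ∈ U ∧ a x ≠ 0 ∧ m x ≠ 0 := by
    filter_upwards [hU, hne] with x hx hP
    exact ⟨hx, hφ _ _ hx, add_ratio_ne_zero (hφ _ _ hx) hP⟩
  have da : ∀ x, (x, c x) ∈ U → HasDerivAt a (a x * ((d x).L.v * m x + (d x).r.y)) x :=
    fun x hx => hT.hasDerivAt_dy_phi hφ hx (h0 x)
  have dm : ∀ x, (x, c x) ∈ U → HasDerivAt m ((d x).m₁ (m x) (c₂ x)) x :=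
    fun x hx => hT.hasDerivAt_add_ratio hφ a₃ a₂ a₁ a₀ b hx (h0 x) (h1 x)
  have dW : ∀ x, (x, c x) ∈ U → HasDerivAt (fun x => (d x).W (m x) (c₂ x))
      ((d x).dW (m x) (c₂ x) (c₃ x)) x :=
    fun x hx => hT.hasDerivAt_W hφ a₃ a₂ a₁ a₀ b hx (h0 x) (h1 x) (h2 x)
  have ddW : ∀ x, (x, c x) ∈ U → HasDerivAt (fun x => (d x).dW (m x) (c₂ x) (c₃ x))
      ((d x).ddW (m x) (c₂ x) (c₃ x) w) x :=
    fun x hx => hT.hasDerivAt_dW hφ a₃ a₂ a₁ a₀ b hx (h0 x) (h1 x) (h2 x) (h3 x)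
  have dπ : ∀ x, (x, c x) ∈ U → HasDerivAt (fun x => (d x).π₁ (m x) (c₂ x))
      ((d x).dπ₁ (m x) (c₂ x) (c₃ x)) x :=
    fun x hx => hT.hasDerivAt_π₁ hφ a₃ a₂ a₁ a₀ b hx (h0 x) (h1 x) (h2 x)
  -- Division by `P = a m` at each order gives the denominators `a³m³`, `a⁴m⁵`, `a⁵m⁷`. The power of
  -- `a` grows by only one at a time because `a'/a = L m + r_y` has no denominator in terms of `L`
  -- and `r_y`.
  obtain ⟨e1, e2, e3, e4⟩ := iteratedDeriv_of_comp (x₀ := x₀) (u := u)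
    (F := fun x => φ x (c x)) (G := fun x => ψ x (c x)) (P := fun x => a x * m x)
    (v₁ := fun x => dy ψ x (c x) / a x - jacobian φ ψ x (c x) / (a x ^ 2 * m x))
    (v₂ := fun x => (d x).W (m x) (c₂ x) / (a x ^ 3 * m x ^ 3))
    (v₃ := fun x => (d x).N₃ (m x) (c₂ x) (c₃ x) / (a x ^ 4 * m x ^ 5))
    (v₄ := fun x => (d x).N₄ (m x) (c₂ x) (c₃ x) w / (a x ^ 5 * m x ^ 7))
    (by simpa [hc] using hu) huG
    (hgood.mono fun x ⟨hx, hax, _⟩ =>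
      (hT.smoothOn_phi.hasDerivAt_total₀ (n := 3) hT.isOpen hx (h0 x)).congr_deriv
        (total₁_phi_eq hax))
    (hgood.mono fun x ⟨_, hax, hmx⟩ => mul_ne_zero hax hmx)
    (hgood.mono fun x ⟨hx, hax, hmx⟩ => by
      refine (hT.smoothOn_psi.hasDerivAt_total₀ (n := 3) hT.isOpen hx (h0 x)).congr_deriv ?_
      simp only [ha, hm] at hax hmx ⊢
      field_simp
      simp only [jacobian, total₁, ratio]
      field_simp
      ring)
    (hgood.mono fun x ⟨hx, hax, hmx⟩ => by
      refine (hT.hasDerivAt_first hφ a₃ a₂ a₁ a₀ b hx (h0 x) (h1 x) hmx).congr_deriv ?_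
      simp only [d, m, a] at *
      field_simp)
    (hgood.mono fun x ⟨hx, hax, hmx⟩ => by
      refine ((dW x hx).div (((da x hx).pow 3).mul ((dm x hx).pow 3))
        (mul_ne_zero (pow_ne_zero 3 hax) (pow_ne_zero 3 hmx))).congr_deriv ?_
      simp only [Pi.pow_apply, Pi.mul_apply, FrameData.N₃, FrameData.π₁]
      push_cast
      field_simp)
    (hgood.mono fun x ⟨hx, hax, hmx⟩ => by
      refine ((((dm x hx).mul (ddW x hx)).sub (((dπ x hx).const_mul 3).mul (dW x hx))).div
        (((da x hx).pow 4).mul ((dm x hx).pow 5))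
        (mul_ne_zero (pow_ne_zero 4 hax) (pow_ne_zero 5 hmx))).congr_deriv ?_
      simp only [Pi.pow_apply, Pi.mul_apply, Pi.sub_apply, FrameData.N₄]
      -- The left side is `m a'/a`. It arises four times from differentiating `a⁴`, each time
      -- multiplied by the numerator of `u'''`, hence the coefficient `-4 (m dW - 3 π₁ W)` below.
      have e : (d x).L.v * m x ^ 2 + (d x).r.y * m x =
          (d x).π₁ (m x) (c₂ x) - (d x).m₁ (m x) (c₂ x) := by
        simp only [FrameData.π₁]; ring
      push_cast
      field_simp
      linear_combination (-4 * (m x * (d x).dW (m x) (c₂ x) (c₃ x)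
        - 3 * (d x).π₁ (m x) (c₂ x) * (d x).W (m x) (c₂ x))) * e)
  have hm0 : m x₀ = p + ratio φ x₀ y₀ := by simp [hm, hc, hc₁]
  have ha0 : a x₀ = dy φ x₀ y₀ := by simp [ha, hc]
  have hd0 : d x₀ = frameData φ ψ a₃ a₂ a₁ a₀ b x₀ y₀ := by simp [hd, hc]
  simp only [hm0, ha0, hd0] at e1 e2 e3 e4
  simp only [hc, hc₂, hc₃, taylorQuartic_self] at e1 e2 e3 e4
  have hax := hφ _ _ hz
  have hmx := add_ratio_ne_zero hax hP
  rw [e1, e2, e3, e4, hu0, FrameData.equation]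
  have f1 : (frameData φ ψ a₃ a₂ a₁ a₀ b x₀ y₀).a = dy φ x₀ y₀ := rfl
  have f2 : (frameData φ ψ a₃ a₂ a₁ a₀ b x₀ y₀).c = dy ψ x₀ y₀ := rfl
  have f3 : (frameData φ ψ a₃ a₂ a₁ a₀ b x₀ y₀).u = ψ x₀ y₀ := rfl
  have f4 : (frameData φ ψ a₃ a₂ a₁ a₀ b x₀ y₀).a₃ = a₃ (φ x₀ y₀) := rfl
  have f5 : (frameData φ ψ a₃ a₂ a₁ a₀ b x₀ y₀).a₂ = a₂ (φ x₀ y₀) := rfl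
  have f6 : (frameData φ ψ a₃ a₂ a₁ a₀ b x₀ y₀).a₁ = a₁ (φ x₀ y₀) := rfl
  have f7 : (frameData φ ψ a₃ a₂ a₁ a₀ b x₀ y₀).a₀ = a₀ (φ x₀ y₀) := rfl
  have f8 : (frameData φ ψ a₃ a₂ a₁ a₀ b x₀ y₀).b = b (φ x₀ y₀) := rfl
  have f9 : (frameData φ ψ a₃ a₂ a₁ a₀ b x₀ y₀).Δ.v = jacobian φ ψ x₀ y₀ := rfl
  rw [f1, f2, f3, f4, f5, f6, f7, f8, f9]
  field_simp
  ring

theorem ObtainedFromLinear.hasSecondForm (hT : IsPointTransformation U φ ψ)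
    (hΩ : Ω ⊆ regularJets U φ) (h : ObtainedFromLinear Ω f φ ψ a₃ a₂ a₁ a₀ b)
    (hφ : ∀ x y, (x, y) ∈ U → dy φ x y ≠ 0) :
    HasSecondForm Ω f (centeredCoeffs (frameData φ ψ a₃ a₂ a₁ a₀ b)).expand := by
  intro x y p q s hj
  obtain ⟨u, hu, huG, hlin⟩ := h.exists_solution hT hΩ hj
  have hz : (x, y) ∈ U := (hΩ hj).1
  have hP : total₁ φ x y p ≠ 0 := (hΩ hj).2
  have hm := add_ratio_ne_zero (hφ x y hz) hP
  have := linear_eq_frameData_equation_div (a₃ := a₃) (a₂ := a₂) (a₁ := a₁) (a₀ := a₀) (b := b)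
    hT hφ hz hP hu huG
  rw [hlin, sub_self, eq_comm, div_eq_zero_iff, or_iff_left
    (mul_ne_zero (pow_ne_zero 5 (hφ x y hz)) (pow_ne_zero 7 hm))] at this
  exact ⟨hm, FrameData.secondForm_of_equation_eq_zero _ (hT.jacobian_ne_zero x y hz) hm this⟩

end SecondForm

/-! ### Reduction of the frame data to finitely many partial derivatives at a point. -/

/-- The partial derivatives at a point which enter the coefficients of the second class. -/
structure PointJet where
  (φy φyy φyyy φyyyy ψ ψy ψyy ψyyy ψyyyy Δ Δx Δy Δxx Δxy Δyy Δxxx Δxxy Δxyy Δyyy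
    r rx ry rxx rxy ryy rxxx rxxy rxyy ryyy α β : ℝ)

/-- The point jet of a point transformation and an equation in Laguerre's form. -/
def pointJet (φ ψ : ℝ → ℝ → ℝ) (α β : ℝ → ℝ) (x y : ℝ) : PointJet where
  φy := dy φ x y
  φyy := dy (dy φ) x y
  φyyy := dy (dy (dy φ)) x y
  φyyyy := dy (dy (dy (dy φ))) x y
  ψ := ψ x y
  ψy := dy ψ x y
  ψyy := dy (dy ψ) x y
  ψyyy := dy (dy (dy ψ)) x y
  ψyyyy := dy (dy (dy (dy ψ))) x y
  Δ := jacobian φ ψ x y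
  Δx := dx (jacobian φ ψ) x y
  Δy := dy (jacobian φ ψ) x y
  Δxx := dx (dx (jacobian φ ψ)) x y
  Δxy := dy (dx (jacobian φ ψ)) x y
  Δyy := dy (dy (jacobian φ ψ)) x y
  Δxxx := dx (dx (dx (jacobian φ ψ))) x y
  Δxxy := dy (dx (dx (jacobian φ ψ))) x y
  Δxyy := dy (dy (dx (jacobian φ ψ))) x y
  Δyyy := dy (dy (dy (jacobian φ ψ))) x y
  r := ratio φ x y
  rx := dx (ratio φ) x y
  ry := dy (ratio φ) x y
  rxx := dx (dx (ratio φ)) x y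
  rxy := dy (dx (ratio φ)) x y
  ryy := dy (dy (ratio φ)) x y
  rxxx := dx (dx (dx (ratio φ))) x y
  rxxy := dy (dx (dx (ratio φ))) x y
  rxyy := dy (dy (dx (ratio φ))) x y
  ryyy := dy (dy (dy (ratio φ))) x y
  α := α (φ x y)
  β := β (φ x y)

namespace PointJet

variable (j : PointJet)

/-- The frame jet with given partial derivatives. -/
def ofPartials (r g gx gy gxx gxy gyy : ℝ) : FrameJet :=
  ⟨g, gy, gx - r * gy, gyy, 2 * (gxy - r * gyy), gxx - 2 * r * gxy + r ^ 2 * gyy⟩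

/-- The `y`-derivative of `L = φ_yy / φ_y`. -/
def Ly : ℝ := (j.φyyy * j.φy - j.φyy * j.φyy) / j.φy ^ 2

/-- The second `y`-derivative of `L`. -/
def Lyy : ℝ := j.φyyyy / j.φy - 3 * j.φyyy * j.φyy / j.φy ^ 2 + 2 * j.φyy ^ 3 / j.φy ^ 3

/-- `L_x - r L_y`. -/
def LX : ℝ := j.ryy + j.ry * (j.φyy / j.φy)

/-- The `y`-derivative of `L_x - r L_y`. -/
def LXy : ℝ := j.ryyy + (j.ryy * (j.φyy / j.φy) + j.ry * j.Ly)

/-- The `x`-derivative of `L_x - r L_y`. -/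
def LXx : ℝ := j.rxyy + (j.rxy * (j.φyy / j.φy) + j.ry * (j.r * j.Ly + j.LX))

/-- `S = φ_y ψ_yy - ψ_y φ_yy`. -/
def S : ℝ := j.φy * j.ψyy - j.ψy * j.φyy

/-- The `y`-derivative of `S`. -/
def Sy : ℝ := j.φy * j.ψyyy - j.ψy * j.φyyy

/-- The second `y`-derivative of `S`. -/
def Syy : ℝ := j.φyy * j.ψyyy + j.φy * j.ψyyyy - (j.ψyy * j.φyyy + j.ψy * j.φyyyy)

/-- `S_x - r S_y`. -/
def SX : ℝ := 3 * (j.ry * j.S) - j.Δyy + 3 * (j.Δy * (j.φyy / j.φy)) + j.Δ * j.Ly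
  - 2 * (j.Δ * (j.φyy / j.φy * (j.φyy / j.φy)))

/-- The `y`-derivative of `S_x - r S_y`. -/
def SXy : ℝ := 3 * (j.ryy * j.S + j.ry * j.Sy) - j.Δyyy
  + 3 * (j.Δyy * (j.φyy / j.φy) + j.Δy * j.Ly) + (j.Δy * j.Ly + j.Δ * j.Lyy)
  - 2 * (j.Δy * (j.φyy / j.φy * (j.φyy / j.φy)) + j.Δ * (j.Ly * (j.φyy / j.φy)
    + j.φyy / j.φy * j.Ly))

/-- The `x`-derivative of `S_x - r S_y`. -/
def SXx : ℝ := 3 * (j.rxy * j.S + j.ry * (j.r * j.Sy + j.SX)) - j.Δxyy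
  + 3 * (j.Δxy * (j.φyy / j.φy) + j.Δy * (j.r * j.Ly + j.LX))
  + (j.Δx * j.Ly + j.Δ * (j.ry * j.Ly + j.r * j.Lyy + j.LXy))
  - 2 * (j.Δx * (j.φyy / j.φy * (j.φyy / j.φy))
    + j.Δ * ((j.r * j.Ly + j.LX) * (j.φyy / j.φy) + j.φyy / j.φy * (j.r * j.Ly + j.LX)))

/-- The frame jet of `Δ`. -/
def frameΔ : FrameJet := ofPartials j.r j.Δ j.Δx j.Δy j.Δxx j.Δxy j.Δyy

/-- The frame jet of `Δ_x`. -/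
def frameΔx : FrameJet := ofPartials j.r j.Δx j.Δxx j.Δxy j.Δxxx j.Δxxy j.Δxyy

/-- The frame jet of `Δ_y`. -/
def frameΔy : FrameJet := ofPartials j.r j.Δy j.Δxy j.Δyy j.Δxxy j.Δxyy j.Δyyy

/-- The frame jet of `r`. -/
def frameR : FrameJet := ofPartials j.r j.r j.rx j.ry j.rxx j.rxy j.ryy

/-- The frame jet of `r_x`. -/
def frameRx : FrameJet := ofPartials j.r j.rx j.rxx j.rxy j.rxxx j.rxxy j.rxyy

/-- The frame jet of `r_y`. -/
def frameRy : FrameJet := ofPartials j.r j.ry j.rxy j.ryy j.rxxy j.rxyy j.ryyy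

/-- The frame jet of `L`. -/
def frameL : FrameJet :=
  ⟨j.φyy / j.φy, j.Ly, j.LX, j.Lyy, 2 * (j.LXy + j.ry * j.Ly),
    (j.rx - j.r * j.ry) * j.Ly + (j.LXx - j.r * j.LXy)⟩

/-- The frame jet of `S`. -/
def frameS : FrameJet :=
  ⟨j.S, j.Sy, j.SX, j.Syy, 2 * (j.SXy + j.ry * j.Sy),
    (j.rx - j.r * j.ry) * j.Sy + (j.SXx - j.r * j.SXy)⟩

/-- The frame data determined by a point jet. -/
def frameData : FrameData where
  Δ := j.frameΔ
  r := j.frameR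
  ry := j.frameRy
  L := j.frameL
  w₀ := j.frameΔ * (j.frameRx - j.frameR * j.frameRy)
  w₁ := (3 : ℝ) • (j.frameΔ * j.frameRy) - j.frameΔx + j.frameR * j.frameΔy
  w₂ := (3 : ℝ) • (j.frameΔ * j.frameL) - (2 : ℝ) • j.frameΔy
  w₃ := j.frameS
  a := j.φy
  c := j.ψy
  u := j.ψ
  a₃ := 0
  a₂ := 0
  a₁ := j.α
  a₀ := j.β
  b := 0

end PointJet

namespace IsPointTransformation

variable {U : Set (ℝ × ℝ)} {φ ψ : ℝ → ℝ → ℝ} {x y : ℝ}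
  (hT : IsPointTransformation U φ ψ)
include hT

theorem dy_wronskianY (hz : (x, y) ∈ U) :
    dy (wronskianY φ ψ) x y = (dy φ * dy (dy (dy ψ)) - dy ψ * dy (dy (dy φ))) x y := by
  have hU := hT.isOpen
  have ha := hT.smoothOn_phi.dy (n := 3) hU
  have hc := hT.smoothOn_psi.dy (n := 3) hU
  have ha1 := ha.dy (n := 2) hU
  have hc1 := hc.dy (n := 2) hU
  have ha' : SmoothOn 2 U (dy φ) := ha.mono (by norm_num)
  have hc' : SmoothOn 2 U (dy ψ) := hc.mono (by norm_num)
  rw [wronskianY, dy_sub (n := 1) hU (ha'.mul hc1) (hc'.mul ha1) hz,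
    dy_mul (n := 1) hU ha' hc1 hz, dy_mul (n := 1) hU hc' ha1 hz]
  simp only [Pi.sub_apply, Pi.mul_apply]
  ring

theorem dy_dy_wronskianY (hz : (x, y) ∈ U) :
    dy (dy (wronskianY φ ψ)) x y = dy (dy φ) x y * dy (dy (dy ψ)) x y
      + dy φ x y * dy (dy (dy (dy ψ))) x y
      - (dy (dy ψ) x y * dy (dy (dy φ)) x y + dy ψ x y * dy (dy (dy (dy φ))) x y) := by
  have hU := hT.isOpen
  have ha := hT.smoothOn_phi.dy (n := 3) hU
  have hc := hT.smoothOn_psi.dy (n := 3) hU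
  have ha2 := (ha.dy (n := 2) hU).dy (n := 1) hU
  have hc2 := (hc.dy (n := 2) hU).dy (n := 1) hU
  have ha' : SmoothOn 1 U (dy φ) := ha.mono (by norm_num)
  have hc' : SmoothOn 1 U (dy ψ) := hc.mono (by norm_num)
  rw [dy_congr hU (fun _ _ h => hT.dy_wronskianY h) hz,
    dy_sub (n := 0) hU (ha'.mul hc2) (hc'.mul ha2) hz,
    dy_mul (n := 0) hU ha' hc2 hz, dy_mul (n := 0) hU hc' ha2 hz]

variable (hφ : ∀ x y, (x, y) ∈ U → dy φ x y ≠ 0)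
include hφ

theorem dy_dy_logDerivY (hz : (x, y) ∈ U) :
    dy (dy (logDerivY φ)) x y = dy (dy (dy (dy φ))) x y / dy φ x y
      - 3 * dy (dy (dy φ)) x y * dy (dy φ) x y / dy φ x y ^ 2
      + 2 * dy (dy φ) x y ^ 3 / dy φ x y ^ 3 := by
  have hU := hT.isOpen
  have ha := hT.smoothOn_phi.dy (n := 3) hU
  have ha1 := ha.dy (n := 2) hU
  have ha2 := ha1.dy (n := 1) hU
  have ha' : SmoothOn 1 U (dy φ) := ha.mono (by norm_num)
  have ha1' : SmoothOn 1 U (dy (dy φ)) := ha1.mono (by norm_num)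
  have h0 := hφ x y hz
  -- The square in the denominator is written as a product, so that the quotient and product rules
  -- for `dy` apply.
  have h : ∀ x y, (x, y) ∈ U → dy (logDerivY φ) x y =
      ((dy (dy (dy φ)) * dy φ - dy (dy φ) * dy (dy φ)) / (dy φ * dy φ)) x y := by
    intro x y hz
    rw [hT.dy_logDerivY hφ hz]
    simp only [Pi.div_apply, Pi.sub_apply, Pi.mul_apply, sq]
  rw [dy_congr hU h hz, dy_div (n := 0) hU ((ha2.mul ha').sub (ha1'.mul ha1')) (ha'.mul ha') hz
      (mul_ne_zero h0 h0), dy_sub (n := 0) hU (ha2.mul ha') (ha1'.mul ha1') hz,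
    dy_mul (n := 0) hU ha2 ha' hz, dy_mul (n := 0) hU ha1' ha1' hz,
    dy_mul (n := 0) hU ha' ha' hz]
  simp only [Pi.sub_apply, Pi.mul_apply]
  field_simp
  ring

theorem frameJet_logDerivY (α β : ℝ → ℝ) (hz : (x, y) ∈ U) :
    frameJet (ratio φ) (logDerivY φ) x y = (pointJet φ ψ α β x y).frameL := by
  have hU := hT.isOpen
  have hr := hT.smoothOn_ratio hφ
  have hr1 : SmoothOn 1 U (dy (ratio φ)) := (hr.dy (n := 2) hU).mono (by norm_num)
  have hr2 := (hr.dy (n := 2) hU).dy (n := 1) hU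
  have hL := hT.smoothOn_logDerivY hφ
  have hL1 : SmoothOn 1 U (logDerivY φ) := hL.mono (by norm_num)
  rw [frameJet_of_dx_eq hU hL (hr.mono (by norm_num)) (hr2.add (hr1.mul hL1))
    (fun x y hz => hT.dx_logDerivY hφ hz) hz,
    dy_add (n := 0) hU hr2 (hr1.mul hL1) hz, dx_add (n := 0) hU hr2 (hr1.mul hL1) hz,
    dy_mul (n := 0) hU hr1 hL1 hz, dx_mul (n := 0) hU hr1 hL1 hz,
    hT.dx_logDerivY hφ hz, hT.dy_logDerivY hφ hz, hT.dy_dy_logDerivY hφ hz,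
    hr.dx_dy_dy (n := 0) hU hz, (hr.mono (by norm_num) : SmoothOn (0 + 2) U _).dx_dy hU hz]
  rfl

theorem frameJet_wronskianY (α β : ℝ → ℝ) (hz : (x, y) ∈ U) :
    frameJet (ratio φ) (wronskianY φ ψ) x y = (pointJet φ ψ α β x y).frameS := by
  have hU := hT.isOpen
  have hr := hT.smoothOn_ratio hφ
  have hr1 : SmoothOn 1 U (dy (ratio φ)) := (hr.dy (n := 2) hU).mono (by norm_num)
  have hL := hT.smoothOn_logDerivY hφ
  have hL1 : SmoothOn 1 U (logDerivY φ) := hL.mono (by norm_num)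
  have hLy := hL.dy (n := 1) hU
  have hS := hT.smoothOn_wronskianY
  have hS1 : SmoothOn 1 U (wronskianY φ ψ) := hS.mono (by norm_num)
  have hD := hT.smoothOn_jacobian
  have hD1 : SmoothOn 1 U (jacobian φ ψ) := hD.mono (by norm_num)
  have hDy : SmoothOn 1 U (dy (jacobian φ ψ)) := (hD.dy (n := 2) hU).mono (by norm_num)
  have hDyy := (hD.dy (n := 2) hU).dy (n := 1) hU
  have t1 := (hr1.mul hS1).const_smul 3
  have t3 := (hDy.mul hL1).const_smul 3
  have t4 := hD1.mul hLy
  have t5 := (hD1.mul (hL1.mul hL1)).const_smul 2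
  have e1 := hr.dx_dy (n := 1) hU hz
  have e2 := hD.dx_dy (n := 1) hU hz
  -- The mixed derivative of `L` is the `y`-derivative of the formula for `L_x`, so no new
  -- derivative of `φ` in `x` appears.
  have e3 : dx (dy (logDerivY φ)) x y = dy (ratio φ) x y * dy (logDerivY φ) x y
      + ratio φ x y * dy (dy (logDerivY φ)) x y
      + (dy (dy (dy (ratio φ))) x y + (dy (dy (ratio φ)) x y * logDerivY φ x y
        + dy (ratio φ) x y * dy (logDerivY φ) x y)) := by
    have hr0 : SmoothOn 1 U (ratio φ) := hr.mono (by norm_num)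
    have hr2 := (hr.dy (n := 2) hU).dy (n := 1) hU
    have h : ∀ x y, (x, y) ∈ U → dx (logDerivY φ) x y = (ratio φ * dy (logDerivY φ)
      + (dy (dy (ratio φ)) + dy (ratio φ) * logDerivY φ)) x y :=
      fun x y hz => hT.dx_logDerivY hφ hz
    rw [hL.dx_dy (n := 0) hU hz, dy_congr hU h hz,
      dy_add (n := 0) hU (hr0.mul hLy) (hr2.add (hr1.mul hL1)) hz,
      dy_add (n := 0) hU hr2 (hr1.mul hL1) hz, dy_mul (n := 0) hU hr0 hLy hz,
      dy_mul (n := 0) hU hr1 hL1 hz]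
  rw [frameJet_of_dx_eq hU hS (hr.mono (by norm_num)) ((((t1.sub hDyy).add t3).add t4).sub t5)
    (fun x y hz => hT.dx_wronskianY hφ hz) hz,
    dy_sub (n := 0) hU (((t1.sub hDyy).add t3).add t4) t5 hz,
    dy_add (n := 0) hU ((t1.sub hDyy).add t3) t4 hz, dy_add (n := 0) hU (t1.sub hDyy) t3 hz,
    dy_sub (n := 0) hU t1 hDyy hz,
    dx_sub (n := 0) hU (((t1.sub hDyy).add t3).add t4) t5 hz,
    dx_add (n := 0) hU ((t1.sub hDyy).add t3) t4 hz, dx_add (n := 0) hU (t1.sub hDyy) t3 hz,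
    dx_sub (n := 0) hU t1 hDyy hz]
  simp only [dx_const_smul, dy_const_smul, Pi.smul_apply, smul_eq_mul, Pi.add_apply,
    Pi.sub_apply, Pi.mul_apply]
  rw [dy_mul (n := 0) hU hr1 hS1 hz, dx_mul (n := 0) hU hr1 hS1 hz,
    dy_mul (n := 0) hU hDy hL1 hz, dx_mul (n := 0) hU hDy hL1 hz,
    dy_mul (n := 0) hU hD1 hLy hz, dx_mul (n := 0) hU hD1 hLy hz,
    dy_mul (n := 0) hU hD1 (hL1.mul hL1) hz, dx_mul (n := 0) hU hD1 (hL1.mul hL1) hz,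
    dy_mul (n := 0) hU hL1 hL1 hz, dx_mul (n := 0) hU hL1 hL1 hz, hT.dx_wronskianY hφ hz,
    hD.dx_dy_dy (n := 0) hU hz, e1, e2, e3, hT.dx_logDerivY hφ hz, hT.dy_logDerivY hφ hz,
    hT.dy_dy_logDerivY hφ hz, hT.dy_wronskianY hz, hT.dy_dy_wronskianY hz]
  simp only [Pi.smul_apply, smul_eq_mul, Pi.add_apply, Pi.sub_apply, Pi.mul_apply,
    hT.dy_logDerivY hφ hz]
  rfl

/-- The coefficients `w₀, w₁, w₂` are built from `Δ`, `r`, `L` and first derivatives of `Δ` and `r`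
by operations that frame jets respect. Only `L` and `w₃ = S` need their own computation. -/
theorem frameData_eq (α β : ℝ → ℝ) (hz : (x, y) ∈ U) :
    frameData φ ψ (fun _ => 0) (fun _ => 0) α β (fun _ => 0) x y =
      (pointJet φ ψ α β x y).frameData := by
  have hU := hT.isOpen
  have hr := hT.smoothOn_ratio hφ
  have hr' : SmoothOn 2 U (ratio φ) := hr.mono (by norm_num)
  have hrx := hr.dx (n := 2) hU
  have hry := hr.dy (n := 2) hU
  have hL := hT.smoothOn_logDerivY hφ
  have hD := hT.smoothOn_jacobian
  have hD' : SmoothOn 2 U (jacobian φ ψ) := hD.mono (by norm_num)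
  have hDx := hD.dx (n := 2) hU
  have hDy := hD.dy (n := 2) hU
  have eD : frameJet (ratio φ) (dy (jacobian φ ψ)) x y = (pointJet φ ψ α β x y).frameΔy :=
    frameJet_dy hU hD hz
  have er : frameJet (ratio φ) (dy (ratio φ)) x y = (pointJet φ ψ α β x y).frameRy :=
    frameJet_dy hU hr hz
  have e2 : frameJet (ratio φ) (numerator₂ φ ψ) x y =
      (pointJet φ ψ α β x y).frameData.w₂ := by
    rw [numerator₂, frameJet_sub hU ((hD'.mul hL).const_smul 3) (hDy.const_smul 2) hz,
      frameJet_const_smul, frameJet_const_smul, frameJet_mul hU hD' hL hz, eD,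
      hT.frameJet_logDerivY hφ α β hz]
    rfl
  have e1 : frameJet (ratio φ) (numerator₁ φ ψ) x y =
      (pointJet φ ψ α β x y).frameData.w₁ := by
    rw [numerator₁, frameJet_add hU (((hD'.mul hry).const_smul 3).sub hDx) (hr'.mul hDy) hz,
      frameJet_sub hU ((hD'.mul hry).const_smul 3) hDx hz, frameJet_const_smul,
      frameJet_mul hU hD' hry hz, frameJet_mul hU hr' hDy hz, eD, er]
    rfl
  have e0 : frameJet (ratio φ) (numerator₀ φ ψ) x y =
      (pointJet φ ψ α β x y).frameData.w₀ := by
    rw [numerator₀, frameJet_mul hU hD' (hrx.sub (hr'.mul hry)) hz,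
      frameJet_sub hU hrx (hr'.mul hry) hz, frameJet_mul hU hr' hry hz, er]
    rfl
  rw [frameData, e0, e1, e2, er, hT.frameJet_logDerivY hφ α β hz,
    hT.frameJet_wronskianY hφ α β hz]
  rfl

end IsPointTransformation

/-! ### Comparison with the explicit coefficients of the second class. -/

section LaguerreCoefficients

variable {φ ψ : ℝ → ℝ → ℝ} {x y : ℝ}

set_option maxHeartbeats 8000000 in
/-- The coefficients `Fᵢ` of the transform of an equation in Laguerre's form. -/
theorem expand_centeredCoeffs_F (α β : ℝ → ℝ) (d : ℝ → ℝ → FrameData)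
    (hd : d x y = (pointJet φ ψ α β x y).frameData) (hφ : dy φ x y ≠ 0)
    (hΔ : jacobian φ ψ x y ≠ 0) :
    let c := (centeredCoeffs d).expand
    c.F₂ x y = LaguerreSecond.F₂ φ ψ x y ∧
    c.F₁ x y = LaguerreSecond.F₁ φ ψ x y ∧
    c.F₀ x y = LaguerreSecond.F₀ φ ψ x y := by
  refine ⟨?_, ?_, ?_⟩
  -- After unfolding, `r`, `Δ` and all partial derivatives are unrelated symbols, and each goal is
  -- an identity of rational functions with denominators in `φ_y` and `Δ` only.
  all_goals
    simp only [
      SecondCoeffs.expand, centeredCoeffs, hd, FrameData.F₂, LaguerreSecond.F₂, FrameData.F₁,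
      LaguerreSecond.F₁, FrameData.F₀, LaguerreSecond.F₀, PointJet.frameData, PointJet.frameΔ,
      PointJet.frameΔx, PointJet.frameΔy, PointJet.frameR, PointJet.frameRx, PointJet.frameRy,
      PointJet.frameL, PointJet.frameS, PointJet.ofPartials, FrameJet.add_def, FrameJet.sub_def,
      FrameJet.smul_def, FrameJet.mul_def, PointJet.SXx, PointJet.SXy, PointJet.SX, PointJet.Syy,
      PointJet.Sy, PointJet.S, PointJet.LXx, PointJet.LXy, PointJet.LX, PointJet.Lyy, PointJet.Ly,
      pointJet]
    field_simp
    ring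

set_option maxHeartbeats 8000000 in
/-- The coefficients `Hᵢ` of the transform of an equation in Laguerre's form. -/
theorem expand_centeredCoeffs_H (α β : ℝ → ℝ) (d : ℝ → ℝ → FrameData)
    (hd : d x y = (pointJet φ ψ α β x y).frameData) (hφ : dy φ x y ≠ 0)
    (hΔ : jacobian φ ψ x y ≠ 0) :
    let c := (centeredCoeffs d).expand
    c.H₂ x y = LaguerreSecond.H₂ φ ψ x y ∧
    c.H₁ x y = LaguerreSecond.H₁ φ ψ x y ∧
    c.H₀ x y = LaguerreSecond.H₀ φ ψ x y := by
  refine ⟨?_, ?_, ?_⟩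
  all_goals
    simp only [
      SecondCoeffs.expand, centeredCoeffs, hd, FrameData.H₂, LaguerreSecond.H₂, FrameData.H₁,
      LaguerreSecond.H₁, FrameData.H₀, LaguerreSecond.H₀, PointJet.frameData, PointJet.frameΔ,
      PointJet.frameΔx, PointJet.frameΔy, PointJet.frameR, PointJet.frameRx, PointJet.frameRy,
      PointJet.frameL, PointJet.frameS, PointJet.ofPartials, FrameJet.add_def, FrameJet.sub_def,
      FrameJet.smul_def, FrameJet.mul_def, PointJet.SXx, PointJet.SXy, PointJet.SX, PointJet.Syy,
      PointJet.Sy, PointJet.S, PointJet.LXx, PointJet.LXy, PointJet.LX, PointJet.Lyy, PointJet.Ly,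
      pointJet]
    field_simp
    ring

set_option maxHeartbeats 8000000 in
/-- The coefficients `Jᵢ` of the transform of an equation in Laguerre's form. -/
theorem expand_centeredCoeffs_J (α β : ℝ → ℝ) (d : ℝ → ℝ → FrameData)
    (hd : d x y = (pointJet φ ψ α β x y).frameData) (hφ : dy φ x y ≠ 0)
    (hΔ : jacobian φ ψ x y ≠ 0) :
    let c := (centeredCoeffs d).expand
    c.J₄ x y = LaguerreSecond.J₄ φ ψ x y ∧
    c.J₃ x y = LaguerreSecond.J₃ φ ψ x y ∧
    c.J₂ x y = LaguerreSecond.J₂ φ ψ x y ∧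
    c.J₁ x y = LaguerreSecond.J₁ φ ψ x y ∧
    c.J₀ x y = LaguerreSecond.J₀ φ ψ x y := by
  refine ⟨?_, ?_, ?_, ?_, ?_⟩
  all_goals
    simp only [
      SecondCoeffs.expand, centeredCoeffs, hd, FrameData.J₄, LaguerreSecond.J₄, FrameData.J₃,
      LaguerreSecond.J₃, FrameData.J₂, LaguerreSecond.J₂, FrameData.J₁, LaguerreSecond.J₁,
      FrameData.J₀, LaguerreSecond.J₀, PointJet.frameData, PointJet.frameΔ, PointJet.frameΔx,
      PointJet.frameΔy, PointJet.frameR, PointJet.frameRx, PointJet.frameRy, PointJet.frameL,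
      PointJet.frameS, PointJet.ofPartials, FrameJet.add_def, FrameJet.sub_def, FrameJet.smul_def,
      FrameJet.mul_def, PointJet.SXx, PointJet.SXy, PointJet.SX, PointJet.Syy, PointJet.Sy,
      PointJet.S, PointJet.LXx, PointJet.LXy, PointJet.LX, PointJet.Lyy, PointJet.Ly, pointJet]
    field_simp
    ring

set_option maxHeartbeats 8000000 in
/-- The coefficients `Kᵢ` of the transform of an equation in Laguerre's form. -/
theorem expand_centeredCoeffs_K (α β : ℝ → ℝ) (d : ℝ → ℝ → FrameData)
    (hd : d x y = (pointJet φ ψ α β x y).frameData) (hφ : dy φ x y ≠ 0)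
    (hΔ : jacobian φ ψ x y ≠ 0) :
    let c := (centeredCoeffs d).expand
    c.K₇ x y = LaguerreSecond.K₇ φ ψ α β x y ∧
    c.K₆ x y = LaguerreSecond.K₆ φ ψ α β x y ∧
    c.K₅ x y = LaguerreSecond.K₅ φ ψ α β x y ∧
    c.K₄ x y = LaguerreSecond.K₄ φ ψ α β x y ∧
    c.K₃ x y = LaguerreSecond.K₃ φ ψ α β x y ∧
    c.K₂ x y = LaguerreSecond.K₂ φ ψ α β x y ∧
    c.K₁ x y = LaguerreSecond.K₁ φ ψ α β x y ∧
    c.K₀ x y = LaguerreSecond.K₀ φ ψ α β x y := by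
  refine ⟨?_, ?_, ?_, ?_, ?_, ?_, ?_, ?_⟩
  all_goals
    simp only [
      SecondCoeffs.expand, centeredCoeffs, hd, FrameData.K₇, LaguerreSecond.K₇, FrameData.K₆,
      LaguerreSecond.K₆, FrameData.K₅, LaguerreSecond.K₅, FrameData.K₄, LaguerreSecond.K₄,
      FrameData.K₃, LaguerreSecond.K₃, FrameData.K₂, LaguerreSecond.K₂, FrameData.K₁,
      LaguerreSecond.K₁, FrameData.K₀, LaguerreSecond.K₀, PointJet.frameData, PointJet.frameΔ,
      PointJet.frameΔx, PointJet.frameΔy, PointJet.frameR, PointJet.frameRx, PointJet.frameRy,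
      PointJet.frameL, PointJet.frameS, PointJet.ofPartials, FrameJet.add_def, FrameJet.sub_def,
      FrameJet.smul_def, FrameJet.mul_def, PointJet.SXx, PointJet.SXy, PointJet.SX, PointJet.Syy,
      PointJet.Sy, PointJet.S, PointJet.LXx, PointJet.LXy, PointJet.LX, PointJet.Lyy, PointJet.Ly,
      pointJet]
    field_simp
    ring

end LaguerreCoefficients

/-- The jets of `Ω` lie over `U`, so coefficients need to agree only there. -/
theorem HasSecondForm.congr {U : Set (ℝ × ℝ)} {φ : ℝ → ℝ → ℝ}
    {Ω : Set (ℝ × ℝ × ℝ × ℝ × ℝ)} (hΩ : Ω ⊆ regularJets U φ)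
    {f : ℝ × ℝ × ℝ × ℝ × ℝ → ℝ} {c c' : SecondCoeffs} (h : HasSecondForm Ω f c)
    (hr : ∀ x y, (x, y) ∈ U → c.r x y = c'.r x y)
    (hF : ∀ x y, (x, y) ∈ U →
      c.F₂ x y = c'.F₂ x y ∧ c.F₁ x y = c'.F₁ x y ∧ c.F₀ x y = c'.F₀ x y)
    (hH : ∀ x y, (x, y) ∈ U →
      c.H₂ x y = c'.H₂ x y ∧ c.H₁ x y = c'.H₁ x y ∧ c.H₀ x y = c'.H₀ x y)
    (hJ : ∀ x y, (x, y) ∈ U → c.J₄ x y = c'.J₄ x y ∧ c.J₃ x y = c'.J₃ x y ∧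
      c.J₂ x y = c'.J₂ x y ∧ c.J₁ x y = c'.J₁ x y ∧ c.J₀ x y = c'.J₀ x y)
    (hK : ∀ x y, (x, y) ∈ U → c.K₇ x y = c'.K₇ x y ∧ c.K₆ x y = c'.K₆ x y ∧
      c.K₅ x y = c'.K₅ x y ∧ c.K₄ x y = c'.K₄ x y ∧ c.K₃ x y = c'.K₃ x y ∧
      c.K₂ x y = c'.K₂ x y ∧ c.K₁ x y = c'.K₁ x y ∧ c.K₀ x y = c'.K₀ x y) :
    HasSecondForm Ω f c' := by
  intro x y p q s hj
  have hz : (x, y) ∈ U := (hΩ hj).1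
  obtain ⟨f2, f1, f0⟩ := hF x y hz
  obtain ⟨h2, h1, h0⟩ := hH x y hz
  obtain ⟨j4, j3, j2, j1, j0⟩ := hJ x y hz
  obtain ⟨k7, k6, k5, k4, k3, k2, k1, k0⟩ := hK x y hz
  have := h x y p q s hj
  rwa [hr x y hz, f2, f1, f0, h2, h1, h0, j4, j3, j2, j1, j0, k7, k6, k5, k4, k3, k2, k1,
    k0] at this

theorem ObtainedFromLaguerre.hasSecondForm {U : Set (ℝ × ℝ)} {φ ψ : ℝ → ℝ → ℝ}
    (hT : IsPointTransformation U φ ψ) {Ω : Set (ℝ × ℝ × ℝ × ℝ × ℝ)}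
    (hΩ : Ω ⊆ regularJets U φ) {f : ℝ × ℝ × ℝ × ℝ × ℝ → ℝ} {α β : ℝ → ℝ}
    (h : ObtainedFromLaguerre Ω f φ ψ α β) (hφ : ∀ x y, (x, y) ∈ U → dy φ x y ≠ 0) :
    HasSecondForm Ω f (secondCoeffs φ ψ α β) := by
  have hd (x y : ℝ) (hz : (x, y) ∈ U) := hT.frameData_eq hφ α β hz
  have hΔ := hT.jacobian_ne_zero
  exact (ObtainedFromLinear.hasSecondForm hT hΩ h hφ).congr hΩ (fun _ _ _ => rfl)
    (fun x y hz => expand_centeredCoeffs_F α β _ (hd x y hz) (hφ x y hz) (hΔ x y hz))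
    (fun x y hz => expand_centeredCoeffs_H α β _ (hd x y hz) (hφ x y hz) (hΔ x y hz))
    (fun x y hz => expand_centeredCoeffs_J α β _ (hd x y hz) (hφ x y hz) (hΔ x y hz))
    (fun x y hz => expand_centeredCoeffs_K α β _ (hd x y hz) (hφ x y hz) (hΔ x y hz))

/-! ### Restriction to open subsets, and the case of arbitrary `φ`. -/

theorem IsPointTransformation.mono {U V : Set (ℝ × ℝ)} {φ ψ : ℝ → ℝ → ℝ}
    (hT : IsPointTransformation U φ ψ) (hV : IsOpen V) (hVU : V ⊆ U) :
    IsPointTransformation V φ ψ :=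
  ⟨hV, hT.contDiffOn_phi.mono hVU, hT.contDiffOn_psi.mono hVU,
    fun x y h => hT.jacobian_ne_zero x y (hVU h)⟩

theorem ObtainedFromLinear.mono {Ω Ω' : Set (ℝ × ℝ × ℝ × ℝ × ℝ)}
    {f : ℝ × ℝ × ℝ × ℝ × ℝ → ℝ} {φ ψ : ℝ → ℝ → ℝ} {a₃ a₂ a₁ a₀ b : ℝ → ℝ}
    (h : ObtainedFromLinear Ω f φ ψ a₃ a₂ a₁ a₀ b) (hΩ : Ω' ⊆ Ω) :
    ObtainedFromLinear Ω' f φ ψ a₃ a₂ a₁ a₀ b :=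
  fun x₀ t₀ y u ht hy hu he hj => h x₀ t₀ y u ht hy hu he (hΩ hj)

theorem sep_subset_regularJets {U V : Set (ℝ × ℝ)} {φ : ℝ → ℝ → ℝ}
    {Ω : Set (ℝ × ℝ × ℝ × ℝ × ℝ)} (hΩ : Ω ⊆ regularJets U φ) :
    {j ∈ Ω | (j.1, j.2.1) ∈ V} ⊆ regularJets V φ :=
  fun _ hj => ⟨hj.2, (hΩ hj.1).2⟩

/-- In an open set, the points where a function does not vanish together with the interior of its
zero set are dense. -/
theorem subset_closure_ne_zero_union_interior {X : Type*} [TopologicalSpace X] {U : Set X}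
    (hU : IsOpen U) (g : X → ℝ) :
    U ⊆ closure ({z ∈ U | g z ≠ 0} ∪ interior {z ∈ U | g z = 0}) := by
  intro z hz
  by_contra hc
  -- A point outside the closure has a neighbourhood in `U` that avoids `{g ≠ 0}`. So `g` vanishes
  -- on it, and the point lies in the interior of the zero set after all.
  refine hc (subset_closure (Or.inr (mem_interior_iff_mem_nhds.2 ?_)))
  filter_upwards [isClosed_closure.isOpen_compl.mem_nhds hc, hU.mem_nhds hz] with w hw hwU
  exact ⟨hwU, by_contra fun h => hw (subset_closure (Or.inl ⟨hwU, h⟩))⟩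

/-- The set `{φ_y ≠ 0}` is open by continuity of `φ_y`, and together with the interior of `{φ_y =
0}` it is dense. One of these two sets serves as the neighbourhood of every point in it. -/
theorem ObtainedFromLinear.exists_dense_local_forms {U : Set (ℝ × ℝ)} {φ ψ : ℝ → ℝ → ℝ}
    (hT : IsPointTransformation U φ ψ) {Ω : Set (ℝ × ℝ × ℝ × ℝ × ℝ)}
    (hΩ : Ω ⊆ regularJets U φ) {f : ℝ × ℝ × ℝ × ℝ × ℝ → ℝ} {a₃ a₂ a₁ a₀ b : ℝ → ℝ}
    (h : ObtainedFromLinear Ω f φ ψ a₃ a₂ a₁ a₀ b) :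
    ∃ W ⊆ U, IsOpen W ∧ U ⊆ closure W ∧ ∀ z ∈ W, ∃ V ⊆ W, IsOpen V ∧ z ∈ V ∧
      ((∃ c : FirstCoeffs, HasFirstForm {j ∈ Ω | (j.1, j.2.1) ∈ V} f c) ∨
        (∃ c : SecondCoeffs, HasSecondForm {j ∈ Ω | (j.1, j.2.1) ∈ V} f c)) := by
  set V₁ : Set (ℝ × ℝ) := {z ∈ U | dy φ z.1 z.2 ≠ 0} with hV₁
  set V₀ : Set (ℝ × ℝ) := interior {z ∈ U | dy φ z.1 z.2 = 0} with hV₀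
  have hV₁U : V₁ ⊆ U := fun z hz => hz.1
  have hV₀' : V₀ ⊆ {z ∈ U | dy φ z.1 z.2 = 0} := interior_subset
  have hV₀U : V₀ ⊆ U := fun z hz => (hV₀' hz).1
  have hcont : ContinuousOn (fun z : ℝ × ℝ => dy φ z.1 z.2) U :=
    (hT.smoothOn_phi.dy (n := 3) hT.isOpen).continuousOn
  have hV₁o : IsOpen V₁ := hcont.isOpen_inter_preimage hT.isOpen isOpen_ne
  have hV₀o : IsOpen V₀ := isOpen_interior
  refine ⟨V₁ ∪ V₀, Set.union_subset hV₁U hV₀U, hV₁o.union hV₀o,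
    subset_closure_ne_zero_union_interior hT.isOpen _, ?_⟩
  rintro z (hz | hz)
  · exact ⟨V₁, Set.subset_union_left, hV₁o, hz, Or.inr ⟨_,
      (h.mono (Set.sep_subset _ _)).hasSecondForm (hT.mono hV₁o hV₁U)
        (sep_subset_regularJets hΩ) fun x y hxy => hxy.2⟩⟩
  · exact ⟨V₀, Set.subset_union_right, hV₀o, hz, Or.inl ⟨_,
      (h.mono (Set.sep_subset _ _)).hasFirstForm (hT.mono hV₀o hV₀U)
        (sep_subset_regularJets hΩ) fun x y hxy => (hV₀' hxy).2⟩⟩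

end FourthOrder

end

theorem mainTheorem3
    (U : Set (ℝ × ℝ)) (φ ψ : ℝ → ℝ → ℝ) (hT : FourthOrder.IsPointTransformation U φ ψ)
    (Ω : Set (ℝ × ℝ × ℝ × ℝ × ℝ)) (hΩ : Ω ⊆ FourthOrder.regularJets U φ)
    (f : ℝ × ℝ × ℝ × ℝ × ℝ → ℝ) :
    (∀ a₃ a₂ a₁ a₀ b : ℝ → ℝ, FourthOrder.ObtainedFromLinear Ω f φ ψ a₃ a₂ a₁ a₀ b →
      ((∀ z ∈ U, FourthOrder.dy φ z.1 z.2 = 0) →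
        ∃ c : FourthOrder.FirstCoeffs, FourthOrder.HasFirstForm Ω f c) ∧
      ((∀ z ∈ U, FourthOrder.dy φ z.1 z.2 ≠ 0) →
        ∃ c : FourthOrder.SecondCoeffs, c.r = FourthOrder.ratio φ ∧
          FourthOrder.HasSecondForm Ω f c) ∧
      (∃ W ⊆ U, IsOpen W ∧ U ⊆ closure W ∧ ∀ z ∈ W, ∃ V ⊆ W, IsOpen V ∧ z ∈ V ∧
        ((∃ c : FourthOrder.FirstCoeffs,
            FourthOrder.HasFirstForm {j ∈ Ω | (j.1, j.2.1) ∈ V} f c) ∨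
          (∃ c : FourthOrder.SecondCoeffs,
            FourthOrder.HasSecondForm {j ∈ Ω | (j.1, j.2.1) ∈ V} f c))) ∧
      FourthOrder.IsLinearInThirdDerivative Ω f) ∧
    (∀ α β : ℝ → ℝ, FourthOrder.ObtainedFromLaguerre Ω f φ ψ α β →
      ((∀ z ∈ U, FourthOrder.dy φ z.1 z.2 = 0) →
        FourthOrder.HasFirstForm Ω f (FourthOrder.firstCoeffs φ ψ α β)) ∧
      ((∀ z ∈ U, FourthOrder.dy φ z.1 z.2 ≠ 0) →
        FourthOrder.HasSecondForm Ω f (FourthOrder.secondCoeffs φ ψ α β))) := by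
  -- The `rfl` for `c.r` works because expansion in powers of `y'` keeps `r`, which is the value
  -- slot of its own frame jet.
  refine ⟨fun a₃ a₂ a₁ a₀ b h => ⟨fun hφ => ⟨_, h.hasFirstForm hT hΩ fun x y hz => hφ (x, y) hz⟩,
      fun hφ => ⟨_, rfl, h.hasSecondForm hT hΩ fun x y hz => hφ (x, y) hz⟩,
      h.exists_dense_local_forms hT hΩ, h.isLinearInThirdDerivative hT hΩ⟩,
    fun α β h => ⟨fun hφ => h.hasFirstForm hT hΩ fun x y hz => hφ (x, y) hz,
      fun hφ => h.hasSecondForm hT hΩ fun x y hz => hφ (x, y) hz⟩⟩
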